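/- Let $(X_1,Y_1),(X_2,Y_2),\dots$ be independent and identically distributed pairs of real random variables. Given $X=x$, the response $Y$ has the exponential-family density $f_{Y|X}(y;\theta(x))=\exp[\{y\,\theta(x)-b(\theta(x))\}/a(\psi)+c(y,\psi)]$ with respect to a fixed $\sigma$-finite measure, where $a(\psi)>0$ and the canonical parameter ranges over an open interval $\Theta\subseteq\mathbb R$ (possibly all of $\mathbb R$). Fix a degree $p\ge 0$ and assume: (i) $b''$ is continuous on $\Theta$ and bounded away from zero on $\{\theta(x):x\in\Omega_X\}\subseteq\Theta$; (ii) the kernel $K$ is a symmetric, Lipschitz continuous probability density with bounded support; (iii) $X$ has bounded support $\Omega_X$ (a compact interval of positive length or, more generally, a finite union of such intervals) and a density $f_X$ that is Lipschitz continuous and bounded away from $0$ on $\Omega_X$; (iv) $\theta$ has a continuous $(p+1)$-th derivative on $\Omega_X$. For a bandwidth $h>0$ put $K_h(t)=K(t/h)/h$ and $\mathbf x_j(x)=(1,X_j-x,\dots,(X_j-x)^p)^T$. Let $\widehat\beta(x)$ be the local maximum likelihood estimator based on the first $n$ observations, that is, a maximizer over $\beta\in\mathbb R^{p+1}$ of $\sum_{j=1}^n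 \ln f_{Y|X}(Y_j;\mathbf x_j(x)^T\beta)\,K_h(X_j-x)$, subject to $\mathbf x_j(x)^T\beta\in\Theta$ for every $j$ with $K_h(X_j-x)\neq0$ (if no maximizer exists, any $\beta$ satisfying these constraints). Let $\mathbf X(x)$ be the matrix with rows $\mathbf x_j(x)^T$, $\mathbf W(x;\beta)=\mathrm{diag}\{K_h(X_j-x)\,b''(\mathbf x_j(x)^T\beta)\}_{j=1}^n$ and $S_n(x;\beta)=\mathbf X(x)^T\mathbf W(x;\beta)\mathbf X(x)$, and let $H_i$ be the $i$-th diagonal entry of $$\mathcal H(x;\beta)=\mathbf W(x;\beta)^{1/2}\,\mathbf X(x)\,S_n(x;\beta)^{-1}\,\mathbf X(x)^T\,\mathbf W(x;\beta)^{1/2}$$ at $x=X_i$, $\beta=\widehat\beta(X_i)$ (with $H_i=0$ if $S_n$ is singular there). Let $S=(\mu_{i+j-2})_{1\le i,j\le p+1}$ with $\mu_k=\int t^kK(t)\,dt$, and let the equivalent kernel $\mathcal K(t)$ be the first entry of $S^{-1}(1,t,\dots,t^p)^TK(t)$. If $h=h_n>0$ is a deterministic sequence with $h\to0$ and $nh\to\infty$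 as $n\to\infty$, then the degrees of freedom satisfy $$\sum_{i=1}^n H_i=\frac{\mathcal K(0)\,|\Omega_X|}{h}\,\{1+o_P(1)\},$$ where $|\Omega_X|$ is the length of $\Omega_X$. -/

import Mathlib

open MeasureTheory Filter Topology

noncomputable section

namespace LocalLikelihood

/-- The conditional density `exp [{y t - b(t)} / a(ψ) + c(y, ψ)]` of an exponential family
with canonical parameter `t` and dispersion parameter `ψ`. -/
def expDensity (a b : ℝ → ℝ) (c : ℝ → ℝ → ℝ) (ψ : ℝ) (t y : ℝ) : ℝ :=
  Real.exp ((y * t - b t) / a ψ + c y ψ)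

/-- A one-parameter exponential family in canonical form (the dispersion `ψ` being fixed),
with densities taken with respect to a sigma-finite measure `ν` on the line (for instance
Lebesgue or counting measure) and with an open interval `Θ` of canonical parameters. -/
structure ExpFamily where
  ν : Measure ℝ
  sigmaFinite : SigmaFinite ν
  a : ℝ → ℝ
  b : ℝ → ℝ
  c : ℝ → ℝ → ℝ
  ψ : ℝ
  Θ : Set ℝ
  a_pos : 0 < a ψ
  measurable_c : Measurable fun y => c y ψ
  isOpen_Θ : IsOpen Θ
  convex_Θ : Convex ℝ Θ
  lintegral_eq_one : ∀ t ∈ Θ, ∫⁻ y, ENNReal.ofReal (expDensity a b c ψ t y) ∂ν = 1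

attribute [instance] ExpFamily.sigmaFinite

/-- The density of `Y` given `X = x` when the canonical parameter at `x` is `t`. -/
def ExpFamily.density (F : ExpFamily) (t y : ℝ) : ℝ :=
  expDensity F.a F.b F.c F.ψ t y

/-- The conditional log-likelihood `l(t; y)`. -/
def ExpFamily.logLik (F : ExpFamily) (t y : ℝ) : ℝ :=
  Real.log (F.density t y)

/-- The second derivative of the cumulant function `b`. -/
def ExpFamily.b'' (F : ExpFamily) (t : ℝ) : ℝ :=
  deriv (deriv F.b) t

/-- The kernel is a symmetric, Lipschitz continuous probability density with bounded support. -/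
structure IsAdmissibleKernel (K : ℝ → ℝ) : Prop where
  nonneg : ∀ t, 0 ≤ K t
  symm : ∀ t, K (-t) = K t
  integral_eq_one : ∫ t, K t = 1
  hasCompactSupport : HasCompactSupport K
  lipschitz : ∃ L, LipschitzWith L K

/-- The support `Ω` of the design variable is a finite union of nondegenerate compact intervals,
and the design density `f` is Lipschitz continuous and bounded away from zero on it. -/
structure IsAdmissibleDesign (Ω : Set ℝ) (f : ℝ → ℝ) : Prop where
  intervals : ∃ s : Finset (ℝ × ℝ),
    (∀ I ∈ s, I.1 < I.2) ∧ Ω = ⋃ I ∈ s, Set.Icc I.1 I.2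
  lipschitz : ∃ L, LipschitzOnWith L f Ω
  bounded_below : ∃ δ > 0, ∀ x ∈ Ω, δ ≤ f x

/-- `(X i, Y i)`, `i = 0, 1, ...`, are independent observations, each `X i` having density `f`
on `Ω` and each `Y i` having, given `X i = x`, the density of the exponential family at `θ x`. -/
structure IsSample {Ω₀ : Type*} [MeasurableSpace Ω₀] (P : Measure Ω₀) (F : ExpFamily)
    (Ω : Set ℝ) (f θ : ℝ → ℝ) (X Y : ℕ → Ω₀ → ℝ) : Prop where
  measurable_X : ∀ i, Measurable (X i)
  measurable_Y : ∀ i, Measurable (Y i)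
  indep : ProbabilityTheory.iIndepFun (fun i ω => (X i ω, Y i ω)) P
  law : ∀ i, P.map (fun ω => (X i ω, Y i ω)) =
    ((volume.restrict Ω).prod F.ν).withDensity
      fun z => ENNReal.ofReal (f z.1 * F.density (θ z.1) z.2)

/-- The rescaled kernel `K_h(t) = K(t / h) / h`. -/
def scaledKernel (K : ℝ → ℝ) (h t : ℝ) : ℝ :=
  K (t / h) / h

/-- The local polynomial `x_j(x)ᵀ β`, that is `∑ k ≤ p, β_k (u - x) ^ k` at `u = X_j`. -/
def localPoly {p : ℕ} (β : Fin (p + 1) → ℝ) (x u : ℝ) : ℝ :=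
  ∑ k : Fin (p + 1), (u - x) ^ (k : ℕ) * β k

/-- The local log-likelihood `ℓ(β; x)` of the data `(X j, Y j)`, `j < n`. -/
def localLogLik (F : ExpFamily) (K : ℝ → ℝ) (h : ℝ) {n p : ℕ} (X Y : Fin n → ℝ) (x : ℝ)
    (β : Fin (p + 1) → ℝ) : ℝ :=
  ∑ j, F.logLik (localPoly β x (X j)) (Y j) * scaledKernel K h (X j - x)

/-- The coefficient vectors at which the local likelihood makes sense: the canonical parameter is
in `Θ` at every observation that carries weight. It is everything if `Θ` is the whole line. -/
def feasible (F : ExpFamily) (K : ℝ → ℝ) (h : ℝ) {n : ℕ} (p : ℕ) (X : Fin n → ℝ) (x : ℝ) :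
    Set (Fin (p + 1) → ℝ) :=
  {β | ∀ j, scaledKernel K h (X j - x) ≠ 0 → localPoly β x (X j) ∈ F.Θ}

/-- `β` maximizes the local log-likelihood at `x`. -/
def IsMaximizer (F : ExpFamily) (K : ℝ → ℝ) (h : ℝ) {n p : ℕ} (X Y : Fin n → ℝ) (x : ℝ)
    (β : Fin (p + 1) → ℝ) : Prop :=
  β ∈ feasible F K h p X x ∧
    IsMaxOn (localLogLik F K h X Y x) (feasible F K h p X x) β

/-- `β` is a local maximum likelihood estimate at `x`: a maximizer of the local log-likelihood,
if there is one. For data with no maximizer (such as binary responses that are all equal near `x`)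
any feasible value is allowed. -/
def IsLocalMLE (F : ExpFamily) (K : ℝ → ℝ) (h : ℝ) {n p : ℕ} (X Y : Fin n → ℝ) (x : ℝ)
    (β : Fin (p + 1) → ℝ) : Prop :=
  β ∈ feasible F K h p X x ∧
    ((∃ β' : Fin (p + 1) → ℝ, IsMaximizer F K h X Y x β') → IsMaximizer F K h X Y x β)

/-- The design matrix with rows `(1, X_j - x, ..., (X_j - x) ^ p)`. -/
def designMatrix {n : ℕ} (p : ℕ) (X : Fin n → ℝ) (x : ℝ) : Matrix (Fin n) (Fin (p + 1)) ℝ :=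
  Matrix.of fun j k => (X j - x) ^ (k : ℕ)

/-- The weights `K_h(X_j - x) b''(x_j(x)ᵀ β)`. -/
def weight (F : ExpFamily) (K : ℝ → ℝ) (h : ℝ) {n p : ℕ} (X : Fin n → ℝ) (x : ℝ)
    (β : Fin (p + 1) → ℝ) (j : Fin n) : ℝ :=
  scaledKernel K h (X j - x) * F.b'' (localPoly β x (X j))

/-- `S_n(x; β) = X(x)ᵀ W(x; β) X(x)`. -/
def Sn (F : ExpFamily) (K : ℝ → ℝ) (h : ℝ) {n p : ℕ} (X : Fin n → ℝ) (x : ℝ)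
    (β : Fin (p + 1) → ℝ) : Matrix (Fin (p + 1)) (Fin (p + 1)) ℝ :=
  (designMatrix p X x).transpose * Matrix.diagonal (weight F K h X x β) * designMatrix p X x

/-- The hat matrix `W^{1/2} X(x) S_n⁻¹ X(x)ᵀ W^{1/2}`. -/
def hatMatrix (F : ExpFamily) (K : ℝ → ℝ) (h : ℝ) {n p : ℕ} (X : Fin n → ℝ) (x : ℝ)
    (β : Fin (p + 1) → ℝ) : Matrix (Fin n) (Fin n) ℝ :=
  let R := Matrix.diagonal fun j => Real.sqrt (weight F K h X x β j)
  R * designMatrix p X x * (Sn F K h X x β)⁻¹ * (designMatrix p X x).transpose * R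

/-- The degrees of freedom `∑ i, H_i`, where `H_i` is the `i`-th diagonal entry of the hat matrix
at `x = X_i` and at the estimate `βhat i` of the local coefficients at `X_i`. -/
def degreesOfFreedom (F : ExpFamily) (K : ℝ → ℝ) (h : ℝ) {n p : ℕ} (X : Fin n → ℝ)
    (βhat : Fin n → Fin (p + 1) → ℝ) : ℝ :=
  ∑ i, hatMatrix F K h X (X i) (βhat i) i i

/-- The matrix of kernel moments `μ_{i+j}`, with indices starting at zero. -/
def momentMatrix (K : ℝ → ℝ) (p : ℕ) : Matrix (Fin (p + 1)) (Fin (p + 1)) ℝ :=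
  Matrix.of fun i j => ∫ t, t ^ ((i : ℕ) + (j : ℕ)) * K t

/-- The equivalent kernel: the first entry of `S⁻¹ (1, t, ..., t ^ p)ᵀ K(t)`. -/
def equivalentKernel (K : ℝ → ℝ) (p : ℕ) (t : ℝ) : ℝ :=
  ((momentMatrix K p)⁻¹.mulVec fun k => t ^ (k : ℕ) * K t) 0

end LocalLikelihood

end

open MeasureTheory Filter Topology

noncomputable section

namespace LocalLikelihood

/-! ### Convexity and local quadratic bounds for the cumulant function. -/

section ExponentialFamily

/-! At `x = X i` the `i`-th row of the design matrix is the first unit vector, so after rescaling by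
powers of `h` the hat value satisfies `n h H_i = K(0) b''(β₀) (B⁻¹)₀₀` with `B` the weighted Gram
matrix of the rescaled design (`mul_hatMatrix_diag`). If the fitted polynomial stays near `θ(x)` on
the window, all weights `b''` are close to `b''(θ(x))`. If moreover the window lies inside `Ω`, then
`B` is close to `f(x) b''(θ(x)) S`; the factor `b''` cancels and `n h H_i` is close to `𝒦(0) /
f(x)`. Hence `h ∑ H_i`, the average of `n h H_i`, behaves like the average of `𝒦(0) / f(X_i)`, and
the law of large numbers gives `𝒦(0) ∫_Ω (1/f) f = 𝒦(0) |Ω|`.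

Under `n h → ∞` alone, uniform consistency of the estimates cannot be invoked, and it is not needed.
For each `i`, Chernoff bounds conditional on the `i`-th observation show that the local moments and
scores at `X i` are near their means except with probability `O(exp(-c n h))`
(`IsSample.exists_measure_not_isGood_le`). Off this event the leverage bound `H_i ≤ 1` costs at most
`n h exp(-c n h) → 0` in expectation. Points within `O(h)` of the boundary of `Ω` have probability
`O(h)`, and at good ones `n h H_i` is bounded. Markov's inequality combines both contributions.

On the good event everything is deterministic (`exists_hat_close`). The log-likelihood is concave
because `b` is convex, and it is negative, relative to the constant `θ(x)`, on a small sphere of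
coefficients, since curvature beats the score there. So a maximizer exists and every maximizer lies
in the ball (`norm_scaledCoeff_lt_of_isLocalMLE`). -/

lemma add_mul_sub_le_of_convexOn {S : Set ℝ} {g : ℝ → ℝ} {x y g' : ℝ} (hg : ConvexOn ℝ S g)
    (hx : x ∈ S) (hy : y ∈ S) (hd : HasDerivAt g g' x) : g x + g' * (y - x) ≤ g y := by
  rcases lt_trichotomy x y with h | h | h
  · have := hg.le_slope_of_hasDerivAt hx hy h hd
    rw [slope_def_field, le_div_iff₀ (by linarith)] at this
    linarith
  · subst h; simp
  · have := hg.slope_le_of_hasDerivAt hy hx h hd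
    rw [slope_def_field, div_le_iff₀ (by linarith)] at this
    linarith

lemma add_mul_sub_le_of_deriv2_nonneg {S : Set ℝ} {g g' g'' : ℝ → ℝ} (hS : Convex ℝ S)
    (h1 : ∀ x ∈ S, HasDerivAt g (g' x) x) (h2 : ∀ x ∈ S, HasDerivAt g' (g'' x) x)
    (h0 : ∀ x ∈ S, 0 ≤ g'' x) {x y : ℝ} (hx : x ∈ S) (hy : y ∈ S) :
    g x + g' x * (y - x) ≤ g y := by
  refine add_mul_sub_le_of_convexOn ?_ hx hy (h1 x hx)
  exact convexOn_of_hasDerivWithinAt2_nonneg hS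
    (fun z hz => (h1 z hz).continuousAt.continuousWithinAt)
    (fun z hz => (h1 z (interior_subset hz)).hasDerivWithinAt)
    (fun z hz => (h2 z (interior_subset hz)).hasDerivWithinAt)
    (fun z hz => h0 z (interior_subset hz))

namespace ExpFamily

variable (F : ExpFamily)

lemma density_pos (t y : ℝ) : 0 < F.density t y := Real.exp_pos _

lemma measurable_density (t : ℝ) : Measurable (F.density t) := by
  have := F.measurable_c
  unfold density expDensity
  fun_prop

lemma logLik_eq (t y : ℝ) : F.logLik t y = (y * t - F.b t) / F.a F.ψ + F.c y F.ψ :=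
  Real.log_exp _

lemma lintegral_density {t : ℝ} (ht : t ∈ F.Θ) :
    ∫⁻ y, ENNReal.ofReal (F.density t y) ∂F.ν = 1 := F.lintegral_eq_one t ht

/-- Convexity follows from normalization alone. Convexity of `exp` bounds the density at the mixed
parameter, up to the factor `r`, by the mixture of the two densities; all of them integrate to one,
so `r ≤ 1`, and the logarithm of this is the claim. -/
lemma convexOn_b : ConvexOn ℝ F.Θ F.b := by
  refine ⟨F.convex_Θ, fun x hx y hy s t hs ht hst => ?_⟩
  have ha := F.a_pos
  simp only [smul_eq_mul]
  have hm : s * x + t * y ∈ F.Θ := F.convex_Θ hx hy hs ht hst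
  set r := Real.exp ((F.b (s * x + t * y) - (s * F.b x + t * F.b y)) / F.a F.ψ) with hr
  have key : ∀ z, r * F.density (s * x + t * y) z ≤ s * F.density x z + t * F.density y z := by
    intro z
    have h := convexOn_exp.2 (Set.mem_univ ((z * x - F.b x) / F.a F.ψ + F.c z F.ψ))
      (Set.mem_univ ((z * y - F.b y) / F.a F.ψ + F.c z F.ψ)) hs ht hst
    simp only [smul_eq_mul] at h
    refine le_trans (le_of_eq ?_) h
    rw [hr, density, expDensity, ← Real.exp_add]
    congr 1
    obtain rfl : t = 1 - s := by linarith
    field_simp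
    ring
  have h1 : ENNReal.ofReal r ≤ 1 := by
    calc ENNReal.ofReal r
        = ∫⁻ z, ENNReal.ofReal r * ENNReal.ofReal (F.density (s * x + t * y) z) ∂F.ν := by
          rw [lintegral_const_mul _ (F.measurable_density _).ennreal_ofReal,
            F.lintegral_density hm, mul_one]
      _ ≤ ∫⁻ z, (ENNReal.ofReal s * ENNReal.ofReal (F.density x z)
            + ENNReal.ofReal t * ENNReal.ofReal (F.density y z)) ∂F.ν := by
          refine lintegral_mono fun z => ?_
          dsimp only
          rw [← ENNReal.ofReal_mul (Real.exp_pos _).le, ← ENNReal.ofReal_mul hs,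
            ← ENNReal.ofReal_mul ht, ← ENNReal.ofReal_add
              (mul_nonneg hs (F.density_pos _ _).le) (mul_nonneg ht (F.density_pos _ _).le)]
          exact ENNReal.ofReal_le_ofReal (key z)
      _ = 1 := by
          rw [lintegral_add_left ((F.measurable_density _).ennreal_ofReal.const_mul _),
            lintegral_const_mul _ (F.measurable_density _).ennreal_ofReal,
            lintegral_const_mul _ (F.measurable_density _).ennreal_ofReal,
            F.lintegral_density hx, F.lintegral_density hy, mul_one, mul_one,
            ← ENNReal.ofReal_add hs ht, hst, ENNReal.ofReal_one]
  rw [ENNReal.ofReal_le_one, hr, Real.exp_le_one_iff, div_le_iff₀ ha] at h1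
  linarith

variable {F}

lemma hasDerivAt_b (hb : ContDiffOn ℝ 2 F.b F.Θ) {t : ℝ} (ht : t ∈ F.Θ) :
    HasDerivAt F.b (deriv F.b t) t :=
  ((hb.differentiableOn (by norm_num)).differentiableAt (F.isOpen_Θ.mem_nhds ht)).hasDerivAt

lemma contDiffOn_deriv_b (hb : ContDiffOn ℝ 2 F.b F.Θ) : ContDiffOn ℝ 1 (deriv F.b) F.Θ :=
  ((contDiffOn_succ_iff_deriv_of_isOpen (n := 1) F.isOpen_Θ).1 hb).2.2

lemma hasDerivAt_deriv_b (hb : ContDiffOn ℝ 2 F.b F.Θ) {t : ℝ} (ht : t ∈ F.Θ) :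
    HasDerivAt (deriv F.b) (F.b'' t) t :=
  (((contDiffOn_deriv_b hb).differentiableOn (by norm_num)).differentiableAt
    (F.isOpen_Θ.mem_nhds ht)).hasDerivAt

lemma continuousOn_b'' (hb : ContDiffOn ℝ 2 F.b F.Θ) : ContinuousOn F.b'' F.Θ :=
  (contDiffOn_deriv_b hb).continuousOn_deriv_of_isOpen F.isOpen_Θ le_rfl

lemma b''_nonneg (hb : ContDiffOn ℝ 2 F.b F.Θ) {t : ℝ} (ht : t ∈ F.Θ) : 0 ≤ F.b'' t := by
  have h := (F.convexOn_b.monotoneOn_deriv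
    (fun x hx => (hasDerivAt_b hb hx).differentiableAt)).derivWithin_nonneg (x := t)
  rwa [derivWithin_of_isOpen F.isOpen_Θ ht] at h

/-- The function `b(s) - c (s - t)² / 2` is convex on the ball, hence lies above its tangent at `t`.
-/
lemma le_b_of_le_b'' (hb : ContDiffOn ℝ 2 F.b F.Θ) {t d c ρ : ℝ}
    (hρ : Metric.closedBall t ρ ⊆ F.Θ) (hc : ∀ s ∈ Metric.closedBall t ρ, c ≤ F.b'' s)
    (hd : |d| ≤ ρ) : F.b t + deriv F.b t * d + c / 2 * d ^ 2 ≤ F.b (t + d) := by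
  have h := add_mul_sub_le_of_deriv2_nonneg (S := Metric.closedBall t ρ)
    (g := fun s => F.b s - c / 2 * (s - t) ^ 2) (g' := fun s => deriv F.b s - c * (s - t))
    (g'' := fun s => F.b'' s - c) (convex_closedBall t ρ)
    (fun x hx => by
      refine ((hasDerivAt_b hb (hρ hx)).fun_sub
        ((((hasDerivAt_id' x).sub_const t).fun_pow 2).const_mul (c / 2))).congr_deriv ?_
      norm_num; ring)
    (fun x hx => by
      refine ((hasDerivAt_deriv_b hb (hρ hx)).fun_sub
        (((hasDerivAt_id' x).sub_const t).const_mul c)).congr_deriv ?_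
      simp)
    (fun x hx => sub_nonneg.2 (hc x hx)) (x := t) (y := t + d)
    (by simpa using (abs_nonneg d).trans hd) (by simpa [Real.dist_eq] using hd)
  simp only [sub_self, add_sub_cancel_left] at h
  linarith

lemma b_le_of_b''_le (hb : ContDiffOn ℝ 2 F.b F.Θ) {t d c ρ : ℝ}
    (hρ : Metric.closedBall t ρ ⊆ F.Θ) (hc : ∀ s ∈ Metric.closedBall t ρ, F.b'' s ≤ c)
    (hd : |d| ≤ ρ) : F.b (t + d) ≤ F.b t + deriv F.b t * d + c / 2 * d ^ 2 := by
  have h := add_mul_sub_le_of_deriv2_nonneg (S := Metric.closedBall t ρ)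
    (g := fun s => c / 2 * (s - t) ^ 2 - F.b s) (g' := fun s => c * (s - t) - deriv F.b s)
    (g'' := fun s => c - F.b'' s) (convex_closedBall t ρ)
    (fun x hx => by
      refine (((((hasDerivAt_id' x).sub_const t).fun_pow 2).const_mul (c / 2)).fun_sub
        (hasDerivAt_b hb (hρ hx))).congr_deriv ?_
      norm_num; ring)
    (fun x hx => by
      refine ((((hasDerivAt_id' x).sub_const t).const_mul c).fun_sub
        (hasDerivAt_deriv_b hb (hρ hx))).congr_deriv ?_
      simp)
    (fun x hx => sub_nonneg.2 (hc x hx)) (x := t) (y := t + d)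
    (by simpa using (abs_nonneg d).trans hd) (by simpa [Real.dist_eq] using hd)
  simp only [sub_self, add_sub_cancel_left] at h
  linarith

/-- The moment generating function of the response. -/
lemma lintegral_exp_mul_density {t s : ℝ} (m : ℝ) (hs : t + F.a F.ψ * s ∈ F.Θ) :
    ∫⁻ y, ENNReal.ofReal (F.density t y) * ENNReal.ofReal (Real.exp (s * (y - m))) ∂F.ν
      = ENNReal.ofReal (Real.exp ((F.b (t + F.a F.ψ * s) - F.b t) / F.a F.ψ - s * m)) := by
  have ha := F.a_pos
  rw [← mul_one (ENNReal.ofReal (Real.exp ((F.b (t + F.a F.ψ * s) - F.b t) / F.a F.ψ - s * m))),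
    ← F.lintegral_density hs, ← lintegral_const_mul _ (F.measurable_density _).ennreal_ofReal]
  refine lintegral_congr fun y => ?_
  rw [← ENNReal.ofReal_mul (F.density_pos _ _).le, ← ENNReal.ofReal_mul (Real.exp_pos _).le]
  congr 1
  rw [density, density, expDensity, expDensity, ← Real.exp_add, ← Real.exp_add]
  congr 1
  field_simp
  ring

/-- The centred response has sub-Gaussian moment generating function near zero. -/
lemma lintegral_exp_centred_le (hb : ContDiffOn ℝ 2 F.b F.Θ) {t s c ρ : ℝ}
    (hρ : Metric.closedBall t ρ ⊆ F.Θ) (hc : ∀ s ∈ Metric.closedBall t ρ, F.b'' s ≤ c)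
    (hs : F.a F.ψ * |s| ≤ ρ) :
    ∫⁻ y, ENNReal.ofReal (F.density t y) *
        ENNReal.ofReal (Real.exp (s * (y - deriv F.b t))) ∂F.ν
      ≤ ENNReal.ofReal (Real.exp (F.a F.ψ * c / 2 * s ^ 2)) := by
  have ha := F.a_pos
  have hd : |F.a F.ψ * s| ≤ ρ := by rwa [abs_mul, abs_of_pos ha]
  have hmem : t + F.a F.ψ * s ∈ F.Θ := hρ (by simpa [Real.dist_eq] using hd)
  rw [lintegral_exp_mul_density _ hmem]
  refine ENNReal.ofReal_le_ofReal (Real.exp_le_exp.2 ?_)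
  have h := b_le_of_b''_le hb hρ hc hd
  rw [sub_le_iff_le_add, div_le_iff₀ ha]
  nlinarith

end ExpFamily

end ExponentialFamily

/-! ### Gram matrices, quadratic forms and the diagonal of the hat matrix. -/

section Matrices

open Matrix

/-- The polynomial with coefficients `v`. -/
def evalPoly {p : ℕ} (v : Fin (p + 1) → ℝ) (u : ℝ) : ℝ :=
  ∑ k : Fin (p + 1), u ^ (k : ℕ) * v k

lemma evalPoly_smul {p : ℕ} (s : ℝ) (v : Fin (p + 1) → ℝ) (u : ℝ) :
    evalPoly (s • v) u = s * evalPoly v u := by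
  simp only [evalPoly, Pi.smul_apply, smul_eq_mul, Finset.mul_sum]
  exact Finset.sum_congr rfl fun _ _ => by ring

lemma evalPoly_zero_left {p : ℕ} (u : ℝ) : evalPoly (0 : Fin (p + 1) → ℝ) u = 0 := by
  simp [evalPoly]

lemma evalPoly_zero_right {p : ℕ} (v : Fin (p + 1) → ℝ) : evalPoly v 0 = v 0 := by
  rw [evalPoly, Fin.sum_univ_succ]
  simp

lemma continuous_evalPoly {p : ℕ} :
    Continuous fun q : (Fin (p + 1) → ℝ) × ℝ => evalPoly q.1 q.2 := by
  unfold evalPoly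
  fun_prop

lemma abs_evalPoly_le {p : ℕ} (v : Fin (p + 1) → ℝ) {u C : ℝ} (hC : 1 ≤ C) (hu : |u| ≤ C) :
    |evalPoly v u| ≤ (p + 1) * C ^ p * ‖v‖ := by
  calc |evalPoly v u| ≤ ∑ k : Fin (p + 1), |u ^ (k : ℕ) * v k| := Finset.abs_sum_le_sum_abs _ _
    _ ≤ ∑ _k : Fin (p + 1), C ^ p * ‖v‖ := by
        refine Finset.sum_le_sum fun k _ => ?_
        rw [abs_mul, abs_pow]
        refine mul_le_mul ?_ (norm_le_pi_norm v k) (abs_nonneg _) (by positivity)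
        exact (pow_le_pow_left₀ (abs_nonneg _) hu _).trans
          (pow_le_pow_right₀ hC (Nat.lt_succ_iff.1 k.2))
    _ = _ := by simp; ring

/-- The Gram matrix of the monomials with respect to point masses `c j` at `u j`. -/
def gram {n : ℕ} (p : ℕ) (c u : Fin n → ℝ) : Matrix (Fin (p + 1)) (Fin (p + 1)) ℝ :=
  Matrix.of fun k l => ∑ j, c j * u j ^ ((k : ℕ) + (l : ℕ))

lemma dotProduct_gram_mulVec {n p : ℕ} (c u : Fin n → ℝ) (v : Fin (p + 1) → ℝ) :
    v ⬝ᵥ (gram p c u *ᵥ v) = ∑ j, c j * evalPoly v (u j) ^ 2 := by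
  simp only [dotProduct, mulVec, gram, Matrix.of_apply, evalPoly, sq, Finset.mul_sum,
    Finset.sum_mul]
  conv_rhs => rw [Finset.sum_comm]
  refine Finset.sum_congr rfl fun k _ => ?_
  conv_rhs => rw [Finset.sum_comm]
  refine Finset.sum_congr rfl fun l _ => Finset.sum_congr rfl fun j _ => by ring

/-- Writing the entry as the quadratic form of `A` at `w = A⁻¹ e₀` lets a lower bound on the form
yield both its positivity and an upper bound, with no symmetry assumption on `A`. -/
lemma inv_zero_zero_eq {p : ℕ} {A : Matrix (Fin (p + 1)) (Fin (p + 1)) ℝ} (hA : IsUnit A.det) :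
    A⁻¹ 0 0 = (A⁻¹ *ᵥ Pi.single 0 1) ⬝ᵥ (A *ᵥ (A⁻¹ *ᵥ Pi.single 0 1)) := by
  rw [mulVec_mulVec, mul_nonsing_inv _ hA, one_mulVec]
  simp

lemma isUnit_det_of_quadratic {p : ℕ} {A : Matrix (Fin (p + 1)) (Fin (p + 1)) ℝ} {l : ℝ}
    (hl : 0 < l) (hA : ∀ v, l * ‖v‖ ^ 2 ≤ v ⬝ᵥ (A *ᵥ v)) : IsUnit A.det := by
  rw [isUnit_iff_ne_zero]
  intro h
  obtain ⟨v, hv, h0⟩ := exists_mulVec_eq_zero_iff.2 h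
  have h1 := hA v
  rw [h0, dotProduct_zero] at h1
  have : 0 < ‖v‖ := norm_pos_iff.2 hv
  have : 0 < l * ‖v‖ ^ 2 := by positivity
  linarith

lemma inv_zero_zero_pos {p : ℕ} {A : Matrix (Fin (p + 1)) (Fin (p + 1)) ℝ} {l : ℝ}
    (hl : 0 < l) (hA : ∀ v, l * ‖v‖ ^ 2 ≤ v ⬝ᵥ (A *ᵥ v)) : 0 < A⁻¹ 0 0 := by
  have hu := isUnit_det_of_quadratic hl hA
  rw [inv_zero_zero_eq hu]
  refine lt_of_lt_of_le ?_ (hA _)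
  have : A⁻¹ *ᵥ Pi.single 0 1 ≠ 0 := by
    intro h
    have h2 : A *ᵥ (A⁻¹ *ᵥ Pi.single 0 1) = 0 := by rw [h, mulVec_zero]
    rw [mulVec_mulVec, mul_nonsing_inv _ hu, one_mulVec] at h2
    simpa using congrFun h2 0
  have : 0 < ‖A⁻¹ *ᵥ Pi.single 0 1‖ := norm_pos_iff.2 this
  positivity

/-- With `w = A⁻¹ e₀` one has `l w₀² ≤ l ‖w‖² ≤ w ⬝ A w = w₀`. -/
lemma inv_zero_zero_le {p : ℕ} {A : Matrix (Fin (p + 1)) (Fin (p + 1)) ℝ} {l : ℝ}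
    (hl : 0 < l) (hA : ∀ v, l * ‖v‖ ^ 2 ≤ v ⬝ᵥ (A *ᵥ v)) : A⁻¹ 0 0 ≤ 1 / l := by
  have hu := isUnit_det_of_quadratic hl hA
  have h1 := hA (A⁻¹ *ᵥ Pi.single 0 1)
  rw [← inv_zero_zero_eq hu] at h1
  have h2 : A⁻¹ 0 0 ≤ ‖A⁻¹ *ᵥ Pi.single 0 1‖ := by
    have := norm_le_pi_norm (A⁻¹ *ᵥ Pi.single 0 1) 0
    simp only [mulVec_single_one] at this
    exact (le_abs_self _).trans (by simpa using this)
  have h0 := inv_zero_zero_pos hl hA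
  have h3 : l * (A⁻¹ 0 0) ^ 2 ≤ A⁻¹ 0 0 :=
    (mul_le_mul_of_nonneg_left (pow_le_pow_left₀ h0.le h2 2) hl.le).trans h1
  rw [le_div_iff₀ hl]
  nlinarith

variable {F : ExpFamily} {K : ℝ → ℝ} {h : ℝ} {n p : ℕ} {X : Fin n → ℝ} {x : ℝ}
  {β : Fin (p + 1) → ℝ}

lemma Sn_eq_gram : Sn F K h X x β = gram p (weight F K h X x β) (fun j => X j - x) := by
  ext k l
  rw [Sn, mul_apply]
  simp only [gram, mul_diagonal, transpose_apply, designMatrix, Matrix.of_apply]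
  exact Finset.sum_congr rfl fun j _ => by rw [pow_add]; ring

lemma weight_nonneg (hb : ContDiffOn ℝ 2 F.b F.Θ) (hK : ∀ t, 0 ≤ K t) (hh : 0 < h)
    (hβ : β ∈ feasible F K h p X x) (j : Fin n) : 0 ≤ weight F K h X x β j := by
  unfold weight
  by_cases h0 : scaledKernel K h (X j - x) = 0
  · simp [h0]
  · exact mul_nonneg (div_nonneg (hK _) hh.le) (ExpFamily.b''_nonneg hb (hβ j h0))

lemma hatMatrix_diag {i : Fin n} (hi : X i = x) (hw : 0 ≤ weight F K h X x β i) :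
    hatMatrix F K h X x β i i = weight F K h X x β i * (Sn F K h X x β)⁻¹ 0 0 := by
  have hd : ∀ k : Fin (p + 1), designMatrix p X x i k = if k = 0 then 1 else 0 := by
    intro k
    change (X i - x) ^ (k : ℕ) = _
    rw [hi, sub_self]
    split_ifs with hk
    · simp [hk]
    · exact zero_pow fun h0 => hk (Fin.ext h0)
  simp only [hatMatrix]
  rw [mul_diagonal, mul_apply]
  simp only [transpose_apply, hd]
  simp only [mul_ite, mul_one, mul_zero, Finset.sum_ite_eq', Finset.mem_univ, if_true]
  rw [mul_apply]
  simp only [diagonal_mul, hd]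
  simp only [mul_ite, mul_one, mul_zero, ite_mul, zero_mul, Finset.sum_ite_eq', Finset.mem_univ,
    if_true]
  rw [mul_right_comm, Real.mul_self_sqrt hw]

/-- The usual leverage bound. With `w = S_n⁻¹ e₀`, the number `w₀` is a sum of nonnegative terms,
one of which is `weight_i w₀²`; hence `weight_i w₀ ≤ 1`. For singular `S_n` the inverse is zero by
convention. This is the only control available at points where the sample is atypical. -/
lemma hatMatrix_diag_mem_Icc {i : Fin n} (hi : X i = x) (hw : ∀ j, 0 ≤ weight F K h X x β j) :
    hatMatrix F K h X x β i i ∈ Set.Icc (0 : ℝ) 1 := by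
  rw [hatMatrix_diag hi (hw i)]
  by_cases hu : IsUnit (Sn F K h X x β).det
  · have h1 := inv_zero_zero_eq hu
    set w := (Sn F K h X x β)⁻¹ *ᵥ Pi.single 0 1 with hwdef
    have h00 : (Sn F K h X x β)⁻¹ 0 0 = w 0 := by simp [hwdef]
    rw [Sn_eq_gram, dotProduct_gram_mulVec, ← Sn_eq_gram] at h1
    rw [h00] at h1 ⊢
    have h2 : 0 ≤ w 0 := by
      rw [h1]; exact Finset.sum_nonneg fun j _ => mul_nonneg (hw j) (sq_nonneg _)
    have h3 : weight F K h X x β i * w 0 ^ 2 ≤ w 0 := by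
      conv_rhs => rw [h1]
      have := Finset.single_le_sum (f := fun j => weight F K h X x β j * evalPoly w (X j - x) ^ 2)
        (fun j _ => mul_nonneg (hw j) (sq_nonneg _)) (Finset.mem_univ i)
      simpa [hi, evalPoly_zero_right] using this
    refine ⟨mul_nonneg (hw i) h2, ?_⟩
    rcases h2.eq_or_lt with h4 | h4
    · rw [← h4]; simp
    · nlinarith
  · rw [nonsing_inv_apply_not_isUnit _ hu]
    simp

lemma localPoly_self : localPoly β x x = β 0 := by
  simpa [localPoly, evalPoly] using evalPoly_zero_right β

/-- The hat value in terms of the rescaled Gram matrix. -/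
lemma mul_hatMatrix_diag {i : Fin n} (hi : X i = x) (hh : 0 < h)
    (hw : 0 ≤ weight F K h X x β i) :
    n * h * hatMatrix F K h X x β i i = K 0 * F.b'' (β 0) *
      (gram p (fun j => K ((X j - x) / h) * F.b'' (localPoly β x (X j)) / (n * h))
        (fun j => (X j - x) / h))⁻¹ 0 0 := by
  have hn : (0 : ℝ) < n := by
    have := i.pos
    exact_mod_cast this
  set B := gram p (fun j => K ((X j - x) / h) * F.b'' (localPoly β x (X j)) / (n * h))
        (fun j => (X j - x) / h)
  -- Rescaling the monomials: the two diagonal factors absorb `h ^ (k + l)` and the normalization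
  -- `n`, and their `(0,0)` entries are `n` and `1`, so inversion changes the corner entry only by
  -- `1 / n`.
  have hS : Sn F K h X x β = diagonal (fun k : Fin (p + 1) => n * h ^ (k : ℕ)) * B *
      diagonal (fun k : Fin (p + 1) => h ^ (k : ℕ)) := by
    rw [Sn_eq_gram]
    ext k l
    simp only [mul_diagonal, diagonal_mul, B, gram, Matrix.of_apply, Finset.mul_sum,
      Finset.sum_mul, weight, scaledKernel]
    refine Finset.sum_congr rfl fun j _ => ?_
    rw [div_pow, pow_add, pow_add]
    field_simp
  have hD : ∀ d : Fin (p + 1) → ℝ, (∀ k, d k ≠ 0) →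
      (diagonal d)⁻¹ = diagonal (fun k => (d k)⁻¹) := by
    intro d hd
    refine inv_eq_left_inv ?_
    rw [diagonal_mul_diagonal]
    simp [inv_mul_cancel₀ (hd _)]
  rw [hatMatrix_diag hi hw, hS, Matrix.mul_inv_rev, Matrix.mul_inv_rev,
    hD _ (fun k => by positivity), hD _ (fun k => by positivity), diagonal_mul, mul_diagonal]
  simp only [weight, scaledKernel, hi, sub_self, zero_div, localPoly_self, Fin.val_zero, pow_zero,
    mul_one, inv_one, one_mul]
  field_simp

end Matrices

/-! ### Deterministic localization of the maximum likelihood estimate. -/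

section Localization

/-- The coefficients of a local polynomial in the rescaled variable, relative to the constant
polynomial `t₀`. -/
def scaledCoeff {p : ℕ} (h t₀ : ℝ) (β : Fin (p + 1) → ℝ) : Fin (p + 1) → ℝ :=
  fun k => β k * h ^ (k : ℕ) - if k = 0 then t₀ else 0

/-- The inverse of `scaledCoeff`. -/
def unscaledCoeff {p : ℕ} (h t₀ : ℝ) (γ : Fin (p + 1) → ℝ) : Fin (p + 1) → ℝ :=
  fun k => (γ k + if k = 0 then t₀ else 0) / h ^ (k : ℕ)

lemma scaledCoeff_unscaledCoeff {p : ℕ} {h : ℝ} (hh : 0 < h) (t₀ : ℝ) (γ : Fin (p + 1) → ℝ) :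
    scaledCoeff h t₀ (unscaledCoeff h t₀ γ) = γ := by
  ext k
  simp only [scaledCoeff, unscaledCoeff]
  field_simp
  ring

lemma localPoly_eq {p : ℕ} {h : ℝ} (hh : 0 < h) (t₀ : ℝ) (β : Fin (p + 1) → ℝ) (x u : ℝ) :
    localPoly β x u = t₀ + evalPoly (scaledCoeff h t₀ β) ((u - x) / h) := by
  simp only [localPoly, evalPoly, scaledCoeff, mul_sub, Finset.sum_sub_distrib, mul_ite, mul_zero,
    Finset.sum_ite_eq', Finset.mem_univ, if_true, Fin.val_zero, pow_zero, one_mul]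
  rw [add_sub_cancel]
  refine Finset.sum_congr rfl fun k _ => ?_
  rw [div_pow]
  field_simp

/-- The log-likelihood ratio against the constant `t₀`, as a function of the rescaled
coefficients, times the dispersion. -/
def scaledLogRatio (F : ExpFamily) {n p : ℕ} (κ u Y : Fin n → ℝ) (t₀ : ℝ)
    (γ : Fin (p + 1) → ℝ) : ℝ :=
  ∑ j, κ j * (Y j * evalPoly γ (u j) - (F.b (t₀ + evalPoly γ (u j)) - F.b t₀))

variable {F : ExpFamily} {n p : ℕ}

/-- The second sum does not depend on `β`, so maximizing the local likelihood amounts to maximizing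
`scaledLogRatio` in the rescaled coefficients. -/
lemma localLogLik_eq (K : ℝ → ℝ) {h : ℝ} (hh : 0 < h) (X Y : Fin n → ℝ) (x t₀ : ℝ)
    (β : Fin (p + 1) → ℝ) :
    localLogLik F K h X Y x β =
      scaledLogRatio F (fun j => K ((X j - x) / h)) (fun j => (X j - x) / h) Y t₀
        (scaledCoeff h t₀ β) / (F.a F.ψ * h) +
      ∑ j, ((Y j * t₀ - F.b t₀) / F.a F.ψ + F.c (Y j) F.ψ) * (K ((X j - x) / h) / h) := by
  have ha := F.a_pos
  rw [localLogLik, scaledLogRatio, Finset.sum_div, ← Finset.sum_add_distrib]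
  refine Finset.sum_congr rfl fun j _ => ?_
  rw [ExpFamily.logLik_eq, localPoly_eq hh t₀, scaledKernel]
  field_simp
  ring

section Ratio

variable {κ u Y : Fin n → ℝ} {t₀ ρ c₀ C r Λ η : ℝ}

lemma scaledLogRatio_zero : scaledLogRatio F κ u Y t₀ (0 : Fin (p + 1) → ℝ) = 0 := by
  simp [scaledLogRatio, evalPoly_zero_left]

lemma abs_evalPoly_le_radius (hC : 1 ≤ C) (hrρ : (p + 1) * C ^ p * r ≤ ρ) {v : ℝ} (hv : |v| ≤ C)
    {γ : Fin (p + 1) → ℝ} (hγ : ‖γ‖ ≤ r) : |evalPoly γ v| ≤ ρ :=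
  (abs_evalPoly_le γ hC hv).trans (le_trans (by gcongr) hrρ)

/-- By the quadratic lower bound for `b`, the ratio is at most score minus curvature. On the sphere
of radius `r` the score contributes at most `(p + 1) η r` and the curvature at least `c₀ Λ r² / 2`,
which is larger by `hrη`. -/
lemma scaledLogRatio_neg_of_norm_eq (hb : ContDiffOn ℝ 2 F.b F.Θ) (hκ : ∀ j, 0 ≤ κ j)
    (hκC : ∀ j, κ j ≠ 0 → |u j| ≤ C) (hC : 1 ≤ C) (hρ : Metric.closedBall t₀ ρ ⊆ F.Θ)
    (hc : ∀ s ∈ Metric.closedBall t₀ ρ, c₀ ≤ F.b'' s) (hc0 : 0 < c₀) (hr : 0 < r)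
    (hrρ : (p + 1) * C ^ p * r ≤ ρ)
    (hΛ : ∀ v : Fin (p + 1) → ℝ, Λ * ‖v‖ ^ 2 ≤ ∑ j, κ j * evalPoly v (u j) ^ 2)
    (hη : ∀ k : Fin (p + 1), |∑ j, κ j * (Y j - deriv F.b t₀) * u j ^ (k : ℕ)| ≤ η)
    (hrη : (p + 1) * η < c₀ / 2 * Λ * r) {γ : Fin (p + 1) → ℝ} (hγ : ‖γ‖ = r) :
    scaledLogRatio F κ u Y t₀ γ < 0 := by
  have h1 : scaledLogRatio F κ u Y t₀ γ ≤
      ∑ j, κ j * (Y j - deriv F.b t₀) * evalPoly γ (u j)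
        - c₀ / 2 * ∑ j, κ j * evalPoly γ (u j) ^ 2 := by
    rw [scaledLogRatio, Finset.mul_sum, ← Finset.sum_sub_distrib]
    refine Finset.sum_le_sum fun j _ => ?_
    by_cases h0 : κ j = 0
    · simp [h0]
    · have := ExpFamily.le_b_of_le_b'' hb hρ hc
        (abs_evalPoly_le_radius hC hrρ (hκC j h0) hγ.le)
      nlinarith [hκ j]
  have h2 : ∑ j, κ j * (Y j - deriv F.b t₀) * evalPoly γ (u j) ≤ (p + 1) * η * r := by
    have : ∑ j, κ j * (Y j - deriv F.b t₀) * evalPoly γ (u j) =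
        ∑ k : Fin (p + 1), (∑ j, κ j * (Y j - deriv F.b t₀) * u j ^ (k : ℕ)) * γ k := by
      simp only [evalPoly, Finset.mul_sum, Finset.sum_mul]
      rw [Finset.sum_comm]
      exact Finset.sum_congr rfl fun k _ => Finset.sum_congr rfl fun j _ => by ring
    rw [this]
    calc _ ≤ ∑ _k : Fin (p + 1), η * r := by
          refine Finset.sum_le_sum fun k _ => (le_abs_self _).trans ?_
          rw [abs_mul]
          exact mul_le_mul (hη k) ((norm_le_pi_norm γ k).trans hγ.le) (abs_nonneg _)
            ((abs_nonneg _).trans (hη k))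
      _ = _ := by simp; ring
  have h3 := hΛ γ
  rw [hγ] at h3
  nlinarith

/-- Concavity along the ray from zero, where the ratio vanishes. Convexity of `b` on all of `Θ` is
what makes this available at feasible coefficients far from zero, where no bound on `b''` holds. -/
lemma mul_scaledLogRatio_le (hκ : ∀ j, 0 ≤ κ j) (ht₀ : t₀ ∈ F.Θ) {γ : Fin (p + 1) → ℝ}
    (hγ : ∀ j, κ j ≠ 0 → t₀ + evalPoly γ (u j) ∈ F.Θ) {s : ℝ} (hs0 : 0 ≤ s) (hs1 : s ≤ 1) :
    s * scaledLogRatio F κ u Y t₀ γ ≤ scaledLogRatio F κ u Y t₀ (s • γ) := by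
  rw [scaledLogRatio, scaledLogRatio, Finset.mul_sum]
  refine Finset.sum_le_sum fun j _ => ?_
  rw [evalPoly_smul]
  by_cases h0 : κ j = 0
  · simp [h0]
  · have h := F.convexOn_b.2 ht₀ (hγ j h0) (sub_nonneg.2 hs1) hs0 (by ring)
    simp only [smul_eq_mul] at h
    rw [show (1 - s) * t₀ + s * (t₀ + evalPoly γ (u j)) = t₀ + s * evalPoly γ (u j) by ring] at h
    nlinarith [hκ j]

lemma continuousOn_scaledLogRatio (hb : ContDiffOn ℝ 2 F.b F.Θ)
    (hκC : ∀ j, κ j ≠ 0 → |u j| ≤ C) (hC : 1 ≤ C) (hρ : Metric.closedBall t₀ ρ ⊆ F.Θ)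
    (hrρ : (p + 1) * C ^ p * r ≤ ρ) :
    ContinuousOn (scaledLogRatio F κ u Y t₀) (Metric.closedBall (0 : Fin (p + 1) → ℝ) r) := by
  unfold scaledLogRatio
  refine continuousOn_finsetSum _ fun j _ => ?_
  by_cases h0 : κ j = 0
  · simp only [h0, zero_mul]; exact continuousOn_const
  · have hq : Continuous fun γ : Fin (p + 1) → ℝ => evalPoly γ (u j) :=
      continuous_evalPoly.comp (by fun_prop : Continuous fun γ : Fin (p + 1) → ℝ => (γ, u j))
    refine continuousOn_const.mul ((continuousOn_const.mul hq.continuousOn).sub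
      ((hb.continuousOn.comp (continuous_const.add hq).continuousOn ?_).sub continuousOn_const))
    intro γ hγ
    refine hρ ?_
    have := abs_evalPoly_le_radius hC hrρ (hκC j h0) (γ := γ) (by simpa using hγ)
    simpa [Real.dist_eq] using this

end Ratio

/-- Every local maximum likelihood estimate is close to the constant `t₀` if the score at `t₀` is
small compared with the information. -/
theorem norm_scaledCoeff_lt_of_isLocalMLE {K : ℝ → ℝ} {h x t₀ ρ c₀ C r Λ η : ℝ}
    {X Y : Fin n → ℝ} (hb : ContDiffOn ℝ 2 F.b F.Θ) (hh : 0 < h) (hK : ∀ t, 0 ≤ K t)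
    (hKC : ∀ t, K t ≠ 0 → |t| ≤ C) (hC : 1 ≤ C) (hρ : Metric.closedBall t₀ ρ ⊆ F.Θ)
    (hc : ∀ s ∈ Metric.closedBall t₀ ρ, c₀ ≤ F.b'' s) (hc0 : 0 < c₀) (hr : 0 < r)
    (hrρ : (p + 1) * C ^ p * r ≤ ρ)
    (hΛ : ∀ v : Fin (p + 1) → ℝ,
      Λ * ‖v‖ ^ 2 ≤ ∑ j, K ((X j - x) / h) * evalPoly v ((X j - x) / h) ^ 2)
    (hη : ∀ k : Fin (p + 1),
      |∑ j, K ((X j - x) / h) * (Y j - deriv F.b t₀) * ((X j - x) / h) ^ (k : ℕ)| ≤ η)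
    (hrη : (p + 1) * η < c₀ / 2 * Λ * r) {β : Fin (p + 1) → ℝ}
    (hβ : IsLocalMLE F K h X Y x β) : ‖scaledCoeff h t₀ β‖ < r := by
  set κ : Fin n → ℝ := fun j => K ((X j - x) / h) with hκdef
  set u : Fin n → ℝ := fun j => (X j - x) / h with hudef
  have hκ : ∀ j, 0 ≤ κ j := fun j => hK _
  have hκC : ∀ j, κ j ≠ 0 → |u j| ≤ C := fun j => hKC _
  have hρ0 : 0 ≤ ρ := le_trans (by positivity) hrρ
  have ht₀ : t₀ ∈ F.Θ := hρ (Metric.mem_closedBall_self hρ0)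
  have ha := F.a_pos
  have hfeas : ∀ β' : Fin (p + 1) → ℝ, β' ∈ feasible F K h p X x ↔
      ∀ j, κ j ≠ 0 → t₀ + evalPoly (scaledCoeff h t₀ β') (u j) ∈ F.Θ := by
    intro β'
    simp only [feasible, Set.mem_ofPred_eq, scaledKernel, localPoly_eq hh t₀, hκdef, hudef]
    exact forall_congr' fun j => by simp [hh.ne']
  have hcmp : ∀ β₁ β₂ : Fin (p + 1) → ℝ,
      localLogLik F K h X Y x β₁ ≤ localLogLik F K h X Y x β₂ ↔
      scaledLogRatio F κ u Y t₀ (scaledCoeff h t₀ β₁) ≤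
        scaledLogRatio F κ u Y t₀ (scaledCoeff h t₀ β₂) := by
    intro β₁ β₂
    rw [localLogLik_eq K hh X Y x t₀ β₁, localLogLik_eq K hh X Y x t₀ β₂, add_le_add_iff_right,
      div_le_div_iff_of_pos_right (by positivity)]
  have hball : ∀ γ : Fin (p + 1) → ℝ, ‖γ‖ ≤ r → ∀ j, κ j ≠ 0 → t₀ + evalPoly γ (u j) ∈ F.Θ := by
    intro γ hγ j h0
    refine hρ ?_
    have := abs_evalPoly_le_radius hC hrρ (hκC j h0) hγ
    simpa [Real.dist_eq] using this
  -- A feasible `γ` outside the ball is shrunk radially to the sphere; the ratio is negative there,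
  -- hence negative at `γ` by concavity.
  have hout : ∀ γ : Fin (p + 1) → ℝ, r ≤ ‖γ‖ → (∀ j, κ j ≠ 0 → t₀ + evalPoly γ (u j) ∈ F.Θ) →
      scaledLogRatio F κ u Y t₀ γ < 0 := by
    intro γ hγ hf
    have hpos : 0 < ‖γ‖ := hr.trans_le hγ
    have h1 := mul_scaledLogRatio_le (Y := Y) hκ ht₀ hf (s := r / ‖γ‖) (by positivity)
      ((div_le_one hpos).2 hγ)
    have h2 := scaledLogRatio_neg_of_norm_eq (Y := Y) hb hκ hκC hC hρ hc hc0 hr hrρ hΛ hη hrη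
      (γ := (r / ‖γ‖) • γ) (by
        rw [norm_smul, Real.norm_of_nonneg (by positivity), div_mul_cancel₀ _ hpos.ne'])
    have h3 : 0 < r / ‖γ‖ := by positivity
    by_contra hcon
    push Not at hcon
    nlinarith
  -- A maximizer over the compact ball has ratio at least the value `0` at the origin and therefore
  -- beats all feasible points outside. It is thus a global maximizer, so the convention for data
  -- without a maximizer is not in force.
  obtain ⟨γ', hγ', hmax⟩ := (isCompact_closedBall (0 : Fin (p + 1) → ℝ) r).exists_isMaxOn
    ⟨0, Metric.mem_closedBall_self hr.le⟩
    (continuousOn_scaledLogRatio (Y := Y) hb hκC hC hρ hrρ)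
  have hγ0 : 0 ≤ scaledLogRatio F κ u Y t₀ γ' := by
    have := hmax (Metric.mem_closedBall_self hr.le)
    simpa [scaledLogRatio_zero] using this
  have hex : IsMaximizer F K h X Y x (unscaledCoeff h t₀ γ') := by
    refine ⟨(hfeas _).2 ?_, fun β₁ hβ₁ => ?_⟩
    · rw [scaledCoeff_unscaledCoeff hh]
      exact hball γ' (by simpa using hγ')
    · refine (hcmp _ _).2 ?_
      rw [scaledCoeff_unscaledCoeff hh]
      by_cases hn : ‖scaledCoeff h t₀ β₁‖ ≤ r
      · exact hmax (by simpa using hn)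
      · exact (hout _ (le_of_not_ge hn) ((hfeas _).1 hβ₁)).le.trans hγ0
  have hm := hβ.2 ⟨_, hex⟩
  have h4 : 0 ≤ scaledLogRatio F κ u Y t₀ (scaledCoeff h t₀ β) := by
    have := (hcmp _ _).1 (hm.2 hex.1)
    rw [scaledCoeff_unscaledCoeff hh] at this
    exact hγ0.trans this
  by_contra hcon
  exact absurd (hout _ (le_of_not_gt hcon) ((hfeas _).1 hβ.1)) (not_lt.2 h4)

end Localization

/-! ### Nondegeneracy of the kernel moments. -/

section Moments

open Matrix

lemma eq_zero_of_evalPoly_eq_zero {p : ℕ} {a b : ℝ} (hab : a < b) {v : Fin (p + 1) → ℝ}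
    (hv : ∀ u ∈ Set.Icc a b, evalPoly v u = 0) : v = 0 := by
  set q : Polynomial ℝ := ∑ k : Fin (p + 1), Polynomial.monomial (k : ℕ) (v k) with hq
  have heval : ∀ u, q.eval u = evalPoly v u := by
    intro u
    simp [hq, Polynomial.eval_finsetSum, Polynomial.eval_monomial, evalPoly, mul_comm]
  have h0 : q = 0 := by
    refine Polynomial.eq_zero_of_infinite_isRoot _ ((Set.Icc_infinite hab).mono fun u hu => ?_)
    change q.eval u = 0
    rw [heval, hv u hu]
  ext k
  have := congrArg (fun r => Polynomial.coeff r (k : ℕ)) h0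
  simpa [hq, Polynomial.finsetSum_coeff, Polynomial.coeff_monomial, Fin.val_inj] using this

/-- The minimum over the unit sphere is positive, because a polynomial vanishing on an interval is
zero; homogeneity extends the bound to all `v`. -/
lemma exists_le_integral_evalPoly_sq (p : ℕ) {a b : ℝ} (hab : a < b) :
    ∃ l > 0, ∀ v : Fin (p + 1) → ℝ, l * ‖v‖ ^ 2 ≤ ∫ u in a..b, evalPoly v u ^ 2 := by
  have hcont : Continuous fun v : Fin (p + 1) → ℝ => ∫ u in a..b, evalPoly v u ^ 2 :=
    intervalIntegral.continuous_parametric_intervalIntegral_of_continuous'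
      (f := fun (v : Fin (p + 1) → ℝ) u => evalPoly v u ^ 2) (continuous_evalPoly.pow 2) a b
  obtain ⟨w, hw, hmin⟩ := (isCompact_sphere (0 : Fin (p + 1) → ℝ) 1).exists_isMinOn
    (NormedSpace.sphere_nonempty.2 zero_le_one) hcont.continuousOn
  have hw1 : ‖w‖ = 1 := by simpa using hw
  refine ⟨∫ u in a..b, evalPoly w u ^ 2, ?_, fun v => ?_⟩
  · have hcw : Continuous fun u => evalPoly w u :=
      continuous_evalPoly.comp (by fun_prop : Continuous fun u : ℝ => (w, u))
    refine intervalIntegral.integral_pos hab (hcw.pow 2).continuousOn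
      (fun _ _ => sq_nonneg _) ?_
    by_contra hcon
    push Not at hcon
    have : w = 0 := eq_zero_of_evalPoly_eq_zero hab fun u hu => by
      have := hcon u hu
      nlinarith [sq_nonneg (evalPoly w u)]
    simp [this] at hw1
  · rcases eq_or_ne v 0 with rfl | hv
    · simp [evalPoly_zero_left]
    · have hn : ‖v‖ ≠ 0 := norm_ne_zero_iff.2 hv
      have h1 := hmin (show ‖v‖⁻¹ • v ∈ Metric.sphere 0 1 by
        simp [norm_smul, inv_mul_cancel₀ hn])
      have h2 : ∀ u, evalPoly v u ^ 2 = ‖v‖ ^ 2 * evalPoly (‖v‖⁻¹ • v) u ^ 2 := by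
        intro u
        rw [evalPoly_smul]
        field_simp
      simp_rw [h2]
      rw [intervalIntegral.integral_const_mul, mul_comm]
      exact mul_le_mul_of_nonneg_left h1 (sq_nonneg _)

lemma dotProduct_moments_mulVec {α : Type*} [MeasurableSpace α] {m : Measure α} {p : ℕ}
    {u w : α → ℝ} (hi : ∀ k, Integrable (fun t => u t ^ k * w t) m) (v : Fin (p + 1) → ℝ) :
    v ⬝ᵥ ((Matrix.of fun k l : Fin (p + 1) => ∫ t, u t ^ ((k : ℕ) + (l : ℕ)) * w t ∂m) *ᵥ v) =
      ∫ t, evalPoly v (u t) ^ 2 * w t ∂m := by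
  have h1 : ∀ t, evalPoly v (u t) ^ 2 * w t = ∑ k : Fin (p + 1), ∑ l : Fin (p + 1),
      v k * v l * (u t ^ ((k : ℕ) + (l : ℕ)) * w t) := by
    intro t
    rw [evalPoly, sq, Finset.sum_mul_sum, Finset.sum_mul]
    refine Finset.sum_congr rfl fun k _ => ?_
    rw [Finset.sum_mul]
    exact Finset.sum_congr rfl fun l _ => by ring
  simp_rw [h1]
  rw [integral_finsetSum _ fun k _ => integrable_finsetSum _ fun l _ => (hi _).const_mul _]
  simp only [dotProduct, mulVec, Matrix.of_apply, Finset.mul_sum]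
  refine Finset.sum_congr rfl fun k _ => ?_
  rw [integral_finsetSum _ fun l _ => (hi _).const_mul _]
  refine Finset.sum_congr rfl fun l _ => ?_
  rw [integral_const_mul]
  ring

/-- A quadratic form changes little if the entries of the matrix do. -/
lemma quadratic_sub_le {p : ℕ} {A B : Matrix (Fin (p + 1)) (Fin (p + 1)) ℝ} {e : ℝ}
    (hAB : ∀ k l, |A k l - B k l| ≤ e) (v : Fin (p + 1) → ℝ) :
    v ⬝ᵥ (A *ᵥ v) - (p + 1) ^ 2 * e * ‖v‖ ^ 2 ≤ v ⬝ᵥ (B *ᵥ v) := by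
  have h1 : v ⬝ᵥ (A *ᵥ v) - v ⬝ᵥ (B *ᵥ v) =
      ∑ k : Fin (p + 1), ∑ l : Fin (p + 1), v k * ((A k l - B k l) * v l) := by
    rw [← dotProduct_sub, ← sub_mulVec]
    simp [dotProduct, mulVec, Finset.mul_sum]
  have h2 : ∑ k : Fin (p + 1), ∑ l : Fin (p + 1), v k * ((A k l - B k l) * v l) ≤
      ∑ _k : Fin (p + 1), ∑ _l : Fin (p + 1), e * ‖v‖ ^ 2 := by
    refine Finset.sum_le_sum fun k _ => Finset.sum_le_sum fun l _ => (le_abs_self _).trans ?_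
    rw [abs_mul, abs_mul]
    have hk : |v k| ≤ ‖v‖ := norm_le_pi_norm v k
    have hl : |v l| ≤ ‖v‖ := norm_le_pi_norm v l
    calc |v k| * (|A k l - B k l| * |v l|) ≤ ‖v‖ * (e * ‖v‖) := by
          have := (abs_nonneg _).trans (hAB k l)
          gcongr
          exact hAB k l
      _ = e * ‖v‖ ^ 2 := by ring
  simp only [Finset.sum_const, Finset.card_univ, Fintype.card_fin, nsmul_eq_mul, Nat.cast_add,
    Nat.cast_one] at h2
  nlinarith

namespace IsAdmissibleKernel

variable {K : ℝ → ℝ} (hK : IsAdmissibleKernel K)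

include hK

lemma continuous : Continuous K := by
  obtain ⟨L, hL⟩ := hK.lipschitz
  exact hL.continuous

lemma exists_support : ∃ C, 1 ≤ C ∧ ∀ t, K t ≠ 0 → |t| ≤ C := by
  obtain ⟨R, _, hR⟩ := hK.hasCompactSupport.exists_pos_le_norm
  refine ⟨max R 1, le_max_right _ _, fun t ht => ?_⟩
  by_contra hcon
  exact ht (hR t ((le_max_left R 1).trans (le_of_not_ge hcon)))

lemma exists_bound : ∃ M, 0 < M ∧ ∀ t, K t ≤ M := by
  obtain ⟨M, hM⟩ := hK.hasCompactSupport.exists_bound_of_continuous hK.continuous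
  refine ⟨max M 1, by positivity, fun t => ?_⟩
  exact (le_abs_self _).trans ((hM t).trans (le_max_left _ _))

lemma exists_pos_near_zero (h0 : 0 < K 0) :
    ∃ r > 0, ∃ k₀ > 0, ∀ u, |u| ≤ r → k₀ ≤ K u := by
  have := hK.continuous.continuousAt (x := 0)
  obtain ⟨r, hr, h⟩ := Metric.eventually_nhds_iff_ball.1
    (this.eventually (lt_mem_nhds (half_lt_self h0)))
  refine ⟨r / 2, by positivity, K 0 / 2, by positivity, fun u hu => (h u ?_).le⟩
  rw [Metric.mem_ball, Real.dist_eq, sub_zero]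
  linarith

lemma integrable_pow_mul (k : ℕ) : Integrable fun t => t ^ k * K t :=
  ((continuous_pow k).mul hK.continuous).integrable_of_hasCompactSupport
    hK.hasCompactSupport.mul_left

lemma exists_le_momentMatrix (h0 : 0 < K 0) (p : ℕ) :
    ∃ l > 0, ∀ v, l * ‖v‖ ^ 2 ≤ v ⬝ᵥ (momentMatrix K p *ᵥ v) := by
  obtain ⟨r, hr, k₀, hk₀, hk⟩ := hK.exists_pos_near_zero h0
  obtain ⟨l, hl, h⟩ := exists_le_integral_evalPoly_sq p hr
  refine ⟨k₀ * l, by positivity, fun v => ?_⟩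
  have hint : Integrable fun t => evalPoly v t ^ 2 * K t :=
    (((continuous_evalPoly.comp (by fun_prop : Continuous fun u : ℝ => (v, u))).pow 2).mul
      hK.continuous).integrable_of_hasCompactSupport hK.hasCompactSupport.mul_left
  have h1 := dotProduct_moments_mulVec (m := volume) (p := p) (u := id) (w := K)
    hK.integrable_pow_mul v
  simp only [id] at h1
  rw [momentMatrix, h1]
  calc k₀ * l * ‖v‖ ^ 2 ≤ k₀ * ∫ u in (0 : ℝ)..r, evalPoly v u ^ 2 := by
        rw [mul_assoc]; exact mul_le_mul_of_nonneg_left (h v) hk₀.le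
    _ = ∫ u in Set.Ioc 0 r, k₀ * evalPoly v u ^ 2 := by
        rw [intervalIntegral.integral_of_le hr.le, integral_const_mul]
    _ ≤ ∫ u in Set.Ioc 0 r, evalPoly v u ^ 2 * K u := by
        refine setIntegral_mono_on ?_ hint.integrableOn measurableSet_Ioc fun u hu => ?_
        · exact (Continuous.integrableOn_Icc (by
            have := (continuous_evalPoly.comp (by fun_prop : Continuous fun u : ℝ => (v, u)))
            exact continuous_const.mul (this.pow 2))).mono_set Set.Ioc_subset_Icc_self
        · rw [mul_comm]
          refine mul_le_mul_of_nonneg_left (hk u ?_) (sq_nonneg _)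
          rw [abs_of_pos hu.1]; exact hu.2
    _ ≤ _ := setIntegral_le_integral hint
        (Filter.Eventually.of_forall fun u => mul_nonneg (sq_nonneg _) (hK.nonneg u))

end IsAdmissibleKernel

lemma equivalentKernel_zero (K : ℝ → ℝ) (p : ℕ) :
    equivalentKernel K p 0 = (momentMatrix K p)⁻¹ 0 0 * K 0 := by
  simp only [equivalentKernel, mulVec, dotProduct]
  rw [Fin.sum_univ_succ]
  simp

end Moments

/-! ### The design region and the expected local moments. -/

section Design

open Matrix

namespace IsAdmissibleDesign

variable {Ω : Set ℝ} {f : ℝ → ℝ}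

lemma isCompact (hΩ : IsAdmissibleDesign Ω f) : IsCompact Ω := by
  obtain ⟨s, -, rfl⟩ := hΩ.intervals
  exact s.isCompact_biUnion fun _ _ => isCompact_Icc

lemma measurableSet (hΩ : IsAdmissibleDesign Ω f) : MeasurableSet Ω :=
  hΩ.isCompact.isClosed.measurableSet

lemma continuousOn (hΩ : IsAdmissibleDesign Ω f) : ContinuousOn f Ω := by
  obtain ⟨L, hL⟩ := hΩ.lipschitz
  exact hL.continuousOn

lemma exists_bound (hΩ : IsAdmissibleDesign Ω f) : ∃ M, 0 < M ∧ ∀ x ∈ Ω, f x ≤ M := by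
  obtain ⟨M, hM⟩ := hΩ.isCompact.exists_bound_of_continuousOn hΩ.continuousOn
  refine ⟨max M 1, by positivity, fun x hx => ?_⟩
  exact (le_abs_self _).trans ((hM x hx).trans (le_max_left _ _))

lemma nonneg (hΩ : IsAdmissibleDesign Ω f) {x : ℝ} (hx : x ∈ Ω) : 0 ≤ f x := by
  obtain ⟨d, hd, h⟩ := hΩ.bounded_below
  exact hd.le.trans (h x hx)

/-- Every point lies in one half of its interval and has at least half the interval's length
available on the other side; the shortest interval gives a uniform length. -/
lemma exists_one_sided (hΩ : IsAdmissibleDesign Ω f) :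
    ∃ l > 0, ∀ x ∈ Ω, Set.Icc x (x + l) ⊆ Ω ∨ Set.Icc (x - l) x ⊆ Ω := by
  obtain ⟨s, hs, rfl⟩ := hΩ.intervals
  rcases s.eq_empty_or_nonempty with rfl | hne
  · exact ⟨1, one_pos, by simp⟩
  obtain ⟨J, hJ, hmin⟩ := s.exists_min_image (fun I => (I.2 - I.1) / 2) hne
  refine ⟨(J.2 - J.1) / 2, by linarith [hs J hJ], fun x hx => ?_⟩
  obtain ⟨I, hI, hx⟩ := Set.mem_iUnion₂.1 hx
  have h1 := hmin I hI
  rcases le_total x ((I.1 + I.2) / 2) with h | h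
  · left
    have h4 : Set.Icc x (x + (J.2 - J.1) / 2) ⊆ Set.Icc I.1 I.2 :=
      Set.Icc_subset_Icc hx.1 (by linarith)
    exact h4.trans (Set.subset_biUnion_of_mem (u := fun I : ℝ × ℝ => Set.Icc I.1 I.2) hI)
  · right
    have h4 : Set.Icc (x - (J.2 - J.1) / 2) x ⊆ Set.Icc I.1 I.2 :=
      Set.Icc_subset_Icc (by linarith) hx.2
    exact h4.trans (Set.subset_biUnion_of_mem (u := fun I : ℝ × ℝ => Set.Icc I.1 I.2) hI)

/-- Outside a set of small measure, a neighbourhood of the point lies in the design region. -/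
lemma exists_boundary (hΩ : IsAdmissibleDesign Ω f) : ∃ A : ℝ, 0 ≤ A ∧ ∀ e, 0 ≤ e →
    ∃ D : Set ℝ, MeasurableSet D ∧ volume D ≤ ENNReal.ofReal (A * e) ∧
      ∀ x ∈ Ω, x ∉ D → Metric.closedBall x e ⊆ Ω := by
  obtain ⟨s, hs, rfl⟩ := hΩ.intervals
  -- The exceptional set consists of a layer of width `e` at each end of each interval. Where
  -- intervals meet or overlap this removes more than necessary, which is harmless.
  refine ⟨s.card * 2, by positivity, fun e he =>
    ⟨⋃ I ∈ s, (Set.Icc I.1 (I.1 + e) ∪ Set.Icc (I.2 - e) I.2), ?_, ?_, ?_⟩⟩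
  · exact s.measurableSet_biUnion fun _ _ => measurableSet_Icc.union measurableSet_Icc
  · calc volume (⋃ I ∈ s, (Set.Icc I.1 (I.1 + e) ∪ Set.Icc (I.2 - e) I.2))
        ≤ ∑ I ∈ s, volume (Set.Icc I.1 (I.1 + e) ∪ Set.Icc (I.2 - e) I.2) :=
          measure_biUnion_finset_le _ _
      _ ≤ ∑ _I ∈ s, ENNReal.ofReal (2 * e) := by
          refine Finset.sum_le_sum fun I _ => (measure_union_le _ _).trans ?_
          rw [Real.volume_Icc, Real.volume_Icc, ← ENNReal.ofReal_add (by linarith) (by linarith)]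
          exact ENNReal.ofReal_le_ofReal (by linarith)
      _ = ENNReal.ofReal (s.card * 2 * e) := by
          rw [Finset.sum_const, nsmul_eq_mul, mul_assoc,
            ENNReal.ofReal_mul (p := (s.card : ℝ)) (by positivity), ENNReal.ofReal_natCast]
  · intro x hx hxD
    obtain ⟨I, hI, hx⟩ := Set.mem_iUnion₂.1 hx
    have h1 : x ∉ Set.Icc I.1 (I.1 + e) ∪ Set.Icc (I.2 - e) I.2 := fun h =>
      hxD (Set.mem_iUnion₂.2 ⟨I, hI, h⟩)
    simp only [Set.mem_union, Set.mem_Icc, not_or, not_and, not_le] at h1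
    have h2 := h1.1 hx.1
    have h3 : x < I.2 - e := by
      by_contra hcon
      exact absurd (h1.2 (le_of_not_gt hcon)) (not_lt.2 hx.2)
    rw [Real.closedBall_eq_Icc]
    have h4 : Set.Icc (x - e) (x + e) ⊆ Set.Icc I.1 I.2 :=
      Set.Icc_subset_Icc (by linarith) (by linarith)
    exact h4.trans (Set.subset_biUnion_of_mem (u := fun I : ℝ × ℝ => Set.Icc I.1 I.2) hI)

end IsAdmissibleDesign

/-- The expected local design moments. -/
def popMoment (K : ℝ → ℝ) (h : ℝ) (Ω : Set ℝ) (f : ℝ → ℝ) (x : ℝ) (k : ℕ) : ℝ :=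
  ∫ x' in Ω, ((x' - x) / h) ^ k * (K ((x' - x) / h) * f x' / h)

variable {K : ℝ → ℝ} {Ω : Set ℝ} {f : ℝ → ℝ}

lemma integrable_popMoment (hK : IsAdmissibleKernel K) (hΩ : IsAdmissibleDesign Ω f) (h x : ℝ)
    (k : ℕ) : Integrable (fun x' => ((x' - x) / h) ^ k * (K ((x' - x) / h) * f x' / h))
      (volume.restrict Ω) := by
  have hc := hK.continuous
  have h1 : Continuous fun x' => ((x' - x) / h) ^ k := by fun_prop
  have h2 : Continuous fun x' => K ((x' - x) / h) := by fun_prop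
  exact ContinuousOn.integrableOn_compact hΩ.isCompact
    (h1.continuousOn.mul ((h2.continuousOn.mul hΩ.continuousOn).div_const h))

/-- Near the boundary only part of the window lies in `Ω`, but a one-sided piece suffices: on `[0,
r]` or `[-r, 0]` in rescaled units, `K ≥ k₀` and `f ≥ d`, and one of the two pieces fits into `Ω`
once `r h ≤ e`. Hence the bound is uniform up to the boundary. -/
lemma exists_le_popMoment (hK : IsAdmissibleKernel K) (hK0 : 0 < K 0)
    (hΩ : IsAdmissibleDesign Ω f) (p : ℕ) :
    ∃ l > 0, ∃ h₀ > 0, ∀ h, 0 < h → h ≤ h₀ → ∀ x ∈ Ω, ∀ v : Fin (p + 1) → ℝ, l * ‖v‖ ^ 2 ≤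
      v ⬝ᵥ ((Matrix.of fun i j : Fin (p + 1) =>
        popMoment K h Ω f x ((i : ℕ) + (j : ℕ))) *ᵥ v) := by
  obtain ⟨r, hr, k₀, hk₀, hk⟩ := hK.exists_pos_near_zero hK0
  obtain ⟨l₁, hl₁, hi₁⟩ := exists_le_integral_evalPoly_sq p hr
  obtain ⟨l₂, hl₂, hi₂⟩ := exists_le_integral_evalPoly_sq p (neg_neg_of_pos hr)
  obtain ⟨d, hd, hf⟩ := hΩ.bounded_below
  obtain ⟨e, he, hside⟩ := hΩ.exists_one_sided
  refine ⟨k₀ * d * min l₁ l₂, by positivity, e / r, by positivity, fun h hh hhe x hx v => ?_⟩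
  have hre : r * h ≤ e := by rwa [le_div_iff₀ hr, mul_comm] at hhe
  have hcv : Continuous fun u => evalPoly v u :=
    continuous_evalPoly.comp (by fun_prop : Continuous fun u : ℝ => (v, u))
  rw [show (Matrix.of fun i j : Fin (p + 1) => popMoment K h Ω f x ((i : ℕ) + (j : ℕ))) =
    Matrix.of fun i j : Fin (p + 1) => ∫ x' in Ω, ((x' - x) / h) ^ ((i : ℕ) + (j : ℕ)) *
      (K ((x' - x) / h) * f x' / h) from rfl,
    dotProduct_moments_mulVec (fun k => integrable_popMoment hK hΩ h x k)]
  have hint : IntegrableOn (fun x' => evalPoly v ((x' - x) / h) ^ 2 *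
      (K ((x' - x) / h) * f x' / h)) Ω := by
    have hc := hK.continuous
    have h1 : Continuous fun x' => evalPoly v ((x' - x) / h) ^ 2 :=
      (hcv.comp (by fun_prop : Continuous fun x' : ℝ => (x' - x) / h)).pow 2
    have h2 : Continuous fun x' => K ((x' - x) / h) := by fun_prop
    exact ContinuousOn.integrableOn_compact hΩ.isCompact
      (h1.continuousOn.mul ((h2.continuousOn.mul hΩ.continuousOn).div_const h))
  have main : ∀ a b : ℝ, a ≤ b → (∀ u, a ≤ u → u ≤ b → |u| ≤ r) →
      Set.Icc (x + h * a) (x + h * b) ⊆ Ω → k₀ * d * ∫ u in a..b, evalPoly v u ^ 2 ≤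
      ∫ x' in Ω, evalPoly v ((x' - x) / h) ^ 2 * (K ((x' - x) / h) * f x' / h) := by
    intro a b hab hur hsub
    have hab' : x + h * a ≤ x + h * b := by gcongr
    have hch : ∫ u in a..b, evalPoly v u ^ 2 =
        ∫ x' in (x + h * a)..(x + h * b), h⁻¹ * evalPoly v ((x' - x) / h) ^ 2 := by
      rw [intervalIntegral.integral_const_mul]
      simp_rw [sub_div]
      rw [intervalIntegral.integral_comp_div_sub (fun u => evalPoly v u ^ 2) hh.ne', smul_eq_mul,
        inv_mul_cancel_left₀ hh.ne']
      congr 1 <;> field_simp <;> ring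
    have hsub' : Set.Ioc (x + h * a) (x + h * b) ⊆ Ω := Set.Ioc_subset_Icc_self.trans hsub
    rw [hch, ← intervalIntegral.integral_const_mul, intervalIntegral.integral_of_le hab']
    refine le_trans ?_ (setIntegral_mono_set hint ?_ hsub'.eventuallyLE)
    · refine setIntegral_mono_on ?_ (hint.mono_set hsub') measurableSet_Ioc fun x' hx' => ?_
      · refine (Continuous.integrableOn_Icc ?_).mono_set Set.Ioc_subset_Icc_self
        have := (hcv.comp (by fun_prop : Continuous fun x' : ℝ => (x' - x) / h)).pow 2
        exact continuous_const.mul (continuous_const.mul this)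
      · have hu := hk ((x' - x) / h) (hur _
          (by rw [le_div_iff₀ hh]; linarith [hx'.1, mul_comm h a])
          (by rw [div_le_iff₀ hh]; linarith [hx'.2, mul_comm h b]))
        have hfx := hf x' (hsub' hx')
        rw [show k₀ * d * (h⁻¹ * evalPoly v ((x' - x) / h) ^ 2) =
          evalPoly v ((x' - x) / h) ^ 2 * (k₀ * d / h) by field_simp]
        have := hk₀.le.trans hu
        gcongr
    · filter_upwards [ae_restrict_mem hΩ.measurableSet] with x' hx'
      have := hΩ.nonneg hx'
      have := hK.nonneg ((x' - x) / h)
      simp only [Pi.zero_apply]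
      positivity
  have hkd : 0 < k₀ * d := by positivity
  rcases hside x hx with hs | hs
  · refine le_trans ?_ (main 0 r hr.le (fun u h1 h2 => by rwa [abs_of_nonneg h1])
      ((Set.Icc_subset_Icc (by simp) (by linarith [mul_comm r h])).trans hs))
    rw [mul_assoc]
    refine mul_le_mul_of_nonneg_left (le_trans ?_ (hi₁ v)) hkd.le
    exact mul_le_mul_of_nonneg_right (min_le_left _ _) (sq_nonneg _)
  · refine le_trans ?_ (main (-r) 0 (by linarith)
      (fun u h1 h2 => by rw [abs_of_nonpos h2]; linarith)
      ((Set.Icc_subset_Icc (by linarith [mul_comm r h]) (by simp)).trans hs))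
    rw [mul_assoc]
    refine mul_le_mul_of_nonneg_left (le_trans ?_ (hi₂ v)) hkd.le
    exact mul_le_mul_of_nonneg_right (min_le_right _ _) (sq_nonneg _)

section Bounds

variable {C M L h x : ℝ}

lemma abs_pow_mul_kernel_le (hK : IsAdmissibleKernel K) (hC : ∀ t, K t ≠ 0 → |t| ≤ C)
    (hC1 : 1 ≤ C) (hM : ∀ t, K t ≤ M) (k : ℕ) (t : ℝ) : |t ^ k * K t| ≤ C ^ k * M := by
  by_cases h0 : K t = 0
  · have := (hK.nonneg 0).trans (hM 0)
    rw [h0, mul_zero, abs_zero]; positivity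
  · rw [abs_mul, abs_pow, abs_of_nonneg (hK.nonneg t)]
    exact mul_le_mul (pow_le_pow_left₀ (abs_nonneg _) (hC t h0) _) (hM t) (hK.nonneg t)
      (by positivity)

lemma kernel_eq_zero_of_notMem (hC : ∀ t, K t ≠ 0 → |t| ≤ C) (hh : 0 < h) {x' : ℝ}
    (hx' : x' ∉ Metric.closedBall x (C * h)) : K ((x' - x) / h) = 0 := by
  by_contra hcon
  refine hx' ?_
  have := hC _ hcon
  rw [abs_div, abs_of_pos hh, div_le_iff₀ hh] at this
  rwa [Metric.mem_closedBall, Real.dist_eq]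

lemma abs_popMoment_le (hK : IsAdmissibleKernel K) (hΩ : IsAdmissibleDesign Ω f)
    (hC : ∀ t, K t ≠ 0 → |t| ≤ C) (hC1 : 1 ≤ C) (hM : ∀ t, K t ≤ M) (hf : ∀ x ∈ Ω, f x ≤ L)
    (hL : 0 ≤ L) (hh : 0 < h) (k : ℕ) :
    |popMoment K h Ω f x k| ≤ C ^ k * M * L * (2 * C) := by
  have hM0 := (hK.nonneg 0).trans (hM 0)
  rw [popMoment, setIntegral_eq_of_subset_of_forall_sdiff_eq_zero hΩ.measurableSet
    (s := Ω ∩ Metric.closedBall x (C * h)) Set.inter_subset_left ?_]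
  · have hvol : volume (Ω ∩ Metric.closedBall x (C * h)) ≤ ENNReal.ofReal (2 * (C * h)) :=
      (measure_mono Set.inter_subset_right).trans (Real.volume_closedBall x _).le
    have h1 := norm_setIntegral_le_of_norm_le_const (μ := volume)
      (s := Ω ∩ Metric.closedBall x (C * h)) (C := C ^ k * M * L / h)
      (f := fun x' => ((x' - x) / h) ^ k * (K ((x' - x) / h) * f x' / h))
      (hvol.trans_lt ENNReal.ofReal_lt_top) ?_
    · refine (Real.norm_eq_abs _).symm.le.trans (h1.trans ?_)
      have h2 : volume.real (Ω ∩ Metric.closedBall x (C * h)) ≤ 2 * (C * h) :=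
        ENNReal.toReal_le_of_le_ofReal (by positivity) hvol
      calc _ ≤ C ^ k * M * L / h * (2 * (C * h)) := by gcongr
        _ = _ := by field_simp
    · intro x' hx'
      rw [show ((x' - x) / h) ^ k * (K ((x' - x) / h) * f x' / h) =
        ((x' - x) / h) ^ k * K ((x' - x) / h) * f x' / h by ring, Real.norm_eq_abs, abs_div,
        abs_mul, abs_of_pos hh, abs_of_nonneg (hΩ.nonneg hx'.1)]
      have := abs_pow_mul_kernel_le hK hC hC1 hM k ((x' - x) / h)
      have := hf x' hx'.1
      have := hΩ.nonneg hx'.1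
      gcongr
  · intro x' hx'
    rw [kernel_eq_zero_of_notMem hC hh fun h => hx'.2 ⟨hx'.1, h⟩]
    simp

lemma integral_scaled_moment (hh : 0 < h) (k : ℕ) (c : ℝ) :
    ∫ x', ((x' - x) / h) ^ k * (K ((x' - x) / h) * c / h) = c * ∫ t, t ^ k * K t := by
  have h1 := integral_sub_right_eq_self (μ := volume)
    (fun y => (y / h) ^ k * (K (y / h) * c / h)) x
  rw [h1]
  have h2 := Measure.integral_comp_div (fun t => t ^ k * (K t * c / h)) h
  rw [h2, abs_of_pos hh, smul_eq_mul, ← integral_const_mul, ← integral_const_mul]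
  refine integral_congr_ae (Filter.Eventually.of_forall fun t => ?_)
  field_simp

/-- When the whole window is in `Ω`, freezing `f` at `x` gives the full kernel moment, and the
Lipschitz property bounds the error of freezing by a multiple of `h`. -/
lemma abs_popMoment_sub_le (hK : IsAdmissibleKernel K) (hΩ : IsAdmissibleDesign Ω f)
    (hC : ∀ t, K t ≠ 0 → |t| ≤ C) (hC1 : 1 ≤ C) (hM : ∀ t, K t ≤ M) {L : NNReal}
    (hf : LipschitzOnWith L f Ω) (hx : x ∈ Ω) (hh : 0 < h)
    (hxh : Metric.closedBall x (C * h) ⊆ Ω) (k : ℕ) :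
    |popMoment K h Ω f x k - f x * ∫ t, t ^ k * K t| ≤ C ^ k * M * L * C * (2 * C) * h := by
  have hM0 := (hK.nonneg 0).trans (hM 0)
  have hi1 := (integrable_popMoment hK hΩ h x k)
  have hi2 : IntegrableOn (fun x' => ((x' - x) / h) ^ k * (K ((x' - x) / h) * f x / h))
      (Metric.closedBall x (C * h)) := by
    have hc := hK.continuous
    exact (by fun_prop : Continuous fun x' => ((x' - x) / h) ^ k *
      (K ((x' - x) / h) * f x / h)).continuousOn.integrableOn_compact (isCompact_closedBall _ _)
  rw [← integral_scaled_moment (x := x) hh k (f x), popMoment,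
    setIntegral_eq_of_subset_of_forall_sdiff_eq_zero hΩ.measurableSet hxh (fun x' hx' => by
      rw [kernel_eq_zero_of_notMem hC hh hx'.2]; simp),
    ← setIntegral_eq_integral_of_forall_compl_eq_zero (μ := volume)
      (f := fun x' => ((x' - x) / h) ^ k * (K ((x' - x) / h) * f x / h))
      (s := Metric.closedBall x (C * h)) (fun x' hx' => by rw [kernel_eq_zero_of_notMem hC hh hx']; simp),
    ← integral_sub (IntegrableOn.mono_set hi1 hxh) hi2]
  have h1 := norm_setIntegral_le_of_norm_le_const (μ := volume)
      (s := Metric.closedBall x (C * h)) (C := C ^ k * M * (L * (C * h)) / h)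
      (f := fun x' => ((x' - x) / h) ^ k * (K ((x' - x) / h) * f x' / h) -
        ((x' - x) / h) ^ k * (K ((x' - x) / h) * f x / h))
      ((isCompact_closedBall _ _).measure_lt_top) ?_
  · refine (Real.norm_eq_abs _).symm.le.trans (h1.trans (le_of_eq ?_))
    rw [measureReal_def, Real.volume_closedBall, ENNReal.toReal_ofReal (by positivity)]
    field_simp
  · intro x' hx'
    rw [show ((x' - x) / h) ^ k * (K ((x' - x) / h) * f x' / h) -
        ((x' - x) / h) ^ k * (K ((x' - x) / h) * f x / h) =
        ((x' - x) / h) ^ k * K ((x' - x) / h) * (f x' - f x) / h by ring, Real.norm_eq_abs,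
        abs_div, abs_mul, abs_of_pos hh]
    have h2 := abs_pow_mul_kernel_le hK hC hC1 hM k ((x' - x) / h)
    have h3 : |f x' - f x| ≤ L * (C * h) := by
      have := hf.dist_le_mul x' (hxh hx') x hx
      rw [Real.dist_eq] at this
      exact this.trans (mul_le_mul_of_nonneg_left hx' L.2)
    gcongr

end Bounds

end Design

/-! ### Chernoff bounds for sums centred at one of the observations. -/

section Concentration

open ProbabilityTheory

variable {Ω₀ E ι : Type*} [MeasurableSpace Ω₀] {P : Measure Ω₀} [MeasurableSpace E]

/-- The exponential moment of a sum over pairs that share one member. -/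
lemma lintegral_exp_sum_le [IsProbabilityMeasure P] [Fintype ι] [DecidableEq ι] {μ : Measure E}
    {Z : ι → Ω₀ → E} (hZ : ∀ j, Measurable (Z j)) (hind : iIndepFun Z P)
    (hlaw : ∀ j, P.map (Z j) = μ) {φ : E → E → ℝ} (hφ : Measurable (Function.uncurry φ))
    {B D : ℝ} (hB0 : 0 ≤ B)
    (hB : ∀ᵐ z ∂μ, ∫⁻ w, ENNReal.ofReal (Real.exp (φ z w)) ∂μ ≤ ENNReal.ofReal (Real.exp B))
    (hD : ∫⁻ z, ENNReal.ofReal (Real.exp (φ z z)) ∂μ ≤ ENNReal.ofReal D) (i : ι) :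
    ∫⁻ ω, ENNReal.ofReal (Real.exp (∑ j, φ (Z i ω) (Z j ω))) ∂P ≤
      ENNReal.ofReal (D * Real.exp (Fintype.card ι * B)) := by
  set T : Finset ι := Finset.univ.erase i with hT
  set U : Ω₀ → (T → E) := fun ω j => Z j ω with hU
  have hUm : Measurable U := measurable_pi_lambda _ fun j => hZ j
  have hφ1 : ∀ z, Measurable (φ z) := fun z => hφ.of_uncurry_left
  have hφd : Measurable fun z => φ z z := hφ.comp (measurable_id.prodMk measurable_id)
  -- The `i`-th observation is independent of the vector of all others. By Fubini it can be frozen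
  -- at `z`; the exponential moment then factors, the diagonal term `φ z z` standing apart.
  have hiU : Z i ⟂ᵢ[P] U := by
    have h1 := iIndepFun.indepFun_finset {i} T (by simp [hT]) hind hZ
    exact h1.comp (φ := fun v : (({i} : Finset ι) → E) => v ⟨i, Finset.mem_singleton_self i⟩)
      (ψ := id) (measurable_pi_apply (X := fun _ : ({i} : Finset ι) => E)
        ⟨i, Finset.mem_singleton_self i⟩) measurable_id
  set g : E × (T → E) → ENNReal := fun q => ENNReal.ofReal (Real.exp (φ q.1 q.1)) *
    ∏ j : T, ENNReal.ofReal (Real.exp (φ q.1 (q.2 j))) with hg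
  have hgm : Measurable g := by
    refine ((Real.measurable_exp.comp (hφd.comp measurable_fst)).ennreal_ofReal).mul
      (Finset.measurable_prod _ fun j _ => ?_)
    exact (Real.measurable_exp.comp (hφ.comp (measurable_fst.prodMk
      ((measurable_pi_apply j).comp measurable_snd)))).ennreal_ofReal
  have hsum : ∀ ω, ENNReal.ofReal (Real.exp (∑ j, φ (Z i ω) (Z j ω))) = g (Z i ω, U ω) := by
    intro ω
    rw [Real.exp_sum, ENNReal.ofReal_prod_of_nonneg fun _ _ => (Real.exp_pos _).le,
      ← Finset.mul_prod_erase _ _ (Finset.mem_univ i), hg]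
    simp only [hU, ← hT]
    rw [Finset.prod_coe_sort T fun j => ENNReal.ofReal (Real.exp (φ (Z i ω) (Z j ω)))]
  simp_rw [hsum]
  have hinner : ∀ z, ∫⁻ ω, g (z, U ω) ∂P = ENNReal.ofReal (Real.exp (φ z z)) *
      (∫⁻ w, ENNReal.ofReal (Real.exp (φ z w)) ∂μ) ^ T.card := by
    intro z
    have hm : Measurable fun w => ENNReal.ofReal (Real.exp (φ z w)) :=
      (Real.measurable_exp.comp (hφ1 z)).ennreal_ofReal
    have h1 : ∀ ω, g (z, U ω) = ENNReal.ofReal (Real.exp (φ z z)) *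
        ∏ j ∈ T, ENNReal.ofReal (Real.exp (φ z (Z j ω))) := by
      intro ω
      simp only [hg, hU]
      rw [Finset.prod_coe_sort T fun j => ENNReal.ofReal (Real.exp (φ z (Z j ω)))]
    simp_rw [h1]
    have hm2 : Measurable fun ω => ∏ j ∈ T, ENNReal.ofReal (Real.exp (φ z (Z j ω))) :=
      Finset.measurable_prod _ fun j _ => hm.comp (hZ j)
    rw [lintegral_const_mul _ hm2,
      lintegral_prod_eq_prod_lintegral_of_indepFun T
        (fun j ω => ENNReal.ofReal (Real.exp (φ z (Z j ω))))
        (hind.comp (fun _ w => ENNReal.ofReal (Real.exp (φ z w))) fun _ => hm)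
        (fun j => hm.comp (hZ j))]
    rw [← Finset.prod_const]
    congr 1
    refine Finset.prod_congr rfl fun j _ => ?_
    rw [← hlaw j, lintegral_map hm (hZ j)]
  rw [← lintegral_map (f := g) (g := fun ω => (Z i ω, U ω)) hgm ((hZ i).prodMk hUm),
    (indepFun_iff_map_prod_eq_prod_map_map (hZ i).aemeasurable hUm.aemeasurable).1 hiU, hlaw i]
  have : IsProbabilityMeasure (P.map U) := Measure.isProbabilityMeasure_map hUm.aemeasurable
  rw [lintegral_prod _ hgm.aemeasurable]
  have hD0 : ∀ z, ∫⁻ u, g (z, u) ∂(P.map U) = ∫⁻ ω, g (z, U ω) ∂P := fun z =>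
    lintegral_map (hgm.comp (measurable_const.prodMk measurable_id)) hUm
  simp_rw [hD0, hinner]
  calc ∫⁻ z, ENNReal.ofReal (Real.exp (φ z z)) *
        (∫⁻ w, ENNReal.ofReal (Real.exp (φ z w)) ∂μ) ^ T.card ∂μ
      ≤ ∫⁻ z, ENNReal.ofReal (Real.exp (φ z z)) *
        ENNReal.ofReal (Real.exp (Fintype.card ι * B)) ∂μ := by
        refine lintegral_mono_ae ?_
        filter_upwards [hB] with z hz
        gcongr
        -- There is one factor fewer than the cardinality of `ι`; rounding the exponent up is
        -- allowed because `0 ≤ B`.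
        refine (pow_le_pow_left' hz _).trans ?_
        rw [← ENNReal.ofReal_pow (Real.exp_pos _).le, ← Real.exp_nat_mul]
        refine ENNReal.ofReal_le_ofReal (Real.exp_le_exp.2 ?_)
        gcongr
        exact Finset.card_le_univ T
    _ ≤ _ := by
        have hm3 : Measurable fun z => ENNReal.ofReal (Real.exp (φ z z)) :=
          (Real.measurable_exp.comp hφd).ennreal_ofReal
        rw [lintegral_mul_const _ hm3,
          ENNReal.ofReal_mul' (Real.exp_pos _).le]
        gcongr

/-- Chernoff's bound for a sum over pairs that share one member. -/
lemma measure_le_sum_le [IsProbabilityMeasure P] [Fintype ι] [DecidableEq ι] {μ : Measure E}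
    {Z : ι → Ω₀ → E} (hZ : ∀ j, Measurable (Z j)) (hind : iIndepFun Z P)
    (hlaw : ∀ j, P.map (Z j) = μ) {φ : E → E → ℝ} (hφ : Measurable (Function.uncurry φ))
    {B D : ℝ} (hB0 : 0 ≤ B)
    (hB : ∀ᵐ z ∂μ, ∫⁻ w, ENNReal.ofReal (Real.exp (φ z w)) ∂μ ≤ ENNReal.ofReal (Real.exp B))
    (hD : ∫⁻ z, ENNReal.ofReal (Real.exp (φ z z)) ∂μ ≤ ENNReal.ofReal D) (i : ι) (A : ℝ) :
    P {ω | A ≤ ∑ j, φ (Z i ω) (Z j ω)} ≤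
      ENNReal.ofReal (D * Real.exp (Fintype.card ι * B - A)) := by
  have hm : Measurable fun ω => ∑ j, φ (Z i ω) (Z j ω) :=
    Finset.measurable_sum _ fun j _ => hφ.comp ((hZ i).prodMk (hZ j))
  have h1 := meas_ge_le_lintegral_div (μ := P)
    (f := fun ω => ENNReal.ofReal (Real.exp (∑ j, φ (Z i ω) (Z j ω))))
    (Real.measurable_exp.comp hm).ennreal_ofReal.aemeasurable
    (ε := ENNReal.ofReal (Real.exp A)) (by simp [Real.exp_pos]) ENNReal.ofReal_ne_top
  refine le_trans (measure_mono fun ω hω => ?_) (h1.trans ?_)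
  · exact ENNReal.ofReal_le_ofReal (Real.exp_le_exp.2 hω)
  · refine (ENNReal.div_le_div_right
      (lintegral_exp_sum_le hZ hind hlaw hφ hB0 hB hD i) _).trans ?_
    rw [← ENNReal.ofReal_div_of_pos (Real.exp_pos _), Real.exp_sub, mul_div_assoc]

/-- Uses `exp u ≤ 1 + u + u²` for `|u| ≤ 1`. The quadratic term is needed only on `S`, so the
exponent carries `μ(S)`. For a kernel window this is of order `h`, which is why the final bounds
involve `n h` rather than `n`. -/
lemma lintegral_exp_le_of_bounded {μ : Measure E} [IsProbabilityMeasure μ] {ξ : E → ℝ}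
    (hξ : Measurable ξ) {κ s : ℝ} (hκ : ∀ w, |ξ w| ≤ κ) {S : Set E} (hS : MeasurableSet S)
    (hξS : ∀ w, w ∉ S → ξ w = 0) (hs : |s| * κ ≤ 1) :
    ∫⁻ w, ENNReal.ofReal (Real.exp (s * (ξ w - ∫ w', ξ w' ∂μ))) ∂μ ≤
      ENNReal.ofReal (Real.exp (s ^ 2 * κ ^ 2 * μ.real S)) := by
  have hint : Integrable ξ μ := Integrable.of_bound hξ.aestronglyMeasurable κ
    (Filter.Eventually.of_forall hκ)
  have hb : ∀ w, |s * ξ w| ≤ 1 := fun w => by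
    rw [abs_mul]
    exact (mul_le_mul_of_nonneg_left (hκ w) (abs_nonneg s)).trans hs
  set m := ∫ w', ξ w' ∂μ with hm
  have h1 : ∀ w, Real.exp (s * (ξ w - m)) ≤
      Real.exp (-(s * m)) * (1 + s * ξ w + S.indicator (fun _ => s ^ 2 * κ ^ 2) w) := by
    intro w
    rw [show s * (ξ w - m) = -(s * m) + s * ξ w by ring, Real.exp_add]
    refine mul_le_mul_of_nonneg_left ?_ (Real.exp_pos _).le
    by_cases hw : w ∈ S
    · rw [Set.indicator_of_mem hw]
      have h2 := (le_abs_self _).trans (Real.abs_exp_sub_one_sub_id_le (hb w))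
      have h3 : (s * ξ w) ^ 2 ≤ s ^ 2 * κ ^ 2 := by
        rw [mul_pow]
        exact mul_le_mul_of_nonneg_left (sq_le_sq' (abs_le.1 (hκ w)).1 (abs_le.1 (hκ w)).2)
          (sq_nonneg _)
      linarith
    · rw [Set.indicator_of_notMem hw, hξS w hw]
      simp
  have hi2 : Integrable (fun w => Real.exp (-(s * m)) *
      (1 + s * ξ w + S.indicator (fun _ => s ^ 2 * κ ^ 2) w)) μ :=
    ((((integrable_const 1).add (hint.const_mul s)).add
      ((integrable_const _).indicator hS)).const_mul _)
  calc ∫⁻ w, ENNReal.ofReal (Real.exp (s * (ξ w - m))) ∂μ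
      ≤ ∫⁻ w, ENNReal.ofReal (Real.exp (-(s * m)) *
      (1 + s * ξ w + S.indicator (fun _ => s ^ 2 * κ ^ 2) w)) ∂μ :=
        lintegral_mono fun w => ENNReal.ofReal_le_ofReal (h1 w)
    _ = ENNReal.ofReal (∫ w, Real.exp (-(s * m)) *
      (1 + s * ξ w + S.indicator (fun _ => s ^ 2 * κ ^ 2) w) ∂μ) :=
        (ofReal_integral_eq_lintegral_ofReal hi2 (Filter.Eventually.of_forall fun w =>
          (Real.exp_pos _).le.trans (h1 w))).symm
    _ ≤ _ := by
        refine ENNReal.ofReal_le_ofReal ?_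
        have hlin : Integrable (fun w => 1 + s * ξ w) μ :=
          (integrable_const 1).add (hint.const_mul s)
        rw [integral_const_mul, integral_add hlin
          ((integrable_const _).indicator hS), integral_add (integrable_const 1)
          (hint.const_mul s), integral_const_mul, integral_indicator_const _ hS, ← hm]
        simp only [integral_const, probReal_univ, smul_eq_mul, one_mul]
        have h4 := Real.add_one_le_exp (s * m + μ.real S * (s ^ 2 * κ ^ 2))
        calc _ ≤ Real.exp (-(s * m)) * Real.exp (s * m + μ.real S * (s ^ 2 * κ ^ 2)) :=
              mul_le_mul_of_nonneg_left (by linarith) (Real.exp_pos _).le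
          _ = _ := by rw [← Real.exp_add]; congr 1; ring

/-- Concentration of a bounded localized average around its conditional mean. -/
lemma measure_le_abs_sum_sub_le [IsProbabilityMeasure P] [Fintype ι] [DecidableEq ι]
    {μ : Measure E} [IsProbabilityMeasure μ]
    {Z : ι → Ω₀ → E} (hZ : ∀ j, Measurable (Z j)) (hind : iIndepFun Z P)
    (hlaw : ∀ j, P.map (Z j) = μ) {ξ : E → E → ℝ} (hξ : Measurable (Function.uncurry ξ))
    {κ s q : ℝ} (hκ : ∀ z w, |ξ z w| ≤ κ) {S : E → Set E} (hS : ∀ z, MeasurableSet (S z))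
    (hξS : ∀ z w, w ∉ S z → ξ z w = 0) (hq : ∀ z, μ.real (S z) ≤ q) (hs0 : 0 ≤ s)
    (hs : s * κ ≤ 1) (i : ι) (A : ℝ) :
    P {ω | A ≤ |∑ j, (ξ (Z i ω) (Z j ω) - ∫ w, ξ (Z i ω) w ∂μ)|} ≤
      ENNReal.ofReal (2 * Real.exp 2 *
        Real.exp (Fintype.card ι * (s ^ 2 * κ ^ 2 * q) - s * A)) := by
  have hmm : Measurable fun z => ∫ w, ξ z w ∂μ :=
    (hξ.stronglyMeasurable.integral_prod_right).measurable
  have hmb : ∀ z, |∫ w, ξ z w ∂μ| ≤ κ := fun z => by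
    have := norm_integral_le_of_norm_le_const (μ := μ) (f := ξ z) (C := κ)
      (Filter.Eventually.of_forall (hκ z))
    simpa using this
  have key : ∀ s' : ℝ, |s'| = s →
      P {ω | s * A ≤ ∑ j, s' * (ξ (Z i ω) (Z j ω) - ∫ w, ξ (Z i ω) w ∂μ)} ≤
      ENNReal.ofReal (Real.exp 2 *
        Real.exp (Fintype.card ι * (s ^ 2 * κ ^ 2 * q) - s * A)) := by
    intro s' hs'
    have hq0 : ∀ z : E, 0 ≤ q := fun z => measureReal_nonneg.trans (hq z)
    obtain ⟨z₀⟩ : Nonempty E := by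
      by_contra hE
      rw [not_nonempty_iff] at hE
      exact (IsProbabilityMeasure.ne_zero μ) (Measure.eq_zero_of_isEmpty μ)
    have hsq : s' ^ 2 = s ^ 2 := by rw [← hs', sq_abs]
    -- The constant `D = exp 2` pays for the diagonal term: a value and its mean are each at most
    -- `κ` in size, and `s κ ≤ 1`.
    refine measure_le_sum_le hZ hind hlaw
      (φ := fun z w => s' * (ξ z w - ∫ w, ξ z w ∂μ)) ?_ ?_ ?_ ?_ i (s * A)
    · exact measurable_const.mul (hξ.sub (hmm.comp measurable_fst))
    · have := hq0 z₀; positivity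
    · refine Filter.Eventually.of_forall fun z => ?_
      refine (lintegral_exp_le_of_bounded (hξ.of_uncurry_left) (hκ z) (hS z) (hξS z)
        (by rwa [hs'])).trans ?_
      rw [hsq]
      refine ENNReal.ofReal_le_ofReal (Real.exp_le_exp.2 ?_)
      exact mul_le_mul_of_nonneg_left (hq z) (by positivity)
    · calc _ ≤ ∫⁻ _z : E, ENNReal.ofReal (Real.exp 2) ∂μ := by
            refine lintegral_mono fun z => ENNReal.ofReal_le_ofReal (Real.exp_le_exp.2 ?_)
            refine (le_abs_self _).trans ?_
            rw [abs_mul, hs']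
            have h1 := abs_sub (ξ z z) (∫ w, ξ z w ∂μ)
            have h2 := hκ z z
            have h3 := hmb z
            nlinarith
        _ = _ := by simp
  have hsub : {ω | A ≤ |∑ j, (ξ (Z i ω) (Z j ω) - ∫ w, ξ (Z i ω) w ∂μ)|} ⊆
      {ω | s * A ≤ ∑ j, s * (ξ (Z i ω) (Z j ω) - ∫ w, ξ (Z i ω) w ∂μ)} ∪
      {ω | s * A ≤ ∑ j, (-s) * (ξ (Z i ω) (Z j ω) - ∫ w, ξ (Z i ω) w ∂μ)} := by
    intro ω hω
    rcases le_abs.1 (show A ≤ |_| from hω) with h | h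
    · left
      rw [Set.mem_ofPred_eq, ← Finset.mul_sum]
      exact mul_le_mul_of_nonneg_left h hs0
    · right
      rw [Set.mem_ofPred_eq, ← Finset.mul_sum, neg_mul, ← mul_neg]
      exact mul_le_mul_of_nonneg_left h hs0
  refine (measure_mono hsub).trans ((measure_union_le _ _).trans ?_)
  refine (add_le_add (key s (abs_of_nonneg hs0)) (key (-s) (by rw [abs_neg, abs_of_nonneg hs0]))).trans ?_
  rw [← ENNReal.ofReal_add (by positivity) (by positivity)]
  exact ENNReal.ofReal_le_ofReal (le_of_eq (by ring))

end Concentration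

/-! ### Integration against the joint law of design point and response. -/

section JointLaw

open ProbabilityTheory

/-- The joint law of a design point and its response. -/
def jointLaw (F : ExpFamily) (Ω : Set ℝ) (f θ : ℝ → ℝ) : Measure (ℝ × ℝ) :=
  ((volume.restrict Ω).prod F.ν).withDensity
    fun z => ENNReal.ofReal (f z.1 * F.density (θ z.1) z.2)

variable {F : ExpFamily} {Ω : Set ℝ} {f θ : ℝ → ℝ}

/-- Since `f` and `θ` are controlled only on `Ω`, the density is merely almost everywhere
measurable. -/
lemma aemeasurable_jointDensity (hΩm : MeasurableSet Ω) (hf : ContinuousOn f Ω)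
    (hb : ContinuousOn F.b F.Θ) (hθ : ContinuousOn θ Ω) (hθΘ : ∀ x ∈ Ω, θ x ∈ F.Θ) :
    AEMeasurable (fun z : ℝ × ℝ => ENNReal.ofReal (f z.1 * F.density (θ z.1) z.2))
      ((volume.restrict Ω).prod F.ν) := by
  have hq := Measure.quasiMeasurePreserving_fst (μ := volume.restrict Ω) (ν := F.ν)
  have h1 : AEMeasurable (fun z : ℝ × ℝ => f z.1) ((volume.restrict Ω).prod F.ν) :=
    (hf.aemeasurable hΩm).comp_quasiMeasurePreserving hq
  have h2 : AEMeasurable (fun z : ℝ × ℝ => θ z.1) ((volume.restrict Ω).prod F.ν) :=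
    (hθ.aemeasurable hΩm).comp_quasiMeasurePreserving hq
  have h3 : AEMeasurable (fun z : ℝ × ℝ => F.b (θ z.1)) ((volume.restrict Ω).prod F.ν) :=
    ((hb.comp hθ hθΘ).aemeasurable hΩm).comp_quasiMeasurePreserving hq
  have h4 : AEMeasurable (fun z : ℝ × ℝ => F.c z.2 F.ψ) ((volume.restrict Ω).prod F.ν) :=
    (F.measurable_c.comp measurable_snd).aemeasurable
  have h5 : AEMeasurable (fun z : ℝ × ℝ => z.2) ((volume.restrict Ω).prod F.ν) :=
    measurable_snd.aemeasurable
  refine (h1.mul ?_).ennreal_ofReal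
  exact Real.measurable_exp.comp_aemeasurable ((((h5.mul h2).sub h3).div_const _).add h4)

lemma lintegral_jointLaw (hΩm : MeasurableSet Ω) (hf : ContinuousOn f Ω)
    (hf0 : ∀ x ∈ Ω, 0 ≤ f x) (hb : ContinuousOn F.b F.Θ) (hθ : ContinuousOn θ Ω)
    (hθΘ : ∀ x ∈ Ω, θ x ∈ F.Θ) {g : ℝ × ℝ → ENNReal} (hg : Measurable g) :
    ∫⁻ z, g z ∂(jointLaw F Ω f θ) = ∫⁻ x in Ω, ENNReal.ofReal (f x) *
      ∫⁻ y, ENNReal.ofReal (F.density (θ x) y) * g (x, y) ∂F.ν := by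
  have hm := aemeasurable_jointDensity hΩm hf hb hθ hθΘ
  rw [jointLaw, lintegral_withDensity_eq_lintegral_mul₀ hm hg.aemeasurable,
    lintegral_prod _ (hm.mul hg.aemeasurable)]
  refine setLIntegral_congr_fun hΩm fun x hx => ?_
  have hm2 : Measurable fun y => ENNReal.ofReal (F.density (θ x) y) * g (x, y) :=
    (F.measurable_density _).ennreal_ofReal.mul (hg.comp (measurable_const.prodMk measurable_id))
  rw [← lintegral_const_mul _ hm2]
  refine lintegral_congr fun y => ?_
  simp only [Pi.mul_apply]
  rw [ENNReal.ofReal_mul (hf0 x hx), mul_assoc]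

lemma lintegral_jointLaw_fst (hΩm : MeasurableSet Ω) (hf : ContinuousOn f Ω)
    (hf0 : ∀ x ∈ Ω, 0 ≤ f x) (hb : ContinuousOn F.b F.Θ) (hθ : ContinuousOn θ Ω)
    (hθΘ : ∀ x ∈ Ω, θ x ∈ F.Θ) {g : ℝ → ENNReal} (hg : Measurable g) :
    ∫⁻ z, g z.1 ∂(jointLaw F Ω f θ) = ∫⁻ x in Ω, ENNReal.ofReal (f x) * g x := by
  rw [lintegral_jointLaw hΩm hf hf0 hb hθ hθΘ (g := fun z => g z.1) (hg.comp measurable_fst)]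
  refine setLIntegral_congr_fun hΩm fun x hx => ?_
  dsimp only
  rw [lintegral_mul_const _ (F.measurable_density _).ennreal_ofReal,
    F.lintegral_density (hθΘ x hx), one_mul]

lemma map_fst_jointLaw (hΩm : MeasurableSet Ω) (hf : ContinuousOn f Ω)
    (hf0 : ∀ x ∈ Ω, 0 ≤ f x) (hb : ContinuousOn F.b F.Θ) (hθ : ContinuousOn θ Ω)
    (hθΘ : ∀ x ∈ Ω, θ x ∈ F.Θ) :
    (jointLaw F Ω f θ).map Prod.fst =
      (volume.restrict Ω).withDensity fun x => ENNReal.ofReal (f x) := by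
  ext s hs
  have h1 := lintegral_jointLaw_fst hΩm hf hf0 hb hθ hθΘ
    (g := s.indicator 1) (measurable_one.indicator hs)
  rw [Measure.map_apply measurable_fst hs, withDensity_apply _ hs,
    ← lintegral_indicator_one (measurable_fst hs)]
  refine Eq.trans ?_ (h1.trans ?_)
  · exact lintegral_congr fun z => rfl
  · rw [← lintegral_indicator hs]
    exact lintegral_congr fun x => by simp [Set.indicator]

lemma integral_jointLaw_fst (hΩm : MeasurableSet Ω) (hf : ContinuousOn f Ω)
    (hf0 : ∀ x ∈ Ω, 0 ≤ f x) (hb : ContinuousOn F.b F.Θ) (hθ : ContinuousOn θ Ω)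
    (hθΘ : ∀ x ∈ Ω, θ x ∈ F.Θ) {g : ℝ → ℝ} (hg : Measurable g) :
    ∫ z, g z.1 ∂(jointLaw F Ω f θ) = ∫ x in Ω, f x * g x := by
  rw [← integral_map (φ := Prod.fst) (f := g) measurable_fst.aemeasurable hg.aestronglyMeasurable,
    map_fst_jointLaw hΩm hf hf0 hb hθ hθΘ,
    integral_withDensity_eq_integral_toReal_smul₀ (hf.aemeasurable hΩm).ennreal_ofReal
      (Filter.Eventually.of_forall fun _ => ENNReal.ofReal_lt_top)]
  refine setIntegral_congr_fun hΩm fun x hx => ?_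
  simp only [ENNReal.toReal_ofReal (hf0 x hx), smul_eq_mul]

lemma jointLaw_fst_le (hΩm : MeasurableSet Ω) (hf : ContinuousOn f Ω)
    (hf0 : ∀ x ∈ Ω, 0 ≤ f x) (hb : ContinuousOn F.b F.Θ) (hθ : ContinuousOn θ Ω)
    (hθΘ : ∀ x ∈ Ω, θ x ∈ F.Θ) {M : ℝ} (hM : ∀ x ∈ Ω, f x ≤ M) {S : Set ℝ}
    (hS : MeasurableSet S) :
    jointLaw F Ω f θ (Prod.fst ⁻¹' S) ≤ ENNReal.ofReal M * volume S := by
  rw [← Measure.map_apply measurable_fst hS, map_fst_jointLaw hΩm hf hf0 hb hθ hθΘ,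
    withDensity_apply _ hS]
  calc ∫⁻ x in S, ENNReal.ofReal (f x) ∂(volume.restrict Ω)
      ≤ ∫⁻ _x in S, ENNReal.ofReal M ∂(volume.restrict Ω) := by
        refine lintegral_mono_ae ?_
        filter_upwards [ae_restrict_of_ae (ae_restrict_mem hΩm)] with x hx
        exact ENNReal.ofReal_le_ofReal (hM x hx)
    _ ≤ _ := by
        rw [lintegral_const]
        rw [Measure.restrict_apply_univ]
        gcongr
        exact Measure.restrict_le_self

/-- Exponential moments of the centred response, weighted by a function of the design point. -/
lemma lintegral_exp_score_le (hΩm : MeasurableSet Ω) (hf : ContinuousOn f Ω)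
    (hf0 : ∀ x ∈ Ω, 0 ≤ f x) (hb : ContDiffOn ℝ 2 F.b F.Θ) (hθ : ContinuousOn θ Ω)
    (hθΘ : ∀ x ∈ Ω, θ x ∈ F.Θ) [IsProbabilityMeasure (jointLaw F Ω f θ)] {ρ M : ℝ}
    (hρ : ∀ x ∈ Ω, Metric.closedBall (θ x) ρ ⊆ F.Θ)
    (hM : ∀ x ∈ Ω, ∀ t ∈ Metric.closedBall (θ x) ρ, F.b'' t ≤ M) (hM0 : 0 ≤ M)
    {m : ℝ → ℝ} (hm : Measurable m) (hmΩ : ∀ x ∈ Ω, m x = deriv F.b (θ x))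
    {κ : ℝ → ℝ} (hκ : Measurable κ) {k₀ s : ℝ} (hκ0 : ∀ x, |κ x| ≤ k₀) {S : Set ℝ}
    (hS : MeasurableSet S) (hκS : ∀ x ∉ S, κ x = 0) (hs : F.a F.ψ * (|s| * k₀) ≤ ρ)
    (hs1 : F.a F.ψ * M / 2 * (s * k₀) ^ 2 ≤ 1) :
    ∫⁻ z, ENNReal.ofReal (Real.exp (s * ((z.2 - m z.1) * κ z.1))) ∂(jointLaw F Ω f θ) ≤
      ENNReal.ofReal (Real.exp (F.a F.ψ * M * (s * k₀) ^ 2 *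
        (jointLaw F Ω f θ).real (Prod.fst ⁻¹' S))) := by
  have ha := F.a_pos
  -- The conditional exponential moment is at most `exp v ≤ 1 + 2 v` when `x ∈ S`, as `v ≤ 1`, and
  -- equals `1` otherwise; integrating the indicator produces the mass of `S`.
  set v := F.a F.ψ * M / 2 * (s * k₀) ^ 2 with hv
  have hv0 : 0 ≤ v := by positivity
  have hg : Measurable fun z : ℝ × ℝ =>
      ENNReal.ofReal (Real.exp (s * ((z.2 - m z.1) * κ z.1))) := by fun_prop
  have hg2 : Measurable fun x : ℝ => ENNReal.ofReal (1 + S.indicator (fun _ => 2 * v) x) :=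
    (measurable_const.add (measurable_const.indicator hS)).ennreal_ofReal
  have hstep : ∫⁻ z, ENNReal.ofReal (Real.exp (s * ((z.2 - m z.1) * κ z.1))) ∂(jointLaw F Ω f θ) ≤
      ∫⁻ z, ENNReal.ofReal (1 + S.indicator (fun _ => 2 * v) z.1) ∂(jointLaw F Ω f θ) := by
    rw [lintegral_jointLaw hΩm hf hf0 hb.continuousOn hθ hθΘ hg,
      lintegral_jointLaw_fst hΩm hf hf0 hb.continuousOn hθ hθΘ hg2]
    refine setLIntegral_mono' hΩm fun x hx => ?_
    gcongr
    have h1 := F.lintegral_exp_centred_le hb (s := s * κ x) (hρ x hx) (hM x hx) (by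
      rw [abs_mul]
      refine le_trans ?_ hs
      gcongr
      exact hκ0 x)
    dsimp only
    rw [hmΩ x hx]
    refine le_trans (le_of_eq ?_) (h1.trans ?_)
    · refine lintegral_congr fun y => ?_
      rw [show s * ((y - deriv F.b (θ x)) * κ x) = s * κ x * (y - deriv F.b (θ x)) by ring]
    · refine ENNReal.ofReal_le_ofReal ?_
      by_cases hxS : x ∈ S
      · rw [Set.indicator_of_mem hxS]
        have h2 : F.a F.ψ * M / 2 * (s * κ x) ^ 2 ≤ v := by
          rw [hv]
          refine mul_le_mul_of_nonneg_left ?_ (by positivity)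
          rw [mul_pow, mul_pow]
          exact mul_le_mul_of_nonneg_left
            (sq_le_sq' (abs_le.1 (hκ0 x)).1 (abs_le.1 (hκ0 x)).2) (sq_nonneg _)
        have h3 := (le_abs_self _).trans (Real.abs_exp_sub_one_sub_id_le (x := v)
          (by rwa [abs_of_nonneg hv0]))
        have h4 := Real.exp_le_exp.2 h2
        nlinarith
      · rw [Set.indicator_of_notMem hxS, hκS x hxS]
        simp
  refine hstep.trans ?_
  have hfun : ∀ z : ℝ × ℝ, 1 + S.indicator (fun _ => 2 * v) z.1 =
      1 + (Prod.fst ⁻¹' S).indicator (fun _ => 2 * v) z := fun z => rfl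
  have hS2 : MeasurableSet (Prod.fst ⁻¹' S : Set (ℝ × ℝ)) := measurable_fst hS
  simp_rw [hfun]
  have hint : Integrable (fun z : ℝ × ℝ => 1 + (Prod.fst ⁻¹' S).indicator (fun _ => 2 * v) z)
      (jointLaw F Ω f θ) := (integrable_const 1).add ((integrable_const _).indicator hS2)
  rw [← ofReal_integral_eq_lintegral_ofReal hint (Filter.Eventually.of_forall fun z => by
    simp only [Pi.zero_apply, Set.indicator]; split_ifs <;> linarith),
    integral_add (integrable_const 1) ((integrable_const _).indicator hS2),
    integral_indicator_const _ hS2]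
  refine ENNReal.ofReal_le_ofReal ?_
  simp only [integral_const, probReal_univ, smul_eq_mul, one_mul]
  have := Real.add_one_le_exp (F.a F.ψ * M * (s * k₀) ^ 2 *
    (jointLaw F Ω f θ).real (Prod.fst ⁻¹' S))
  refine le_trans (le_of_eq ?_) this
  rw [hv]; ring

end JointLaw

/-! ### Uniform neighbourhoods of the true parameter; information and score on the good event. -/

section HatLimit

open Matrix

/-- By Cramer's rule the entry is a quotient of polynomials in the matrix entries, hence continuous
where the determinant is nonzero. -/
lemma exists_inv_zero_zero_close {p : ℕ} {S : Matrix (Fin (p + 1)) (Fin (p + 1)) ℝ}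
    (hS : IsUnit S.det) {e : ℝ} (he : 0 < e) :
    ∃ d > 0, ∀ A : Matrix (Fin (p + 1)) (Fin (p + 1)) ℝ, (∀ k l, |A k l - S k l| ≤ d) →
      |A⁻¹ 0 0 - S⁻¹ 0 0| ≤ e := by
  set g : (Fin (p + 1) → Fin (p + 1) → ℝ) → ℝ := fun A => (Matrix.of A)⁻¹ 0 0 with hg
  have hc : ContinuousAt g S := by
    have h1 : g = fun A => (Matrix.of A).det⁻¹ * (Matrix.of A).adjugate 0 0 := by
      ext A
      simp [hg, Matrix.inv_def]
    have hid : Continuous fun A : Fin (p + 1) → Fin (p + 1) → ℝ => Matrix.of A := continuous_id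
    have h2 : Continuous fun A : Fin (p + 1) → Fin (p + 1) → ℝ => (Matrix.of A).det :=
      hid.matrix_det
    have h3 : Continuous fun A : Fin (p + 1) → Fin (p + 1) → ℝ => (Matrix.of A).adjugate 0 0 :=
      hid.matrix_adjugate.matrix_elem 0 0
    rw [h1]
    exact (h2.continuousAt.inv₀ (isUnit_iff_ne_zero.1 hS)).mul h3.continuousAt
  obtain ⟨d, hd, h⟩ := Metric.continuousAt_iff.1 hc e he
  refine ⟨d / 2, by positivity, fun A hA => ?_⟩
  have h1 : dist (α := Fin (p + 1) → Fin (p + 1) → ℝ) A S < d := by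
    refine lt_of_le_of_lt ?_ (half_lt_self hd)
    exact (dist_pi_le_iff (by positivity)).2 fun k =>
      (dist_pi_le_iff (by positivity)).2 fun l => by rw [Real.dist_eq]; exact hA k l
  exact (h h1).le

/-- The compact set `θ(Ω)` has a compact thickening inside the open set where `b'' > d / 2`.
Boundedness and uniform continuity of `b''` on that thickening give the remaining constants. -/
lemma exists_radius {F : ExpFamily} {Ω : Set ℝ} {θ : ℝ → ℝ} (hb : ContDiffOn ℝ 2 F.b F.Θ)
    (hb'' : ∃ d > 0, ∀ x ∈ Ω, d ≤ F.b'' (θ x)) (hΩ : IsCompact Ω) (hθ : ContinuousOn θ Ω)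
    (hθΘ : ∀ x ∈ Ω, θ x ∈ F.Θ) :
    ∃ ρ > 0, ∃ c > 0, ∃ M > 0, (∀ x ∈ Ω, Metric.closedBall (θ x) ρ ⊆ F.Θ) ∧
      (∀ x ∈ Ω, ∀ t ∈ Metric.closedBall (θ x) ρ, c ≤ F.b'' t ∧ F.b'' t ≤ M) ∧
      ∀ e > 0, ∃ r > 0, r ≤ ρ ∧ ∀ x ∈ Ω, ∀ t ∈ Metric.closedBall (θ x) r,
        |F.b'' t - F.b'' (θ x)| ≤ e := by
  obtain ⟨d, hd, hbd⟩ := hb''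
  have hcb := ExpFamily.continuousOn_b'' hb
  have hT : IsCompact (θ '' Ω) := hΩ.image_of_continuousOn hθ
  have hU : IsOpen (F.Θ ∩ F.b'' ⁻¹' Set.Ioi (d / 2)) :=
    hcb.isOpen_inter_preimage F.isOpen_Θ isOpen_Ioi
  obtain ⟨ρ, hρ, hsub⟩ := hT.exists_cthickening_subset_open hU (by
    rintro _ ⟨x, hx, rfl⟩
    exact ⟨hθΘ x hx, (half_lt_self hd).trans_le (hbd x hx)⟩)
  have hball : ∀ x ∈ Ω, Metric.closedBall (θ x) ρ ⊆ Metric.cthickening ρ (θ '' Ω) :=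
    fun x hx => Metric.closedBall_subset_cthickening (Set.mem_image_of_mem _ hx) _
  have hcomp : IsCompact (Metric.cthickening ρ (θ '' Ω)) := hT.cthickening
  have hcb' : ContinuousOn F.b'' (Metric.cthickening ρ (θ '' Ω)) :=
    hcb.mono (hsub.trans Set.inter_subset_left)
  obtain ⟨M, hM⟩ := hcomp.exists_bound_of_continuousOn hcb'
  refine ⟨ρ, hρ, d / 2, by positivity, max M 1, by positivity,
    fun x hx => (hball x hx).trans (hsub.trans Set.inter_subset_left), fun x hx t ht =>
    ⟨(hsub (hball x hx ht)).2.le, (le_abs_self _).trans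
      ((hM t (hball x hx ht)).trans (le_max_left _ _))⟩, fun e he => ?_⟩
  obtain ⟨r, hr, hur⟩ := Metric.uniformContinuousOn_iff_le.1
    (hcomp.uniformContinuousOn_of_continuous hcb') e he
  refine ⟨min r ρ, by positivity, min_le_right _ _, fun x hx t ht => ?_⟩
  rw [Metric.mem_closedBall] at ht
  exact hur t (hball x hx (Metric.mem_closedBall.2 (ht.trans (min_le_right _ _)))) (θ x)
    (hball x hx (Metric.mem_closedBall_self hρ.le)) (ht.trans (min_le_left _ _))

/-- The local design moments and the local scores at `x` are within `e` of their means. -/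
def IsGood (F : ExpFamily) (K : ℝ → ℝ) (Ω : Set ℝ) (f θ : ℝ → ℝ) (p : ℕ) (h e : ℝ) {n : ℕ}
    (X Y : Fin n → ℝ) (x : ℝ) : Prop :=
  (∀ k ≤ 2 * p, |∑ j, ((X j - x) / h) ^ k * K ((X j - x) / h) - n * h * popMoment K h Ω f x k| ≤
    e * (n * h)) ∧
  ∀ k ≤ p, |∑ j, (Y j - deriv F.b (θ (X j))) * (((X j - x) / h) ^ k * K ((X j - x) / h))| ≤
    e * (n * h)

variable {F : ExpFamily} {K : ℝ → ℝ} {Ω : Set ℝ} {f θ : ℝ → ℝ} {p n : ℕ} {h e : ℝ}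
  {X Y : Fin n → ℝ} {x : ℝ}

lemma IsGood.information_ge (hg : IsGood F K Ω f θ p h e X Y x) {l : ℝ} (hh : 0 < h)
    (hl : ∀ v : Fin (p + 1) → ℝ, l * ‖v‖ ^ 2 ≤ v ⬝ᵥ ((Matrix.of fun i j : Fin (p + 1) =>
        popMoment K h Ω f x ((i : ℕ) + (j : ℕ))) *ᵥ v))
    (he : (p + 1) ^ 2 * e ≤ l / 2) (v : Fin (p + 1) → ℝ) :
    n * h * (l / 2) * ‖v‖ ^ 2 ≤ ∑ j, K ((X j - x) / h) * evalPoly v ((X j - x) / h) ^ 2 := by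
  have h1 := quadratic_sub_le (e := e * (n * h))
    (A := (n * h) • (Matrix.of fun i j : Fin (p + 1) => popMoment K h Ω f x ((i : ℕ) + (j : ℕ))))
    (B := gram p (fun j => K ((X j - x) / h)) (fun j => (X j - x) / h)) (fun k l => by
      have := hg.1 ((k : ℕ) + (l : ℕ)) (by omega)
      rw [abs_sub_comm] at this
      simpa [gram, mul_comm] using this) v
  rw [dotProduct_gram_mulVec, smul_mulVec, dotProduct_smul, smul_eq_mul] at h1
  have h2 := mul_le_mul_of_nonneg_left (hl v) (by positivity : 0 ≤ n * h)
  have h3 := mul_le_mul_of_nonneg_right he (by positivity : 0 ≤ n * h * ‖v‖ ^ 2)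
  nlinarith

lemma IsGood.sum_kernel_le (hg : IsGood F K Ω f θ p h e X Y x) {A : ℝ} (hh : 0 < h)
    (hA : |popMoment K h Ω f x 0| ≤ A) (he : e ≤ 1) :
    ∑ j, K ((X j - x) / h) ≤ (A + 1) * (n * h) := by
  have h1 := (abs_le.1 (hg.1 0 (Nat.zero_le _))).2
  simp only [pow_zero, one_mul] at h1
  have h2 := mul_le_mul_of_nonneg_left ((le_abs_self _).trans hA) (by positivity : 0 ≤ n * h)
  have h3 := mul_le_mul_of_nonneg_right he (by positivity : 0 ≤ n * h)
  nlinarith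

/-- A weighted sum of small terms is small. -/
lemma abs_sum_kernel_mul_le (hK : ∀ t, 0 ≤ K t) {C o : ℝ} (hC : ∀ t, K t ≠ 0 → |t| ≤ C)
    {d : Fin n → ℝ} (hd : ∀ j, K ((X j - x) / h) ≠ 0 → |d j| ≤ o) (k : ℕ) :
    |∑ j, K ((X j - x) / h) * d j * ((X j - x) / h) ^ k| ≤
      o * C ^ k * ∑ j, K ((X j - x) / h) := by
  rw [Finset.mul_sum]
  refine (Finset.abs_sum_le_sum_abs _ _).trans (Finset.sum_le_sum fun j _ => ?_)
  by_cases h0 : K ((X j - x) / h) = 0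
  · simp [h0]
  · rw [abs_mul, abs_mul, abs_pow, abs_of_nonneg (hK _)]
    have h1 := hd j h0
    have h2 := hC _ h0
    have := (abs_nonneg _).trans h1
    calc K ((X j - x) / h) * |d j| * |(X j - x) / h| ^ k ≤ K ((X j - x) / h) * o * C ^ k := by
          have := hK ((X j - x) / h)
          gcongr
      _ = _ := by ring

/-- Splits the score into the centred responses, controlled by the good event, and the bias from
replacing the mean at `X j` by the mean at `x`, controlled by the oscillation `o` of `b' ∘ θ` over
the window. -/
lemma IsGood.score_le (hg : IsGood F K Ω f θ p h e X Y x) (hK : ∀ t, 0 ≤ K t) {C o A : ℝ}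
    (hC : ∀ t, K t ≠ 0 → |t| ≤ C) (hC1 : 1 ≤ C) (hh : 0 < h)
    (hA : |popMoment K h Ω f x 0| ≤ A) (he : e ≤ 1) (ho0 : 0 ≤ o)
    (ho : ∀ j, K ((X j - x) / h) ≠ 0 → |deriv F.b (θ (X j)) - deriv F.b (θ x)| ≤ o)
    (k : Fin (p + 1)) :
    |∑ j, K ((X j - x) / h) * (Y j - deriv F.b (θ x)) * ((X j - x) / h) ^ (k : ℕ)| ≤
      (e + o * C ^ p * (A + 1)) * (n * h) := by
  have hsplit : ∑ j, K ((X j - x) / h) * (Y j - deriv F.b (θ x)) * ((X j - x) / h) ^ (k : ℕ) =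
      ∑ j, (Y j - deriv F.b (θ (X j))) * (((X j - x) / h) ^ (k : ℕ) * K ((X j - x) / h)) +
      ∑ j, K ((X j - x) / h) * (deriv F.b (θ (X j)) - deriv F.b (θ x)) *
        ((X j - x) / h) ^ (k : ℕ) := by
    rw [← Finset.sum_add_distrib]
    exact Finset.sum_congr rfl fun j _ => by ring
  have hkp : (k : ℕ) ≤ p := Nat.lt_succ_iff.1 k.2
  have h1 := hg.2 k hkp
  have h2 := abs_sum_kernel_mul_le hK hC ho (k : ℕ)
  have h3 := hg.sum_kernel_le hh hA he
  have h4 : o * C ^ (k : ℕ) * ∑ j, K ((X j - x) / h) ≤ o * C ^ p * ((A + 1) * (n * h)) := by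
    have h5 : C ^ (k : ℕ) ≤ C ^ p := pow_le_pow_right₀ hC1 hkp
    have h6 : 0 ≤ ∑ j, K ((X j - x) / h) := Finset.sum_nonneg fun j _ => hK _
    gcongr
  rw [hsplit]
  refine (abs_add_le _ _).trans ?_
  linarith

end HatLimit

/-! ### Gram matrix and estimate on the good event. -/

section HatLimit

open Matrix

variable {F : ExpFamily} {K : ℝ → ℝ} {Ω : Set ℝ} {f θ : ℝ → ℝ} {p n : ℕ} {h e : ℝ}
  {X Y : Fin n → ℝ} {x : ℝ}

/-- The three error terms are the variation of the weights `b` across the window, the sampling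
fluctuation of the moments, and the smoothing bias of the expected moments. -/
lemma IsGood.gram_close (hg : IsGood F K Ω f θ p h e X Y x) (hK : ∀ t, 0 ≤ K t)
    {C A b₀ o M L μ : ℝ} (hC : ∀ t, K t ≠ 0 → |t| ≤ C) (hC1 : 1 ≤ C) (hh : 0 < h) (hn : 0 < n)
    (hA : |popMoment K h Ω f x 0| ≤ A) (he : e ≤ 1) {b : Fin n → ℝ}
    (ho : ∀ j, K ((X j - x) / h) ≠ 0 → |b j - b₀| ≤ o) (ho0 : 0 ≤ o)
    (hb₀ : |b₀| ≤ M) {k l : Fin (p + 1)}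
    (hL : |popMoment K h Ω f x ((k : ℕ) + (l : ℕ)) - f x * μ| ≤ L) :
    |gram p (fun j => K ((X j - x) / h) * b j / (n * h)) (fun j => (X j - x) / h) k l -
      f x * b₀ * μ| ≤ o * C ^ (2 * p) * (A + 1) + M * e + M * L := by
  have hN : (0 : ℝ) < n * h := by positivity
  set m : ℕ := (k : ℕ) + (l : ℕ) with hm
  have hm2 : m ≤ 2 * p := by omega
  have hsplit : gram p (fun j => K ((X j - x) / h) * b j / (n * h)) (fun j => (X j - x) / h) k l -
      f x * b₀ * μ = (∑ j, K ((X j - x) / h) * (b j - b₀) * ((X j - x) / h) ^ m) / (n * h) +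
      b₀ * ((∑ j, ((X j - x) / h) ^ m * K ((X j - x) / h) - n * h * popMoment K h Ω f x m) /
        (n * h)) + b₀ * (popMoment K h Ω f x m - f x * μ) := by
    have h1 : gram p (fun j => K ((X j - x) / h) * b j / (n * h)) (fun j => (X j - x) / h) k l =
        (∑ j, K ((X j - x) / h) * (b j - b₀) * ((X j - x) / h) ^ m) / (n * h) +
        b₀ * ((∑ j, ((X j - x) / h) ^ m * K ((X j - x) / h)) / (n * h)) := by
      rw [← mul_div_assoc, ← add_div, Finset.mul_sum, ← Finset.sum_add_distrib, Finset.sum_div]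
      simp only [gram, Matrix.of_apply, ← hm]
      exact Finset.sum_congr rfl fun j _ => by ring
    rw [h1, sub_div, mul_div_cancel_left₀ _ hN.ne']
    ring
  have h1 : |(∑ j, K ((X j - x) / h) * (b j - b₀) * ((X j - x) / h) ^ m) / (n * h)| ≤
      o * C ^ (2 * p) * (A + 1) := by
    rw [abs_div, abs_of_pos hN, div_le_iff₀ hN]
    refine (abs_sum_kernel_mul_le hK hC ho m).trans ?_
    have h5 : C ^ m ≤ C ^ (2 * p) := pow_le_pow_right₀ hC1 hm2
    have h6 : 0 ≤ ∑ j, K ((X j - x) / h) := Finset.sum_nonneg fun j _ => hK _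
    rw [mul_assoc _ (A + 1)]
    have := hg.sum_kernel_le hh hA he
    gcongr
  have h2 : |b₀ * ((∑ j, ((X j - x) / h) ^ m * K ((X j - x) / h) -
      n * h * popMoment K h Ω f x m) / (n * h))| ≤ M * e := by
    rw [abs_mul, abs_div, abs_of_pos hN]
    have := hg.1 m hm2
    have h0 : 0 ≤ M := (abs_nonneg _).trans hb₀
    refine mul_le_mul hb₀ ?_ (by positivity) h0
    rwa [div_le_iff₀ hN]
  have h3 : |b₀ * (popMoment K h Ω f x m - f x * μ)| ≤ M * L := by
    rw [abs_mul]
    exact mul_le_mul hb₀ hL (abs_nonneg _) ((abs_nonneg _).trans hb₀)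
  rw [hsplit]
  refine (abs_add_le _ _).trans (add_le_add ((abs_add_le _ _).trans (add_le_add h1 h2)) h3)

/-- On the good event the local maximum likelihood estimate is consistent. -/
lemma IsGood.estimate_close (hb : ContDiffOn ℝ 2 F.b F.Θ) (hK : ∀ t, 0 ≤ K t)
    {C c₀ l A o ρ r : ℝ} (hC : ∀ t, K t ≠ 0 → |t| ≤ C) (hC1 : 1 ≤ C) (hh : 0 < h) (hn : 0 < n)
    (hρ : Metric.closedBall (θ x) ρ ⊆ F.Θ)
    (hc : ∀ s ∈ Metric.closedBall (θ x) ρ, c₀ ≤ F.b'' s) (hc0 : 0 < c₀)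
    (hl : ∀ v : Fin (p + 1) → ℝ, l * ‖v‖ ^ 2 ≤ v ⬝ᵥ ((Matrix.of fun i j : Fin (p + 1) =>
        popMoment K h Ω f x ((i : ℕ) + (j : ℕ))) *ᵥ v))
    (hA : |popMoment K h Ω f x 0| ≤ A) (ho0 : 0 ≤ o)
    (ho : ∀ j, K ((X j - x) / h) ≠ 0 → |deriv F.b (θ (X j)) - deriv F.b (θ x)| ≤ o)
    (hg : IsGood F K Ω f θ p h e X Y x) (he1 : e ≤ 1) (he : (p + 1) ^ 2 * e ≤ l / 2)
    (hr : 0 < r) (hrρ : r ≤ ρ)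
    (her : (p + 1) * (e + o * C ^ p * (A + 1)) < c₀ / 2 * (l / 2) * (r / ((p + 1) * C ^ p)))
    {β : Fin (p + 1) → ℝ} (hβ : IsLocalMLE F K h X Y x β) {u : ℝ} (hu : |u - x| ≤ C * h) :
    localPoly β x u ∈ Metric.closedBall (θ x) r := by
  have hCp : 0 < C ^ p := by positivity
  have hr' : (p + 1) * C ^ p * (r / ((p + 1) * C ^ p)) = r := by field_simp
  -- Coefficients of norm at most `r / ((p + 1) C ^ p)` give a polynomial bounded by `r` on the
  -- rescaled window `[-C, C]`.
  have h1 := norm_scaledCoeff_lt_of_isLocalMLE (r := r / ((p + 1) * C ^ p)) (t₀ := θ x)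
    (Λ := n * h * (l / 2)) (η := (e + o * C ^ p * (A + 1)) * (n * h)) hb hh hK hC hC1 hρ hc hc0
    (by positivity) (by rw [hr']; exact hrρ) (hg.information_ge hh hl he)
    (hg.score_le hK hC hC1 hh hA he1 ho0 ho) (by
      have hN : (0 : ℝ) < n * h := by positivity
      have := mul_lt_mul_of_pos_right her hN
      refine lt_of_le_of_lt (le_of_eq ?_) (this.trans_eq ?_) <;> ring) hβ
  rw [localPoly_eq hh (θ x), Metric.mem_closedBall, Real.dist_eq, add_sub_cancel_left]
  refine abs_evalPoly_le_radius hC1 hr'.le ?_ h1.le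
  rwa [abs_div, abs_of_pos hh, div_le_iff₀ hh]

end HatLimit

/-! ### Limit of a single rescaled hat value. -/

section HatLimit

open Matrix

variable {F : ExpFamily} {K : ℝ → ℝ} {Ω : Set ℝ} {f θ : ℝ → ℝ} {p : ℕ}

lemma abs_mul_div_sub_le {k₀ b₁ b₀ g g' y d c e₁ e₂ : ℝ} (hk : 0 ≤ k₀) (hd : 0 < d) (hy : d ≤ y)
    (hc : 0 < c) (hb₀ : c ≤ b₀) (hb : |b₁ - b₀| ≤ e₂) (hg : |g' - g| ≤ e₁) (hg0 : 0 ≤ g)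
    (he₁ : e₁ ≤ 1) :
    |k₀ * b₁ * (g' / (y * b₀)) - g * k₀ / y| ≤ k₀ / d * (e₁ + (g + 1) * e₂ / c) := by
  have hy0 : 0 < y := hd.trans_le hy
  have hb0 : 0 < b₀ := hc.trans_le hb₀
  have h1 : k₀ * b₁ * (g' / (y * b₀)) - g * k₀ / y =
      k₀ / y * ((g' - g) + g' * (b₁ - b₀) / b₀) := by
    field_simp
    ring
  have h2 : |g'| ≤ g + 1 := by
    have := abs_le.1 (hg.trans he₁)
    rw [abs_le]; constructor <;> linarith
  have he₂ : 0 ≤ e₂ := (abs_nonneg _).trans hb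
  rw [h1, abs_mul, abs_of_nonneg (by positivity)]
  have h3 : |g' * (b₁ - b₀) / b₀| ≤ (g + 1) * e₂ / c := by
    rw [abs_div, abs_mul, abs_of_pos hb0]
    gcongr
  have h4 := (abs_add_le (g' - g) (g' * (b₁ - b₀) / b₀)).trans (add_le_add hg h3)
  gcongr

lemma smul_inv_zero_zero {A : Matrix (Fin (p + 1)) (Fin (p + 1)) ℝ} (hA : IsUnit A.det) {c : ℝ}
    (hc : c ≠ 0) : A⁻¹ 0 0 = (c⁻¹ • A)⁻¹ 0 0 / c := by
  have := Matrix.inv_smul' A (Units.mk0 c hc)⁻¹ hA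
  have h2 : ((Units.mk0 c hc)⁻¹ : ℝˣ) • A = c⁻¹ • A := by
    ext k l; simp [Units.smul_def]
  rw [h2] at this
  rw [this]
  simp [Units.smul_def]
  field_simp

/-- On the good event the rescaled hat values are bounded, and in the interior of the design region
they are close to their limits. -/
theorem exists_hat_close (hb : ContDiffOn ℝ 2 F.b F.Θ)
    (hb'' : ∃ d > 0, ∀ x ∈ Ω, d ≤ F.b'' (θ x)) (hK : IsAdmissibleKernel K) (hK0 : 0 < K 0)
    (hΩ : IsAdmissibleDesign Ω f) (hθ : ContinuousOn θ Ω) (hθΘ : ∀ x ∈ Ω, θ x ∈ F.Θ) {C : ℝ}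
    (hC : ∀ t, K t ≠ 0 → |t| ≤ C) (hC1 : 1 ≤ C) :
    ∃ T, 0 ≤ T ∧ ∀ ε > 0, ∃ e > 0, ∃ h₁ > 0, ∀ (n : ℕ) (h : ℝ), 0 < h → h ≤ h₁ →
      ∀ (X Y : Fin n → ℝ), (∀ j, X j ∈ Ω) → ∀ (i : Fin n) (β : Fin (p + 1) → ℝ),
      IsLocalMLE F K h X Y (X i) β → IsGood F K Ω f θ p h e X Y (X i) →
      n * h * hatMatrix F K h X (X i) β i i ≤ T ∧
      (Metric.closedBall (X i) (C * h) ⊆ Ω →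
        |n * h * hatMatrix F K h X (X i) β i i - equivalentKernel K p 0 / f (X i)| ≤ ε) := by
  obtain ⟨ρ, hρ, c, hc, M, hM, hρΘ, hρb, hunif⟩ := exists_radius hb hb'' hΩ.isCompact hθ hθΘ
  obtain ⟨l, hl, h₀, hh₀, hpop⟩ := exists_le_popMoment hK hK0 hΩ p
  obtain ⟨κ, hκ, hκb⟩ := hK.exists_bound
  obtain ⟨Mf, hMf, hMfb⟩ := hΩ.exists_bound
  obtain ⟨d, hd, hfd⟩ := hΩ.bounded_below
  obtain ⟨Lf, hLf⟩ := hΩ.lipschitz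
  obtain ⟨lS, hlS, hS⟩ := hK.exists_le_momentMatrix hK0 p
  set A : ℝ := C ^ 0 * κ * Mf * (2 * C) with hAdef
  have hA0 : 0 ≤ A := by positivity
  have hA : ∀ h, 0 < h → ∀ x, |popMoment K h Ω f x 0| ≤ A := fun h hh x =>
    abs_popMoment_le hK hΩ hC hC1 hκb hMfb hMf.le hh 0
  -- The bound `T` comes from `b'' ≤ M` and the quadratic lower bound `c l / 2` for `B`. It must
  -- precede `ε`, since it is also used at boundary points.
  refine ⟨K 0 * M * (1 / (c * (l / 2))), by positivity, fun ε hε => ?_⟩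
  set g := (momentMatrix K p)⁻¹ 0 0 with hgdef
  have hg : 0 < g := inv_zero_zero_pos hlS hS
  set e₁ : ℝ := min 1 (ε * d / (2 * K 0)) with he₁
  have he₁0 : 0 < e₁ := by positivity
  obtain ⟨w, hw, hinv⟩ := exists_inv_zero_zero_close (isUnit_det_of_quadratic hlS hS) he₁0
  -- The first entry makes the error in `b''(β₀)` cost at most `ε / 2`. The second makes the
  -- variation of the weights take a third of the tolerance `w d c` for the Gram matrix; `e` and
  -- `h₁` below provide the other two thirds.
  set e₃ : ℝ := min (ε * d * c / (2 * K 0 * (g + 1))) (w * (d * c) / (3 * (C ^ (2 * p) * (A + 1))))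
    with he₃
  have he₃0 : 0 < e₃ := by positivity
  obtain ⟨r, hr, hrρ, hrb⟩ := hunif e₃ he₃0
  -- The score, divided by `n h`, has to stay below `q` for localization at radius `r`; noise and
  -- bias each receive `q / 4`.
  set q : ℝ := c / 2 * (l / 2) * (r / ((p + 1) * C ^ p)) / (p + 1) with hq
  have hq0 : 0 < q := by positivity
  set o : ℝ := q / 4 / (C ^ p * (A + 1)) with ho
  have ho0 : 0 < o := by positivity
  set e : ℝ := min (min 1 (l / (2 * (p + 1) ^ 2))) (min (q / 4) (w * (d * c) / (3 * M))) with he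
  have he0 : 0 < e := by positivity
  have he1 : e ≤ 1 := (min_le_left _ _).trans (min_le_left _ _)
  have hel : (p + 1) ^ 2 * e ≤ l / 2 := by
    have : e ≤ l / (2 * (p + 1) ^ 2) := (min_le_left _ _).trans (min_le_right _ _)
    rw [le_div_iff₀ (by positivity)] at this
    linarith
  have heq : e ≤ q / 4 := (min_le_right _ _).trans (min_le_left _ _)
  have heM : M * e ≤ w * (d * c) / 3 := by
    have : e ≤ w * (d * c) / (3 * M) := (min_le_right _ _).trans (min_le_right _ _)
    rw [le_div_iff₀ (by positivity)] at this
    linarith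
  have her : (p + 1) * (e + o * C ^ p * (A + 1)) <
      c / 2 * (l / 2) * (r / ((p + 1) * C ^ p)) := by
    have h1 : o * C ^ p * (A + 1) = q / 4 := by rw [ho]; field_simp
    have h2 : c / 2 * (l / 2) * (r / ((p + 1) * C ^ p)) = (p + 1) * q := by
      rw [hq]; field_simp
    rw [h1, h2]
    have : (0 : ℝ) < p + 1 := by positivity
    refine mul_lt_mul_of_pos_left (by linarith) this
  have hcont : ContinuousOn (fun x => deriv F.b (θ x)) Ω :=
    ((ExpFamily.contDiffOn_deriv_b hb).continuousOn).comp hθ hθΘ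
  obtain ⟨η, hη, hηb⟩ := Metric.uniformContinuousOn_iff_le.1
    (hΩ.isCompact.uniformContinuousOn_of_continuous hcont) o ho0
  set L₁ : ℝ := C ^ (2 * p) * κ * Lf * C * (2 * C) with hL₁
  have hL₁0 : 0 ≤ L₁ := by positivity
  -- `L₁ + 1` replaces `L₁` because the latter vanishes if the Lipschitz constant of `f` is zero.
  set h₁ : ℝ := min h₀ (min (η / C) (w * (d * c) / (3 * (M * (L₁ + 1))))) with hh₁
  refine ⟨e, he0, h₁, by positivity, fun n h hh hhle X Y hX i β hβ hgood => ?_⟩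
  have hn : 0 < n := i.pos
  have hN : (0 : ℝ) < n * h := by positivity
  set x := X i with hx
  have hxΩ : x ∈ Ω := hX i
  have hhh₀ : h ≤ h₀ := hhle.trans (min_le_left _ _)
  have hhη : C * h ≤ η := by
    have : h ≤ η / C := hhle.trans ((min_le_right _ _).trans (min_le_left _ _))
    rw [le_div_iff₀ (by positivity)] at this
    linarith
  have hhL : M * (L₁ * h) ≤ w * (d * c) / 3 := by
    have : h ≤ w * (d * c) / (3 * (M * (L₁ + 1))) :=
      hhle.trans ((min_le_right _ _).trans (min_le_right _ _))
    rw [le_div_iff₀ (by positivity)] at this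
    nlinarith [mul_pos hM hh]
  have hnear : ∀ j, K ((X j - x) / h) ≠ 0 → |X j - x| ≤ C * h := fun j hj => by
    have := hC _ hj
    rwa [abs_div, abs_of_pos hh, div_le_iff₀ hh] at this
  have hest : ∀ u, |u - x| ≤ C * h → localPoly β x u ∈ Metric.closedBall (θ x) r := fun u hu =>
    IsGood.estimate_close hb hK.nonneg hC hC1 hh hn (hρΘ x hxΩ) (fun s hs => (hρb x hxΩ s hs).1)
      hc (hpop h hh hhh₀ x hxΩ) (hA h hh x) ho0.le
      (fun j hj => hηb (X j) (hX j) x hxΩ ((hnear j hj).trans hhη)) hgood he1 hel hr hrρ her hβ hu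
  have hestρ : ∀ u, |u - x| ≤ C * h → localPoly β x u ∈ Metric.closedBall (θ x) ρ := fun u hu =>
    Metric.closedBall_subset_closedBall hrρ (hest u hu)
  have hx0 : |x - x| ≤ C * h := by rw [sub_self, abs_zero]; positivity
  have hβ0 : β 0 ∈ Metric.closedBall (θ x) r := by
    have := hest x hx0
    rwa [localPoly_self] at this
  have hβ0ρ : β 0 ∈ Metric.closedBall (θ x) ρ := Metric.closedBall_subset_closedBall hrρ hβ0
  have hwt := weight_nonneg hb hK.nonneg hh hβ.1
  rw [mul_hatMatrix_diag hx.symm hh (hwt i)]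
  set B := gram p (fun j => K ((X j - x) / h) * F.b'' (localPoly β x (X j)) / (n * h))
        (fun j => (X j - x) / h) with hB
  have hBquad : ∀ v : Fin (p + 1) → ℝ, c * (l / 2) * ‖v‖ ^ 2 ≤ v ⬝ᵥ (B *ᵥ v) := by
    intro v
    rw [hB, dotProduct_gram_mulVec]
    have h1 := hgood.information_ge hh (hpop h hh hhh₀ x hxΩ) hel v
    have h2 : c / (n * h) * ∑ j, K ((X j - x) / h) * evalPoly v ((X j - x) / h) ^ 2 ≤
        ∑ j, K ((X j - x) / h) * F.b'' (localPoly β x (X j)) / (n * h) *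
          evalPoly v ((X j - x) / h) ^ 2 := by
      rw [Finset.mul_sum]
      refine Finset.sum_le_sum fun j _ => ?_
      by_cases h0 : K ((X j - x) / h) = 0
      · simp [h0]
      · have h3 := (hρb x hxΩ _ (hestρ (X j) (hnear j h0))).1
        have h4 : 0 ≤ K ((X j - x) / h) * evalPoly v ((X j - x) / h) ^ 2 / (n * h) :=
          div_nonneg (mul_nonneg (hK.nonneg _) (sq_nonneg _)) hN.le
        have h5 := mul_le_mul_of_nonneg_left h3 h4
        refine (le_of_eq ?_).trans (h5.trans (le_of_eq ?_)) <;> ring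
    refine le_trans ?_ h2
    have h6 := mul_le_mul_of_nonneg_left h1 (by positivity : 0 ≤ c / (n * h))
    refine (le_of_eq ?_).trans h6
    field_simp
  have hl2 : 0 < c * (l / 2) := by positivity
  have hBpos := inv_zero_zero_pos hl2 hBquad
  refine ⟨?_, fun hball => ?_⟩
  · have h1 := inv_zero_zero_le hl2 hBquad
    have h2 := (hρb x hxΩ _ hβ0ρ).2
    gcongr
  · set b₀ := F.b'' (θ x) with hb₀
    have hb₀b := hρb x hxΩ (θ x) (Metric.mem_closedBall_self hρ.le)
    have hfx := hfd x hxΩ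
    have hfx0 : 0 < f x := hd.trans_le hfx
    have hb₀0 : 0 < b₀ := hc.trans_le hb₀b.1
    have hclose : |((f x * b₀)⁻¹ • B)⁻¹ 0 0 - g| ≤ e₁ := by
      refine hinv _ fun k m => ?_
      have h1 := hgood.gram_close (k := k) (l := m) (b₀ := b₀) (M := M) (L := L₁ * h)
        (μ := momentMatrix K p k m) (o := e₃) hK.nonneg hC hC1 hh hn (hA h hh x) he1
        (b := fun j => F.b'' (localPoly β x (X j)))
        (fun j hj => hrb x hxΩ _ (hest (X j) (hnear j hj))) he₃0.le
        (by rw [abs_of_pos hb₀0]; exact hb₀b.2) (by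
          refine (abs_popMoment_sub_le hK hΩ hC hC1 hκb hLf hxΩ hh hball _).trans ?_
          have : C ^ ((k : ℕ) + (m : ℕ)) ≤ C ^ (2 * p) := pow_le_pow_right₀ hC1 (by omega)
          rw [hL₁]
          gcongr)
      have h2 : e₃ * C ^ (2 * p) * (A + 1) ≤ w * (d * c) / 3 := by
        have : e₃ ≤ w * (d * c) / (3 * (C ^ (2 * p) * (A + 1))) := min_le_right _ _
        rw [le_div_iff₀ (by positivity)] at this
        linarith
      have h3 : |B k m - f x * b₀ * momentMatrix K p k m| ≤ w * (d * c) := by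
        refine h1.trans ?_
        linarith
      have h4 : ((f x * b₀)⁻¹ • B) k m - momentMatrix K p k m =
          (B k m - f x * b₀ * momentMatrix K p k m) / (f x * b₀) := by
        rw [Matrix.smul_apply, smul_eq_mul]
        field_simp
      rw [h4, abs_div, abs_of_pos (by positivity : 0 < f x * b₀), div_le_iff₀ (by positivity)]
      refine h3.trans ?_
      have := hb₀b.1
      gcongr
    -- Dividing `B` by `f(x) b''(θ(x))` brings it close to the moment matrix; the factor `b''` then
    -- cancels against `b''(β₀)` up to a small error.
    rw [equivalentKernel_zero, ← hgdef,
      smul_inv_zero_zero (isUnit_det_of_quadratic hl2 hBquad) (by positivity : f x * b₀ ≠ 0)]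
    refine (abs_mul_div_sub_le hK0.le hd hfx hc hb₀b.1 (hrb x hxΩ _ hβ0) hclose hg.le
      (min_le_left _ _)).trans ?_
    have h1 : K 0 / d * e₁ ≤ ε / 2 := by
      have : e₁ ≤ ε * d / (2 * K 0) := min_le_right _ _
      calc K 0 / d * e₁ ≤ K 0 / d * (ε * d / (2 * K 0)) := by gcongr
        _ = ε / 2 := by field_simp
    have h2 : K 0 / d * ((g + 1) * e₃ / c) ≤ ε / 2 := by
      have : e₃ ≤ ε * d * c / (2 * K 0 * (g + 1)) := min_le_left _ _
      calc K 0 / d * ((g + 1) * e₃ / c)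
          ≤ K 0 / d * ((g + 1) * (ε * d * c / (2 * K 0 * (g + 1))) / c) := by gcongr
        _ = ε / 2 := by field_simp
    rw [mul_add]
    linarith

end HatLimit

/-! ### Probability that a sample is atypical near one of its points. -/

section BadEvent

open ProbabilityTheory

variable {F : ExpFamily} {K : ℝ → ℝ} {Ω : Set ℝ} {f θ : ℝ → ℝ} {p : ℕ}

lemma measurable_localMonomial (hK : Continuous K) (h : ℝ) (k : ℕ) :
    Measurable fun q : (ℝ × ℝ) × (ℝ × ℝ) =>
      ((q.2.1 - q.1.1) / h) ^ k * K ((q.2.1 - q.1.1) / h) := by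
  have := hK.measurable
  fun_prop

lemma integral_localMonomial (hK : IsAdmissibleKernel K) (hΩ : IsAdmissibleDesign Ω f)
    (hb : ContinuousOn F.b F.Θ) (hθ : ContinuousOn θ Ω) (hθΘ : ∀ x ∈ Ω, θ x ∈ F.Θ) {h : ℝ}
    (hh : 0 < h) (x : ℝ) (k : ℕ) :
    ∫ w, ((w.1 - x) / h) ^ k * K ((w.1 - x) / h) ∂(jointLaw F Ω f θ) =
      h * popMoment K h Ω f x k := by
  have hKm := hK.continuous.measurable
  rw [integral_jointLaw_fst (g := fun u => ((u - x) / h) ^ k * K ((u - x) / h)) hΩ.measurableSet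
    hΩ.continuousOn (fun x hx => hΩ.nonneg hx) hb hθ hθΘ (by fun_prop), popMoment,
    ← integral_const_mul]
  refine integral_congr_ae (Filter.Eventually.of_forall fun u => ?_)
  field_simp

lemma jointLaw_real_ball_le (hΩ : IsAdmissibleDesign Ω f)
    (hb : ContinuousOn F.b F.Θ) (hθ : ContinuousOn θ Ω) (hθΘ : ∀ x ∈ Ω, θ x ∈ F.Θ) {M r : ℝ}
    (hM : ∀ x ∈ Ω, f x ≤ M) (hM0 : 0 ≤ M) (hr : 0 ≤ r) (x : ℝ) :
    (jointLaw F Ω f θ).real (Prod.fst ⁻¹' Metric.closedBall x r) ≤ M * (2 * r) := by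
  refine ENNReal.toReal_le_of_le_ofReal (by positivity) ?_
  refine (jointLaw_fst_le hΩ.measurableSet hΩ.continuousOn (fun x hx => hΩ.nonneg hx) hb hθ hθΘ
    hM Metric.isClosed_closedBall.measurableSet).trans (le_of_eq ?_)
  rw [Real.volume_closedBall, ENNReal.ofReal_mul hM0]

variable {Ω₀ : Type*} [MeasurableSpace Ω₀] {P : Measure Ω₀} {X Y : ℕ → Ω₀ → ℝ}

lemma IsSample.isProbabilityMeasure_jointLaw [IsProbabilityMeasure P]
    (hXY : IsSample P F Ω f θ X Y) : IsProbabilityMeasure (jointLaw F Ω f θ) := by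
  have h1 := hXY.law 0
  rw [jointLaw, ← h1]
  exact Measure.isProbabilityMeasure_map
    ((hXY.measurable_X 0).prodMk (hXY.measurable_Y 0)).aemeasurable

lemma IsSample.measure_moment_le [IsProbabilityMeasure P] (hXY : IsSample P F Ω f θ X Y)
    (hK : IsAdmissibleKernel K) (hΩ : IsAdmissibleDesign Ω f)
    (hb : ContinuousOn F.b F.Θ) (hθ : ContinuousOn θ Ω) (hθΘ : ∀ x ∈ Ω, θ x ∈ F.Θ)
    {C κ M s h : ℝ} (hC : ∀ t, K t ≠ 0 → |t| ≤ C) (hC1 : 1 ≤ C) {k : ℕ}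
    (hκ : ∀ t, |t ^ k * K t| ≤ κ) (hM : ∀ x ∈ Ω, f x ≤ M) (hM0 : 0 ≤ M) (hs0 : 0 ≤ s)
    (hs : s * κ ≤ 1) (hh : 0 < h) {n : ℕ} (i : Fin n) (A : ℝ) :
    P {ω | A ≤ |∑ j : Fin n, ((X j ω - X i ω) / h) ^ k * K ((X j ω - X i ω) / h) -
        n * h * popMoment K h Ω f (X i ω) k|} ≤
      ENNReal.ofReal (2 * Real.exp 2 *
        Real.exp (n * (s ^ 2 * κ ^ 2 * (M * (2 * (C * h)))) - s * A)) := by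
  have := hXY.isProbabilityMeasure_jointLaw
  have h1 := measure_le_abs_sum_sub_le (P := P) (μ := jointLaw F Ω f θ)
    (Z := fun (j : Fin n) ω => (X j ω, Y j ω))
    (fun j => (hXY.measurable_X j).prodMk (hXY.measurable_Y j))
    (hXY.indep.precomp Fin.val_injective) (fun j => hXY.law j)
    (ξ := fun z w => ((w.1 - z.1) / h) ^ k * K ((w.1 - z.1) / h))
    (measurable_localMonomial hK.continuous h k) (fun z w => hκ _)
    (S := fun z => Prod.fst ⁻¹' Metric.closedBall z.1 (C * h))
    (fun z => measurable_fst Metric.isClosed_closedBall.measurableSet)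
    (fun z w hw => by rw [kernel_eq_zero_of_notMem hC hh hw, mul_zero])
    (fun z => jointLaw_real_ball_le hΩ hb hθ hθΘ hM hM0 (by positivity) z.1) hs0 hs i A
  simp only [Fintype.card_fin] at h1
  refine le_trans (le_of_eq ?_) h1
  congr 1
  ext ω
  simp only [Set.mem_ofPred_eq]
  rw [Finset.sum_sub_distrib, integral_localMonomial hK hΩ hb hθ hθΘ hh]
  simp [mul_assoc]

lemma IsSample.measure_score_le [IsProbabilityMeasure P] (hXY : IsSample P F Ω f θ X Y)
    (hK : IsAdmissibleKernel K) (hΩ : IsAdmissibleDesign Ω f)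
    (hb : ContDiffOn ℝ 2 F.b F.Θ) (hθ : ContinuousOn θ Ω) (hθΘ : ∀ x ∈ Ω, θ x ∈ F.Θ)
    {C κ M s h ρ V : ℝ} (hC : ∀ t, K t ≠ 0 → |t| ≤ C) (hC1 : 1 ≤ C) {k : ℕ}
    (hκ : ∀ t, |t ^ k * K t| ≤ κ) (hM : ∀ x ∈ Ω, f x ≤ M) (hM0 : 0 ≤ M)
    (hρ : ∀ x ∈ Ω, Metric.closedBall (θ x) ρ ⊆ F.Θ)
    (hV : ∀ x ∈ Ω, ∀ t ∈ Metric.closedBall (θ x) ρ, F.b'' t ≤ V) (hV0 : 0 ≤ V)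
    (hs0 : 0 ≤ s) (hs : F.a F.ψ * (s * κ) ≤ ρ) (hs1 : F.a F.ψ * V / 2 * (s * κ) ^ 2 ≤ 1)
    (hh : 0 < h) {n : ℕ} (i : Fin n) (A : ℝ) :
    P {ω | (∀ j : Fin n, X j ω ∈ Ω) ∧ A ≤ |∑ j : Fin n, (Y j ω - deriv F.b (θ (X j ω))) *
        (((X j ω - X i ω) / h) ^ k * K ((X j ω - X i ω) / h))|} ≤
      ENNReal.ofReal (2 * Real.exp 2 *
        Real.exp (n * (F.a F.ψ * V * (s * κ) ^ 2 * (M * (2 * (C * h)))) - s * A)) := by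
  have := hXY.isProbabilityMeasure_jointLaw
  have ha := F.a_pos
  have hΩm := hΩ.measurableSet
  -- A measurable substitute for `b' ∘ θ`, whose behaviour off `Ω` is unknown. The two agree on the
  -- event that all design points are in `Ω`.
  set m : ℝ → ℝ := Ω.indicator fun x => deriv F.b (θ x) with hm
  have hcont : ContinuousOn (fun x => deriv F.b (θ x)) Ω :=
    ((ExpFamily.contDiffOn_deriv_b hb).continuousOn).comp hθ hθΘ
  have hmm : Measurable m := by
    classical
    rw [hm, ← Set.piecewise_eq_indicator]
    exact hcont.measurable_piecewise continuousOn_const hΩm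
  have hmΩ : ∀ x ∈ Ω, m x = deriv F.b (θ x) := fun x hx => Set.indicator_of_mem hx _
  have hKm := hK.continuous.measurable
  have key : ∀ s' : ℝ, |s'| = s →
      P {ω | s * A ≤ ∑ j : Fin n, s' * ((Y j ω - m (X j ω)) *
        (((X j ω - X i ω) / h) ^ k * K ((X j ω - X i ω) / h)))} ≤
      ENNReal.ofReal (Real.exp 2 *
        Real.exp (n * (F.a F.ψ * V * (s * κ) ^ 2 * (M * (2 * (C * h)))) - s * A)) := by
    intro s' hs'
    have hsq : (s' * κ) ^ 2 = (s * κ) ^ 2 := by rw [mul_pow, mul_pow, ← hs', sq_abs]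
    have h1 := measure_le_sum_le (P := P) (μ := jointLaw F Ω f θ)
      (Z := fun (j : Fin n) ω => (X j ω, Y j ω))
      (fun j => (hXY.measurable_X j).prodMk (hXY.measurable_Y j))
      (hXY.indep.precomp Fin.val_injective) (fun j => hXY.law j)
      (φ := fun z w => s' * ((w.2 - m w.1) * (((w.1 - z.1) / h) ^ k * K ((w.1 - z.1) / h))))
      (by
        have h2 := measurable_localMonomial hK.continuous h k
        exact measurable_const.mul (((measurable_snd.comp measurable_snd).sub
          (hmm.comp (measurable_fst.comp measurable_snd))).mul h2))
      (B := F.a F.ψ * V * (s * κ) ^ 2 * (M * (2 * (C * h)))) (D := Real.exp 2) (by positivity)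
      (Filter.Eventually.of_forall fun z => by
        refine (lintegral_exp_score_le hΩm hΩ.continuousOn (fun x hx => hΩ.nonneg hx) hb hθ hθΘ
          hρ hV hV0 hmm hmΩ (κ := fun u => ((u - z.1) / h) ^ k * K ((u - z.1) / h))
          (by fun_prop) (k₀ := κ) (s := s') (fun u => hκ _)
          (S := Metric.closedBall z.1 (C * h)) Metric.isClosed_closedBall.measurableSet
          (fun u hu => by rw [kernel_eq_zero_of_notMem hC hh hu, mul_zero]) (by rwa [hs'])
          (by rwa [hsq])).trans ?_
        rw [hsq]
        refine ENNReal.ofReal_le_ofReal (Real.exp_le_exp.2 ?_)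
        exact mul_le_mul_of_nonneg_left
          (jointLaw_real_ball_le hΩ hb.continuousOn hθ hθΘ hM hM0 (by positivity) z.1)
          (by positivity))
      (by
        -- The diagonal term has the constant weight `0 ^ k * K 0`, so the bound is applied with `S`
        -- the whole line; by `hs1` its exponent is at most `2`.
        have h3 := lintegral_exp_score_le hΩm hΩ.continuousOn (fun x hx => hΩ.nonneg hx) hb hθ hθΘ
          hρ hV hV0 hmm hmΩ (κ := fun _ => (0 : ℝ) ^ k * K 0)
          measurable_const (k₀ := κ) (s := s') (fun u => hκ 0)
          (S := Set.univ) MeasurableSet.univ (fun u hu => absurd (Set.mem_univ u) hu)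
          (by rwa [hs']) (by rwa [hsq])
        simp only [sub_self, zero_div]
        refine h3.trans (ENNReal.ofReal_le_ofReal (Real.exp_le_exp.2 ?_))
        rw [Set.preimage_univ, probReal_univ, hsq]
        linarith) i (s * A)
    simpa only [Fintype.card_fin] using h1
  have hsub : {ω | (∀ j : Fin n, X j ω ∈ Ω) ∧ A ≤ |∑ j : Fin n,
        (Y j ω - deriv F.b (θ (X j ω))) *
        (((X j ω - X i ω) / h) ^ k * K ((X j ω - X i ω) / h))|} ⊆
      {ω | s * A ≤ ∑ j : Fin n, s * ((Y j ω - m (X j ω)) *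
        (((X j ω - X i ω) / h) ^ k * K ((X j ω - X i ω) / h)))} ∪
      {ω | s * A ≤ ∑ j : Fin n, (-s) * ((Y j ω - m (X j ω)) *
        (((X j ω - X i ω) / h) ^ k * K ((X j ω - X i ω) / h)))} := by
    rintro ω ⟨hωΩ, hω⟩
    have h4 : ∀ j : Fin n, deriv F.b (θ (X j ω)) = m (X j ω) := fun j => (hmΩ _ (hωΩ j)).symm
    simp only [h4] at hω
    rcases le_abs.1 hω with h | h
    · left
      rw [Set.mem_ofPred_eq, ← Finset.mul_sum]
      exact mul_le_mul_of_nonneg_left h hs0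
    · right
      rw [Set.mem_ofPred_eq, ← Finset.mul_sum, neg_mul, ← mul_neg]
      exact mul_le_mul_of_nonneg_left h hs0
  refine (measure_mono hsub).trans ((measure_union_le _ _).trans ?_)
  refine (add_le_add (key s (abs_of_nonneg hs0))
    (key (-s) (by rw [abs_neg, abs_of_nonneg hs0]))).trans ?_
  rw [← ENNReal.ofReal_add (by positivity) (by positivity)]
  exact ENNReal.ofReal_le_ofReal (le_of_eq (by ring))

/-- The good event fails with exponentially small probability in the local sample size. -/
theorem IsSample.exists_measure_not_isGood_le [IsProbabilityMeasure P]
    (hXY : IsSample P F Ω f θ X Y) (hb : ContDiffOn ℝ 2 F.b F.Θ)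
    (hb'' : ∃ d > 0, ∀ x ∈ Ω, d ≤ F.b'' (θ x)) (hK : IsAdmissibleKernel K)
    (hΩ : IsAdmissibleDesign Ω f) (hθ : ContinuousOn θ Ω) (hθΘ : ∀ x ∈ Ω, θ x ∈ F.Θ) (p : ℕ)
    {e : ℝ} (he : 0 < e) :
    ∃ D, 0 ≤ D ∧ ∃ c > 0, ∀ (n : ℕ) (h : ℝ), 0 < h → ∀ i : Fin n,
      P {ω | (∀ j : Fin n, X j ω ∈ Ω) ∧ ¬ IsGood F K Ω f θ p h e
        (fun j : Fin n => X j ω) (fun j : Fin n => Y j ω) (X i ω)} ≤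
      ENNReal.ofReal (D * Real.exp (-(c * (n * h)))) := by
  obtain ⟨C, hC1, hC⟩ := hK.exists_support
  obtain ⟨κ₀, hκ₀, hκ₀b⟩ := hK.exists_bound
  obtain ⟨M, hM, hMb⟩ := hΩ.exists_bound
  obtain ⟨ρ, hρ, _, -, V, hV, hρΘ, hρb, -⟩ := exists_radius hb hb'' hΩ.isCompact hθ hθΘ
  have ha := F.a_pos
  set κ := C ^ (2 * p) * κ₀ with hκ
  have hκpos : 0 < κ := by positivity
  have hκb : ∀ k ≤ 2 * p, ∀ t, |t ^ k * K t| ≤ κ := fun k hk t =>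
    (abs_pow_mul_kernel_le hK hC hC1 hκ₀b k t).trans (by
      have : C ^ k ≤ C ^ (2 * p) := pow_le_pow_right₀ hC1 hk
      rw [hκ]
      gcongr)
  set W := max 1 (F.a F.ψ * V) with hW
  have hW1 : 1 ≤ W := le_max_left _ _
  -- The four constraints serve, in order, the Bernstein bound for the moments, the range of the
  -- response's moment generating function, the smallness of its exponent, and the domination of the
  -- quadratic term in the Chernoff exponent by half of `s e n h`.
  set s := min (min (1 / κ) (ρ / (F.a F.ψ * κ)))
    (min (1 / (W * κ)) (e / (2 * (W * κ ^ 2 * (M * (2 * C)))))) with hs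
  have hs0 : 0 < s := by positivity
  have hs1 : s * κ ≤ 1 := by
    have : s ≤ 1 / κ := (min_le_left _ _).trans (min_le_left _ _)
    rwa [le_div_iff₀ hκpos] at this
  have hs2 : F.a F.ψ * (s * κ) ≤ ρ := by
    have : s ≤ ρ / (F.a F.ψ * κ) := (min_le_left _ _).trans (min_le_right _ _)
    rw [le_div_iff₀ (by positivity)] at this
    linarith
  have hs3 : W * (s * κ) ≤ 1 := by
    have : s ≤ 1 / (W * κ) := (min_le_right _ _).trans (min_le_left _ _)
    rw [le_div_iff₀ (by positivity)] at this
    linarith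
  have hs4 : s * (W * κ ^ 2 * (M * (2 * C))) ≤ e / 2 := by
    have : s ≤ e / (2 * (W * κ ^ 2 * (M * (2 * C)))) := (min_le_right _ _).trans (min_le_right _ _)
    rw [le_div_iff₀ (by positivity)] at this
    linarith
  have hsV : F.a F.ψ * V / 2 * (s * κ) ^ 2 ≤ 1 := by
    have h1 : F.a F.ψ * V ≤ W := le_max_right _ _
    have h2 : 0 ≤ s * κ := by positivity
    calc F.a F.ψ * V / 2 * (s * κ) ^ 2 ≤ W * (s * κ) ^ 2 := by
          refine mul_le_mul_of_nonneg_right ?_ (sq_nonneg _)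
          have : 0 < F.a F.ψ * V := by positivity
          linarith
      _ = W * (s * κ) * (s * κ) := by ring
      _ ≤ 1 * 1 := by gcongr
      _ = 1 := one_mul 1
  set b : ℕ → ℝ → ENNReal := fun n h =>
    ENNReal.ofReal (2 * Real.exp 2 * Real.exp (-(s * e / 2 * (n * h)))) with hbdef
  have hexp : ∀ (n : ℕ) (h U : ℝ), 0 < h → U ≤ W → n * (U * (s * κ) ^ 2 * (M * (2 * (C * h)))) -
      s * (e * (n * h)) ≤ -(s * e / 2 * (n * h)) := by
    intro n h U hh hU
    have h1 : U * (s * κ) ^ 2 * (M * (2 * (C * h))) ≤ W * (s * κ) ^ 2 * (M * (2 * (C * h))) := by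
      gcongr
    have h2 := mul_le_mul_of_nonneg_left h1 (Nat.cast_nonneg (α := ℝ) n)
    have h3 := mul_le_mul_of_nonneg_left hs4 (by positivity : 0 ≤ s * (n * h))
    nlinarith
  have hmom : ∀ (n : ℕ) (h : ℝ), 0 < h → ∀ i : Fin n, ∀ k ∈ Finset.range (2 * p + 1),
      P {ω | e * (n * h) ≤ |∑ j : Fin n, ((X j ω - X i ω) / h) ^ k * K ((X j ω - X i ω) / h) -
        n * h * popMoment K h Ω f (X i ω) k|} ≤ b n h := by
    intro n h hh i k hk
    refine (hXY.measure_moment_le hK hΩ hb.continuousOn hθ hθΘ hC hC1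
      (hκb k (Nat.lt_succ_iff.1 (Finset.mem_range.1 hk))) hMb hM.le hs0.le hs1 hh i _).trans ?_
    refine ENNReal.ofReal_le_ofReal (mul_le_mul_of_nonneg_left (Real.exp_le_exp.2 ?_)
      (by positivity))
    have := hexp n h 1 hh hW1
    rwa [one_mul, mul_pow] at this
  have hsco : ∀ (n : ℕ) (h : ℝ), 0 < h → ∀ i : Fin n, ∀ k ∈ Finset.range (p + 1),
      P {ω | (∀ j : Fin n, X j ω ∈ Ω) ∧ e * (n * h) ≤
        |∑ j : Fin n, (Y j ω - deriv F.b (θ (X j ω))) *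
        (((X j ω - X i ω) / h) ^ k * K ((X j ω - X i ω) / h))|} ≤ b n h := by
    intro n h hh i k hk
    have hk' := Nat.lt_succ_iff.1 (Finset.mem_range.1 hk)
    refine (hXY.measure_score_le hK hΩ hb hθ hθΘ hC hC1 (hκb k (by omega)) hMb hM.le hρΘ
      (fun x hx t ht => (hρb x hx t ht).2) hV.le hs0.le hs2 hsV hh i _).trans ?_
    exact ENNReal.ofReal_le_ofReal (mul_le_mul_of_nonneg_left
      (Real.exp_le_exp.2 (hexp n h _ hh (le_max_right _ _))) (by positivity))
  refine ⟨((2 * p + 1 : ℕ) + (p + 1 : ℕ) : ℝ) * (2 * Real.exp 2), by positivity, s * e / 2,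
    by positivity, fun n h hh i => ?_⟩
  have hsub : {ω | (∀ j : Fin n, X j ω ∈ Ω) ∧ ¬ IsGood F K Ω f θ p h e
        (fun j : Fin n => X j ω) (fun j : Fin n => Y j ω) (X i ω)} ⊆
      (⋃ k ∈ Finset.range (2 * p + 1), {ω | e * (n * h) ≤
        |∑ j : Fin n, ((X j ω - X i ω) / h) ^ k * K ((X j ω - X i ω) / h) -
        n * h * popMoment K h Ω f (X i ω) k|}) ∪
      ⋃ k ∈ Finset.range (p + 1), {ω | (∀ j : Fin n, X j ω ∈ Ω) ∧ e * (n * h) ≤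
        |∑ j : Fin n, (Y j ω - deriv F.b (θ (X j ω))) *
        (((X j ω - X i ω) / h) ^ k * K ((X j ω - X i ω) / h))|} := by
    rintro ω ⟨hωΩ, hω⟩
    rw [IsGood, not_and_or] at hω
    push Not at hω
    rcases hω with ⟨k, hk, hlt⟩ | ⟨k, hk, hlt⟩
    · left
      exact Set.mem_iUnion₂.2 ⟨k, Finset.mem_range.2 (by omega), hlt.le⟩
    · right
      exact Set.mem_iUnion₂.2 ⟨k, Finset.mem_range.2 (by omega), hωΩ, hlt.le⟩
  refine (measure_mono hsub).trans ((measure_union_le _ _).trans ?_)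
  refine (add_le_add ((measure_biUnion_finset_le _ _).trans
    (Finset.sum_le_card_nsmul _ _ _ (hmom n h hh i)))
    ((measure_biUnion_finset_le _ _).trans
    (Finset.sum_le_card_nsmul _ _ _ (hsco n h hh i)))).trans (le_of_eq ?_)
  rw [Finset.card_range, Finset.card_range, ← add_nsmul, nsmul_eq_mul, hbdef,
    mul_assoc _ (2 * Real.exp 2), ← Nat.cast_add,
    ENNReal.ofReal_mul (p := ((2 * p + 1 + (p + 1) : ℕ) : ℝ)) (by positivity),
    ENNReal.ofReal_natCast]

end BadEvent

/-! ### Averaging over the observations. -/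

section Assembly

open ProbabilityTheory

variable {F : ExpFamily} {K : ℝ → ℝ} {Ω : Set ℝ} {f θ : ℝ → ℝ} {p : ℕ}
  {Ω₀ : Type*} [MeasurableSpace Ω₀] {P : Measure Ω₀} {X Y : ℕ → Ω₀ → ℝ}

lemma IsSample.map_X (hXY : IsSample P F Ω f θ X Y) (hΩ : IsAdmissibleDesign Ω f)
    (hb : ContinuousOn F.b F.Θ) (hθ : ContinuousOn θ Ω) (hθΘ : ∀ x ∈ Ω, θ x ∈ F.Θ) (j : ℕ) :
    P.map (X j) = (volume.restrict Ω).withDensity fun x => ENNReal.ofReal (f x) := by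
  rw [← map_fst_jointLaw (F := F) hΩ.measurableSet hΩ.continuousOn (fun x hx => hΩ.nonneg hx) hb
    hθ hθΘ, jointLaw, ← hXY.law j, Measure.map_map measurable_fst
    ((hXY.measurable_X j).prodMk (hXY.measurable_Y j))]
  rfl

lemma IsSample.ae_mem (hXY : IsSample P F Ω f θ X Y) (hΩ : IsAdmissibleDesign Ω f)
    (hb : ContinuousOn F.b F.Θ) (hθ : ContinuousOn θ Ω) (hθΘ : ∀ x ∈ Ω, θ x ∈ F.Θ) :
    ∀ᵐ ω ∂P, ∀ j, X j ω ∈ Ω := by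
  refine ae_all_iff.2 fun j => ?_
  have h1 : ∀ᵐ x ∂(P.map (X j)), x ∈ Ω := by
    rw [hXY.map_X hΩ hb hθ hθΘ j]
    exact (withDensity_absolutelyContinuous _ _).ae_le (ae_restrict_mem hΩ.measurableSet)
  exact ae_of_ae_map (hXY.measurable_X j).aemeasurable h1

lemma IsSample.measure_X_mem_le (hXY : IsSample P F Ω f θ X Y) (hΩ : IsAdmissibleDesign Ω f)
    (hb : ContinuousOn F.b F.Θ) (hθ : ContinuousOn θ Ω) (hθΘ : ∀ x ∈ Ω, θ x ∈ F.Θ) {M : ℝ}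
    (hM : ∀ x ∈ Ω, f x ≤ M) {S : Set ℝ} (hS : MeasurableSet S) (j : ℕ) :
    P (X j ⁻¹' S) ≤ ENNReal.ofReal M * volume S := by
  rw [← Measure.map_apply (hXY.measurable_X j) hS, hXY.map_X hΩ hb hθ hθΘ j,
    ← map_fst_jointLaw (F := F) hΩ.measurableSet hΩ.continuousOn (fun x hx => hΩ.nonneg hx) hb
    hθ hθΘ, Measure.map_apply measurable_fst hS]
  exact jointLaw_fst_le hΩ.measurableSet hΩ.continuousOn (fun x hx => hΩ.nonneg hx) hb hθ hθΘ hM hS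

/-- An admissible design may be the empty union of intervals; it is excluded because the design
points have a probability law on `Ω`. -/
lemma IsSample.volume_pos [IsProbabilityMeasure P] (hXY : IsSample P F Ω f θ X Y)
    (hΩ : IsAdmissibleDesign Ω f) (hb : ContinuousOn F.b F.Θ) (hθ : ContinuousOn θ Ω)
    (hθΘ : ∀ x ∈ Ω, θ x ∈ F.Θ) : 0 < volume.real Ω := by
  rw [measureReal_def, ENNReal.toReal_pos_iff]
  refine ⟨pos_iff_ne_zero.2 fun h0 => ?_, hΩ.isCompact.measure_lt_top⟩
  have h1 := hXY.map_X hΩ hb hθ hθΘ 0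
  have h2 : IsProbabilityMeasure (P.map (X 0)) :=
    Measure.isProbabilityMeasure_map (hXY.measurable_X 0).aemeasurable
  rw [Measure.restrict_eq_zero.2 h0, withDensity_zero_left] at h1
  exact h2.ne_zero _ h1

/-- The law of large numbers for the reciprocal design density. -/
lemma IsSample.tendstoInMeasure_average [IsProbabilityMeasure P] (hXY : IsSample P F Ω f θ X Y)
    (hΩ : IsAdmissibleDesign Ω f) (hb : ContinuousOn F.b F.Θ) (hθ : ContinuousOn θ Ω)
    (hθΘ : ∀ x ∈ Ω, θ x ∈ F.Θ) (κ : ℝ) :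
    TendstoInMeasure P (fun (n : ℕ) ω => (∑ i : Fin n, Ω.indicator (fun x => κ / f x) (X i ω)) / n)
      atTop (fun _ => κ * volume.real Ω) := by
  obtain ⟨d, hd, hfd⟩ := hΩ.bounded_below
  set ψ : ℝ → ℝ := Ω.indicator fun x => κ / f x with hψ
  have hψm : Measurable ψ := by
    classical
    rw [hψ, ← Set.piecewise_eq_indicator]
    exact (continuousOn_const.div hΩ.continuousOn fun x hx =>
      (hd.trans_le (hfd x hx)).ne').measurable_piecewise continuousOn_const hΩ.measurableSet
  have hψb : ∀ x, |ψ x| ≤ |κ| / d := by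
    intro x
    by_cases hx : x ∈ Ω
    · rw [hψ, Set.indicator_of_mem hx, abs_div, abs_of_pos (hd.trans_le (hfd x hx))]
      have := hfd x hx
      gcongr
    · rw [hψ, Set.indicator_of_notMem hx, abs_zero]
      positivity
  have hpm : ∀ j, Measurable fun ω => (X j ω, Y j ω) := fun j =>
    (hXY.measurable_X j).prodMk (hXY.measurable_Y j)
  have hint : ∫ ω, ψ (X 0 ω) ∂P = κ * volume.real Ω := by
    have h1 : ∫ ω, ψ (X 0 ω) ∂P = ∫ z, ψ z.1 ∂(jointLaw F Ω f θ) := by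
      rw [jointLaw, ← hXY.law 0, integral_map (f := fun z => ψ z.1) (hpm 0).aemeasurable
        (hψm.comp measurable_fst).aestronglyMeasurable]
    rw [h1, integral_jointLaw_fst hΩ.measurableSet hΩ.continuousOn (fun x hx => hΩ.nonneg hx) hb
      hθ hθΘ hψm]
    have h2 : ∫ x in Ω, f x * ψ x = ∫ _x in Ω, κ := by
      refine setIntegral_congr_fun hΩ.measurableSet fun x hx => ?_
      have := (hd.trans_le (hfd x hx)).ne'
      simp only [hψ, Set.indicator_of_mem hx]
      field_simp
    rw [h2, setIntegral_const, smul_eq_mul, mul_comm]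
  have hslln := strong_law_ae_real (μ := P) (fun j ω => ψ (X j ω))
    (Integrable.of_bound (hψm.comp (hXY.measurable_X 0)).aestronglyMeasurable (|κ| / d)
      (Filter.Eventually.of_forall fun ω => hψb _))
    (fun i j hij => (hXY.indep.indepFun hij).comp (φ := fun z : ℝ × ℝ => ψ z.1)
      (ψ := fun z : ℝ × ℝ => ψ z.1) (hψm.comp measurable_fst) (hψm.comp measurable_fst))
    (fun j => (IdentDistrib.mk (hpm j).aemeasurable (hpm 0).aemeasurable
      ((hXY.law j).trans (hXY.law 0).symm)).comp (u := fun z : ℝ × ℝ => ψ z.1)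
      (hψm.comp measurable_fst))
  rw [hint] at hslln
  refine tendstoInMeasure_of_tendsto_ae (fun n => ?_) ?_
  · exact ((Finset.measurable_sum _ fun (i : Fin n) _ =>
      hψm.comp (hXY.measurable_X i)).div_const _).aestronglyMeasurable
  · filter_upwards [hslln] with ω hω
    refine hω.congr fun n => ?_
    rw [Finset.sum_range]

/-- Markov's inequality for the average of a bounded indicator and a large rare one. -/
lemma measure_average_indicators_ge_le {n : ℕ} (hn : 0 < n) {D B : Fin n → Set Ω₀}
    (hD : ∀ i, MeasurableSet (D i)) (hB : ∀ i, MeasurableSet (B i)) {a b u v ε : ℝ} (ha : 0 ≤ a)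
    (hb : 0 ≤ b) (hu : 0 ≤ u) (hv : 0 ≤ v) (hDu : ∀ i, P (D i) ≤ ENNReal.ofReal u)
    (hBv : ∀ i, P (B i) ≤ ENNReal.ofReal v) (hε : 0 < ε) :
    P {ω | ε ≤ (∑ i, ((D i).indicator (fun _ => a) ω + (B i).indicator (fun _ => b) ω)) / n} ≤
      ENNReal.ofReal ((a * u + b * v) / ε) := by
  have hn' : (0 : ℝ) < n := by exact_mod_cast hn
  set G : Ω₀ → ENNReal := fun ω => ∑ i, ((D i).indicator (fun _ => ENNReal.ofReal a) ω +
    (B i).indicator (fun _ => ENNReal.ofReal b) ω) with hG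
  have hGm : Measurable G := Finset.measurable_sum _ fun i _ =>
    (measurable_const.indicator (hD i)).add (measurable_const.indicator (hB i))
  have hGe : ∀ ω, ENNReal.ofReal (∑ i, ((D i).indicator (fun _ => a) ω +
      (B i).indicator (fun _ => b) ω)) = G ω := by
    intro ω
    rw [ENNReal.ofReal_sum_of_nonneg fun i _ => add_nonneg
      (Set.indicator_nonneg (fun _ _ => ha) _) (Set.indicator_nonneg (fun _ _ => hb) _)]
    refine Finset.sum_congr rfl fun i _ => ?_
    rw [ENNReal.ofReal_add (Set.indicator_nonneg (fun _ _ => ha) _)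
      (Set.indicator_nonneg (fun _ _ => hb) _)]
    congr 1
    · by_cases h : ω ∈ D i <;> simp [h]
    · by_cases h : ω ∈ B i <;> simp [h]
  have hGi : ∫⁻ ω, G ω ∂P ≤ ENNReal.ofReal (n * (a * u + b * v)) := by
    have hm : ∀ i, Measurable fun ω => (D i).indicator (fun _ => ENNReal.ofReal a) ω +
        (B i).indicator (fun _ => ENNReal.ofReal b) ω := fun i =>
      (measurable_const.indicator (hD i)).add (measurable_const.indicator (hB i))
    rw [hG, lintegral_finsetSum _ fun i _ => hm i]
    calc _ ≤ ∑ _i : Fin n, ENNReal.ofReal (a * u + b * v) := by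
          refine Finset.sum_le_sum fun i _ => ?_
          rw [lintegral_add_left (measurable_const.indicator (hD i)),
            lintegral_indicator_const (hD i), lintegral_indicator_const (hB i),
            ENNReal.ofReal_add (by positivity) (by positivity), ENNReal.ofReal_mul ha,
            ENNReal.ofReal_mul hb]
          gcongr
          · exact hDu i
          · exact hBv i
      _ = _ := by
          rw [Finset.sum_const, Finset.card_univ, Fintype.card_fin, nsmul_eq_mul,
            ENNReal.ofReal_mul (p := (n : ℝ)) hn'.le, ENNReal.ofReal_natCast]
  have h1 := meas_ge_le_lintegral_div (μ := P) hGm.aemeasurable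
    (ε := ENNReal.ofReal (n * ε)) (by simp only [ne_eq, ENNReal.ofReal_eq_zero, not_le]; positivity)
    ENNReal.ofReal_ne_top
  refine (measure_mono fun ω hω => ?_).trans (h1.trans ?_)
  · rw [Set.mem_ofPred_eq, le_div_iff₀ hn'] at hω
    rw [Set.mem_ofPred_eq, ← hGe]
    exact ENNReal.ofReal_le_ofReal (by linarith)
  · refine (ENNReal.div_le_div_right hGi _).trans ?_
    rw [← ENNReal.ofReal_div_of_pos (by positivity)]
    exact ENNReal.ofReal_le_ofReal (le_of_eq (by field_simp))

lemma degreesOfFreedom_eq_zero (hK0 : K 0 = 0) {n : ℕ} (h : ℝ) (X : Fin n → ℝ)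
    (β : Fin n → Fin (p + 1) → ℝ) : degreesOfFreedom F K h X β = 0 := by
  refine Finset.sum_eq_zero fun i _ => ?_
  have hw : weight F K h X (X i) (β i) i = 0 := by simp [weight, scaledKernel, hK0]
  rw [hatMatrix_diag rfl hw.ge, hw, zero_mul]

/-- The boundary term is `O(h)`, and the trivial bound `n h` on the bad event is beaten by `exp(-c n
h)`. Hence `n h → ∞` suffices, without a logarithmic factor. -/
lemma tendsto_boundary_add_bad {h : ℕ → ℝ} (hzero : Tendsto h atTop (𝓝 0))
    (hinf : Tendsto (fun n : ℕ => (n : ℝ) * h n) atTop atTop) (a b D c ε : ℝ) (hc : 0 < c) :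
    Tendsto (fun n : ℕ => ENNReal.ofReal ((a * h n +
      (n * h n + b) * (D * Real.exp (-(c * (n * h n))))) / ε)) atTop (𝓝 0) := by
  have h1 : Tendsto (fun n : ℕ => c * ((n : ℝ) * h n)) atTop atTop := hinf.const_mul_atTop hc
  have h2 := (Real.tendsto_pow_mul_exp_neg_atTop_nhds_zero 1).comp h1
  have h3 := (Real.tendsto_pow_mul_exp_neg_atTop_nhds_zero 0).comp h1
  have h4 := (((hzero.const_mul a).add ((h2.const_mul (D / c)).add
    (h3.const_mul (b * D)))).div_const ε)
  rw [← ENNReal.ofReal_zero]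
  refine ENNReal.tendsto_ofReal ?_
  refine (h4.congr fun n => ?_).trans_eq (by simp)
  simp only [Function.comp_apply, pow_one, pow_zero]
  field_simp

/-- The degrees of freedom, multiplied by the bandwidth, converge in probability. -/
theorem tendstoInMeasure_mul_degreesOfFreedom [IsProbabilityMeasure P] {h : ℕ → ℝ}
    {βhat : (n : ℕ) → Ω₀ → Fin n → Fin (p + 1) → ℝ} (hb : ContDiffOn ℝ 2 F.b F.Θ)
    (hb'' : ∃ δ > 0, ∀ x ∈ Ω, δ ≤ F.b'' (θ x)) (hK : IsAdmissibleKernel K) (hK0 : 0 < K 0)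
    (hΩ : IsAdmissibleDesign Ω f) (hθ : ContinuousOn θ Ω) (hθΘ : ∀ x ∈ Ω, θ x ∈ F.Θ)
    (hXY : IsSample P F Ω f θ X Y)
    (hβ : ∀ n ω (i : Fin n), IsLocalMLE F K (h n) (fun j : Fin n => X j ω)
      (fun j : Fin n => Y j ω) (X i ω) (βhat n ω i))
    (hpos : ∀ n, 0 < h n) (hzero : Tendsto h atTop (𝓝 0))
    (hinf : Tendsto (fun n : ℕ => (n : ℝ) * h n) atTop atTop) :
    TendstoInMeasure P (fun n ω =>
      h n * degreesOfFreedom F K (h n) (fun j : Fin n => X j ω) (βhat n ω)) atTop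
      (fun _ => equivalentKernel K p 0 * volume.real Ω) := by
  obtain ⟨C, hC1, hC⟩ := hK.exists_support
  obtain ⟨T, hT, hhat⟩ := exists_hat_close (p := p) hb hb'' hK hK0 hΩ hθ hθΘ hC hC1
  obtain ⟨M, hM, hMb⟩ := hΩ.exists_bound
  obtain ⟨d, hd, hfd⟩ := hΩ.bounded_below
  obtain ⟨A, hA, hbdry⟩ := hΩ.exists_boundary
  obtain ⟨lS, hlS, hS⟩ := hK.exists_le_momentMatrix hK0 p
  set κ := equivalentKernel K p 0 with hκ
  have hκ0 : 0 ≤ κ := by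
    rw [hκ, equivalentKernel_zero]
    exact mul_nonneg (inv_zero_zero_pos hlS hS).le hK0.le
  rw [tendstoInMeasure_iff_norm]
  intro ε hε
  have hε3 : 0 < ε / 3 := by positivity
  obtain ⟨e, he, h₁, hh₁, hclose⟩ := hhat (ε / 3) hε3
  obtain ⟨D, hD, c, hc, hbad⟩ := hXY.exists_measure_not_isGood_le hb hb'' hK hΩ hθ hθΘ p he
  have hmem := hXY.ae_mem hΩ hb.continuousOn hθ hθΘ
  have havg := tendstoInMeasure_iff_norm.1
    (hXY.tendstoInMeasure_average hΩ hb.continuousOn hθ hθΘ κ) (ε / 3) hε3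
  have hrest := tendsto_boundary_add_bad hzero hinf ((T + κ / d) * (M * (A * C))) (κ / d) D c
    (ε / 3) hc
  have hsum := havg.add hrest
  rw [add_zero] at hsum
  refine tendsto_of_tendsto_of_tendsto_of_le_of_le' tendsto_const_nhds hsum
    (Filter.Eventually.of_forall fun _ => zero_le) ?_
  filter_upwards [hzero.eventually (ge_mem_nhds hh₁), eventually_gt_atTop 0] with n hn hn0
  have hh := hpos n
  have hn' : (0 : ℝ) < n := by exact_mod_cast hn0
  obtain ⟨E, hEm, hEv, hE⟩ := hbdry (C * h n) (by positivity)
  set bad : Fin n → Set Ω₀ := fun i => {ω | (∀ j : Fin n, X j ω ∈ Ω) ∧ ¬ IsGood F K Ω f θ p (h n) e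
        (fun j : Fin n => X j ω) (fun j : Fin n => Y j ω) (X i ω)} with hbaddef
  -- The measurable hull has the same measure, so measurability of the bad event need not be
  -- established.
  set B : Fin n → Set Ω₀ := fun i => toMeasurable P (bad i) with hBdef
  have hmarkov := measure_average_indicators_ge_le (P := P) hn0 (D := fun i : Fin n => X i ⁻¹' E)
    (B := B) (fun i => hXY.measurable_X i hEm) (fun i => measurableSet_toMeasurable _ _)
    (a := T + κ / d) (b := n * h n + κ / d) (u := M * (A * (C * h n)))
    (v := D * Real.exp (-(c * (n * h n)))) (by positivity) (by positivity) (by positivity)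
    (by positivity) (fun i => by
      refine (hXY.measure_X_mem_le hΩ hb.continuousOn hθ hθΘ hMb hEm i).trans ?_
      rw [ENNReal.ofReal_mul hM.le]
      gcongr)
    (fun i => by
      rw [hBdef, measure_toMeasurable]
      exact hbad n (h n) hh i) hε3
  have hbound : ∀ᵐ ω ∂P, ω ∈ {ω | ε ≤ ‖h n * degreesOfFreedom F K (h n)
      (fun j : Fin n => X j ω) (βhat n ω) - κ * volume.real Ω‖} →
      ω ∈ {ω | ε / 3 ≤ ‖(∑ i : Fin n, Ω.indicator (fun x => κ / f x) (X i ω)) / n -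
        κ * volume.real Ω‖} ∪
      {ω | ε / 3 ≤ (∑ i : Fin n, ((X i ⁻¹' E).indicator (fun _ => T + κ / d) ω +
        (B i).indicator (fun _ => n * h n + κ / d) ω)) / n} := by
    filter_upwards [hmem] with ω hω hωε
    by_contra hcon
    simp only [Set.mem_union, Set.mem_ofPred_eq, not_or, not_le] at hcon
    refine absurd hωε (not_le.2 ?_)
    set t : Fin n → ℝ := fun i => n * h n *
      hatMatrix F K (h n) (fun j : Fin n => X j ω) (X i ω) (βhat n ω i) i i with ht
    have hdof : h n * degreesOfFreedom F K (h n) (fun j : Fin n => X j ω) (βhat n ω) =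
        (∑ i, t i) / n := by
      rw [ht, ← Finset.mul_sum, degreesOfFreedom]
      field_simp
    -- Three cases: at good interior points the error is at most `ε / 3`; at good boundary points
    -- both quantities are bounded, by `T` and `κ / d`; at bad points `H_i ≤ 1` gives `n h + κ / d`.
    have hterm : ∀ i : Fin n, |t i - Ω.indicator (fun x => κ / f x) (X i ω)| ≤ ε / 3 +
        ((X i ⁻¹' E).indicator (fun _ => T + κ / d) ω +
          (B i).indicator (fun _ => n * h n + κ / d) ω) := by
      intro i
      have hfi := hfd _ (hω i)
      have hfi0 : 0 < f (X i ω) := hd.trans_le hfi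
      rw [Set.indicator_of_mem (hω i)]
      have hτ0 : 0 ≤ κ / f (X i ω) := by positivity
      have hτ1 : κ / f (X i ω) ≤ κ / d := by gcongr
      have hH := hatMatrix_diag_mem_Icc (X := fun j : Fin n => X j ω) (i := i) rfl
        (weight_nonneg hb hK.nonneg hh (hβ n ω i).1)
      have ht0 : 0 ≤ t i := mul_nonneg (by positivity) hH.1
      have ht1 : t i ≤ n * h n := by
        have := mul_le_mul_of_nonneg_left hH.2 (by positivity : 0 ≤ (n : ℝ) * h n)
        rwa [mul_one] at this
      have hi1 : 0 ≤ (X i ⁻¹' E).indicator (fun _ => T + κ / d) ω :=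
        Set.indicator_nonneg (fun _ _ => by positivity) _
      have hi2 : 0 ≤ (B i).indicator (fun _ => n * h n + κ / d) ω :=
        Set.indicator_nonneg (fun _ _ => by positivity) _
      by_cases hgood : IsGood F K Ω f θ p (h n) e
        (fun j : Fin n => X j ω) (fun j : Fin n => Y j ω) (X i ω)
      · obtain ⟨hle, hcl⟩ := hclose n (h n) hh hn (fun j : Fin n => X j ω)
          (fun j : Fin n => Y j ω) (fun j => hω j) i (βhat n ω i) (hβ n ω i) hgood
        by_cases hEi : X i ω ∈ E
        · have h5 : (X i ⁻¹' E).indicator (fun _ => T + κ / d) ω = T + κ / d :=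
            Set.indicator_of_mem (show ω ∈ X i ⁻¹' E from hEi) _
          rw [h5, abs_le]
          have hle' : t i ≤ T := hle
          constructor <;> linarith
        · have hcl' : |t i - κ / f (X i ω)| ≤ ε / 3 := hcl (hE _ (hω i) hEi)
          linarith
      · have h5 : (B i).indicator (fun _ => n * h n + κ / d) ω = n * h n + κ / d :=
          Set.indicator_of_mem (subset_toMeasurable P (bad i) ⟨fun j => hω j, hgood⟩) _
        rw [h5, abs_le]
        constructor <;> linarith
    have h6 : |(∑ i, t i) / n - (∑ i : Fin n, Ω.indicator (fun x => κ / f x) (X i ω)) / n| ≤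
        ε / 3 + (∑ i : Fin n, ((X i ⁻¹' E).indicator (fun _ => T + κ / d) ω +
        (B i).indicator (fun _ => n * h n + κ / d) ω)) / n := by
      rw [← sub_div, ← Finset.sum_sub_distrib, abs_div, abs_of_pos hn', div_le_iff₀ hn', add_mul,
        div_mul_cancel₀ _ hn'.ne']
      refine (Finset.abs_sum_le_sum_abs _ _).trans
        ((Finset.sum_le_sum fun i _ => hterm i).trans (le_of_eq ?_))
      rw [Finset.sum_add_distrib, Finset.sum_const, Finset.card_univ, Fintype.card_fin,
        nsmul_eq_mul, mul_comm]
    rw [hdof, Real.norm_eq_abs]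
    have h7 := abs_sub_le ((∑ i, t i) / n)
      ((∑ i : Fin n, Ω.indicator (fun x => κ / f x) (X i ω)) / n) (κ * volume.real Ω)
    have h8 := hcon.1
    rw [Real.norm_eq_abs] at h8
    linarith [hcon.2]
  refine (measure_mono_ae hbound).trans ((measure_union_le _ _).trans ?_)
  refine add_le_add le_rfl (hmarkov.trans (le_of_eq ?_))
  congr 2
  ring

end Assembly

end LocalLikelihood

end

/-! ### From convergence of `h ∑ H_i` to the relative error. -/

theorem proposition4 {Ω₀ : Type*} [MeasurableSpace Ω₀] (P : Measure Ω₀) [IsProbabilityMeasure P]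
    (F : LocalLikelihood.ExpFamily) (p : ℕ) (K : ℝ → ℝ) (Ω : Set ℝ) (f θ : ℝ → ℝ)
    (X Y : ℕ → Ω₀ → ℝ) (h : ℕ → ℝ)
    (βhat : (n : ℕ) → Ω₀ → Fin n → Fin (p + 1) → ℝ)
    (hb : ContDiffOn ℝ 2 F.b F.Θ)
    (hb'' : ∃ δ > 0, ∀ x ∈ Ω, δ ≤ F.b'' (θ x))
    (hK : LocalLikelihood.IsAdmissibleKernel K)
    (hΩ : LocalLikelihood.IsAdmissibleDesign Ω f)
    (hθ : ContDiffOn ℝ ((p + 1 : ℕ) : WithTop ℕ∞) θ Ω)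
    (hθΘ : ∀ x ∈ Ω, θ x ∈ F.Θ)
    (hXY : LocalLikelihood.IsSample P F Ω f θ X Y)
    (hβ : ∀ n ω (i : Fin n), LocalLikelihood.IsLocalMLE F K (h n)
      (fun j : Fin n => X j ω) (fun j : Fin n => Y j ω) (X i ω) (βhat n ω i))
    (hpos : ∀ n, 0 < h n)
    (hzero : Tendsto h atTop (𝓝 0))
    (hinf : Tendsto (fun n : ℕ => (n : ℝ) * h n) atTop atTop) :
    ∃ R : ℕ → Ω₀ → ℝ,
      TendstoInMeasure P R atTop (fun _ => 0) ∧
      ∀ n ω, LocalLikelihood.degreesOfFreedom F K (h n) (fun j : Fin n => X j ω) (βhat n ω) =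
        LocalLikelihood.equivalentKernel K p 0 * volume.real Ω / h n * (1 + R n ω) := by
  have hθc := hθ.continuousOn
  have hvol := hXY.volume_pos hΩ hb.continuousOn hθc hθΘ
  -- If `K 0 = 0`, every observation has zero weight at its own point, so both sides vanish and `R =
  -- 0` will do. Otherwise the limit is positive and can be divided by.
  rcases (hK.nonneg 0).eq_or_lt with hK0 | hK0
  · refine ⟨fun _ _ => 0, ?_, fun n ω => ?_⟩
    · exact tendstoInMeasure_of_tendsto_ae (fun _ => aestronglyMeasurable_const)
        (Filter.Eventually.of_forall fun _ => tendsto_const_nhds)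
    · rw [LocalLikelihood.degreesOfFreedom_eq_zero hK0.symm, LocalLikelihood.equivalentKernel_zero,
        ← hK0]
      simp
  · obtain ⟨l, hl, hS⟩ := hK.exists_le_momentMatrix hK0 p
    set A := LocalLikelihood.equivalentKernel K p 0 * volume.real Ω with hA
    have hApos : 0 < A := by
      rw [hA, LocalLikelihood.equivalentKernel_zero]
      exact mul_pos (mul_pos (LocalLikelihood.inv_zero_zero_pos hl hS) hK0) hvol
    have hlim := tendstoInMeasure_iff_norm.1
      (LocalLikelihood.tendstoInMeasure_mul_degreesOfFreedom hb hb'' hK hK0 hΩ hθc hθΘ hXY hβ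
        hpos hzero hinf)
    refine ⟨fun n ω => (h n * LocalLikelihood.degreesOfFreedom F K (h n)
      (fun j : Fin n => X j ω) (βhat n ω) - A) / A, ?_, fun n ω => ?_⟩
    · rw [tendstoInMeasure_iff_norm]
      intro ε hε
      refine (hlim (ε * A) (by positivity)).congr fun n => ?_
      congr 1
      ext ω
      simp only [Set.mem_ofPred_eq, sub_zero]
      rw [norm_div, Real.norm_of_nonneg hApos.le, le_div_iff₀ hApos]
    · have := (hpos n).ne'
      field_simp
      ring
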